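/- **Theorem (Bandits with Vector Costs).** *Setting.* There are $n\ge 1$ actions, $T$ rounds, and a norm $\|\cdot\|$ on $\mathbb R^d$ that is monotone, i.e. $\|v\|\le\|u\|$ whenever $0\le v\le u$ coordinatewise. In round $t$ an adaptive adversary fixes a cost matrix $C^{(t)}\in[0,1]^{d\times n}$, which may depend on the actions played in rounds $1,\dots,t-1$; then the (randomized) algorithm plays $x^{(t)}\in\{e_1,\dots,e_n\}$ and observes only the vector cost $C^{(t)}x^{(t)}$ (bandit feedback). Let $\Delta_n=\{x\in[0,1]^n:\sum_i x_i=1\}$. *Gradient stability.* The norm admits a $\delta$-gradient-stable approximation with error $(\alpha,\gamma)$ if for every $\epsilon>0$ there is a monotone, subadditive, convex, differentiable function $\Psi_\epsilon:\mathbb R^d_+\to\mathbb R$ (with one-sided partial derivatives on the boundary) such that for all $x,y\in\mathbb R^d_+$ $$\nabla\Psi_\epsilon(x+y)\ \ge\ \exp(-\epsilon\|y\|-\delta)\,\nabla\Psi_\epsilon(x)\ \text{ coordinatewise},\qquad \|x\|\le\Psi_\epsilon(x)\le\alpha\|x\|+\frac{\gamma}{\epsilon}.$$ *Claim.* There are a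 single bandit algorithm and universal constants $K,k$ such that the following holds for all $n\ge1$, $d$, $T$, all $p\in(0,1]$, every monotone norm on $\mathbb R^d$, every $\frac14$-gradient-stable approximation $(\Psi_\epsilon)_{\epsilon>0}$ of it with error $(\alpha,\gamma)$, and every adaptive adversary. The algorithm is given $n,d,T,p,\alpha,\gamma$, the number $\|\mathbf 1\|$, and access to a value and gradient oracle $(\epsilon,x)\mapsto\Psi_\epsilon(x),\nabla\Psi_\epsilon(x)$. With probability at least $1-p$, simultaneously for all $x^*\in\Delta_n$, $$\Big\|\sum_{t=1}^T C^{(t)}x^{(t)}\Big\|\ \le\ K\Big((\alpha+\gamma)\,\Big\|\sum_{t=1}^T C^{(t)}x^*\Big\|+\alpha\,\|\mathbf 1\|\sqrt{Tn\log(n/p)}\Big).$$ Moreover, the algorithm is efficient: in all $T$ rounds together it always makes at most $k\,(n+d+T+1)^k$ steps on a real random access machine (unit-cost integer addition, subtraction and comparison, unit-cost real arithmetic with $\exp$, $\log$ and comparison, one uniform random number from $[0,1]$ per round, and $d+1$ steps per oracle call). -/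

import Mathlib

namespace VectorBandits

/-! ### Gradient-stable approximations of norms -/

/-- The nonnegative orthant of `ℝ^d`. -/
def orthant (d : ℕ) : Set (Fin d → ℝ) := {x | ∀ i, 0 ≤ x i}

/-- The gradient at `x`, relative to the nonnegative orthant, of a function on that orthant: its
`i`-th entry is the partial derivative in direction `e_i` (one-sided where `x i = 0`). -/
noncomputable def grad {d : ℕ} (ψ : (Fin d → ℝ) → ℝ) (x : Fin d → ℝ) (i : Fin d) : ℝ :=
  fderivWithin ℝ ψ (orthant d) x (Pi.single i 1)

/-- `N` is a norm on `ℝ^d` (a seminorm that vanishes only at `0`) which is monotone on the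
nonnegative orthant. -/
structure IsMonotoneNorm {d : ℕ} (N : Seminorm ℝ (Fin d → ℝ)) : Prop where
  eq_zero : ∀ x, N x = 0 → x = 0
  mono : ∀ u v : Fin d → ℝ, (∀ i, 0 ≤ v i) → (∀ i, v i ≤ u i) → N v ≤ N u

/-- `ψ` is a `δ`-gradient-stable approximation of the norm `N` at scale `ε`, with multiplicative
error `α` and additive error `γ`. Only the values of `ψ` on the nonnegative orthant matter. -/
structure IsGradStableAt {d : ℕ} (N : Seminorm ℝ (Fin d → ℝ)) (δ α γ ε : ℝ)
    (ψ : (Fin d → ℝ) → ℝ) : Prop where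
  mono : ∀ x ∈ orthant d, ∀ y ∈ orthant d, (∀ i, x i ≤ y i) → ψ x ≤ ψ y
  subadditive : ∀ x ∈ orthant d, ∀ y ∈ orthant d, ψ (x + y) ≤ ψ x + ψ y
  convex : ConvexOn ℝ (orthant d) ψ
  differentiable : DifferentiableOn ℝ ψ (orthant d)
  gradient_stable : ∀ x ∈ orthant d, ∀ y ∈ orthant d, ∀ i,
    Real.exp (-(ε * N y) - δ) * grad ψ x i ≤ grad ψ (x + y) i
  norm_le : ∀ x ∈ orthant d, N x ≤ ψ x
  le_norm : ∀ x ∈ orthant d, ψ x ≤ α * N x + γ / ε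

/-- `Ψ` is a `δ`-gradient-stable approximation of the norm `N` with error `(α, γ)`: a family of
gradient-stable approximations, one at each scale `ε > 0`. -/
def IsGradStableApprox {d : ℕ} (N : Seminorm ℝ (Fin d → ℝ)) (δ α γ : ℝ)
    (Ψ : ℝ → (Fin d → ℝ) → ℝ) : Prop :=
  ∀ ε : ℝ, 0 < ε → IsGradStableAt N δ α γ ε (Ψ ε)

/-! ### A real random access machine with oracle calls and a step count -/

/-- Memory: integer registers, arrays of real numbers (`arr a k` is entry `k` of array `a`), and
the number of steps executed so far. -/
structure Store where
  reg : ℕ → ℕ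
  arr : ℕ → ℕ → ℝ
  steps : ℕ

/-- The address of a real number: the entry of the array `array` whose position is the current
content of the integer register `index`. -/
structure Loc where
  array : ℕ
  index : ℕ

/-- Binary real instructions. -/
inductive BinOp
  | add
  | sub
  | mul
  | div

/-- Unary real instructions. -/
inductive UnOp
  | exp
  | log

/-- Programs. They are finite texts that mention no real constant and do not depend on the sizes of
the input; lengths and positions are read from integer registers at run time. -/
inductive Prog
  /-- do nothing -/
  | skip
  /-- `reg r := k` -/
  | const (r k : ℕ)
  /-- `reg r := reg a + reg b` -/
  | natAdd (r a b : ℕ)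
  /-- `reg r := reg a - reg b` (truncated at zero) -/
  | natSub (r a b : ℕ)
  /-- store the integer `reg r` as a real number -/
  | cast (dst : Loc) (r : ℕ)
  /-- copy a real number -/
  | copy (dst src : Loc)
  /-- `dst := op x` -/
  | un (op : UnOp) (dst x : Loc)
  /-- `dst := op x y` -/
  | bin (op : BinOp) (dst x y : Loc)
  /-- value oracle: `dst := Ψ_ε(x)`, with `x` the first `d` entries of the array `x` -/
  | value (dst ε : Loc) (x : ℕ)
  /-- gradient oracle: first `d` entries of the array `dst` `:= ∇Ψ_ε(x)` -/
  | gradient (dst : ℕ) (ε : Loc) (x : ℕ)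
  /-- one program after the other -/
  | seq (P Q : Prog)
  /-- branch on `reg a < reg b` -/
  | ifNat (a b : ℕ) (P Q : Prog)
  /-- branch on `x < y`, for real numbers -/
  | ifReal (x y : Loc) (P Q : Prog)
  /-- repeat the body `reg r` times (`reg r` as it is on entry) -/
  | loop (r : ℕ) (P : Prog)

namespace Store

/-- The real number stored at an address. -/
def get (s : Store) (l : Loc) : ℝ := s.arr l.array (s.reg l.index)

/-- The vector formed by the first `d` entries of an array. -/
def vec (s : Store) (d a : ℕ) : Fin d → ℝ := fun i => s.arr a i

/-- Charge `k` steps. -/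
def tick (s : Store) (k : ℕ) : Store := { s with steps := s.steps + k }

/-- Write an integer register. -/
def setReg (s : Store) (r v : ℕ) : Store := { s with reg := Function.update s.reg r v }

/-- Write a real number at position `k` of array `a`. -/
def setEntry (s : Store) (a k : ℕ) (v : ℝ) : Store :=
  { s with arr := Function.update s.arr a (Function.update (s.arr a) k v) }

/-- Write a real number at an address. -/
def set (s : Store) (l : Loc) (v : ℝ) : Store := s.setEntry l.array (s.reg l.index) v

/-- Write a vector into the first `d` entries of an array. -/
def setVec (s : Store) {d : ℕ} (a : ℕ) (v : Fin d → ℝ) : Store :=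
  let row : ℕ → ℝ := fun k => if h : k < d then v ⟨k, h⟩ else s.arr a k
  { s with arr := Function.update s.arr a row }

end Store

/-- Meaning of a unary instruction. -/
noncomputable def UnOp.eval : UnOp → ℝ → ℝ
  | .exp, x => Real.exp x
  | .log, x => Real.log x

/-- Meaning of a binary instruction. -/
noncomputable def BinOp.eval : BinOp → ℝ → ℝ → ℝ
  | .add, x, y => x + y
  | .sub, x, y => x - y
  | .mul, x, y => x * y
  | .div, x, y => x / y

/-- Execution with value and gradient oracles for the family `Ψ`. Each elementary instruction, each
test and each loop iteration costs one step, an oracle call costs `d + 1` steps. -/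
noncomputable def Prog.exec {d : ℕ} (Ψ : ℝ → (Fin d → ℝ) → ℝ) : Prog → Store → Store
  | .skip, s => s.tick 1
  | .const r k, s => (s.setReg r k).tick 1
  | .natAdd r a b, s => (s.setReg r (s.reg a + s.reg b)).tick 1
  | .natSub r a b, s => (s.setReg r (s.reg a - s.reg b)).tick 1
  | .cast dst r, s => (s.set dst (s.reg r : ℝ)).tick 1
  | .copy dst src, s => (s.set dst (s.get src)).tick 1
  | .un op dst x, s => (s.set dst (op.eval (s.get x))).tick 1
  | .bin op dst x y, s => (s.set dst (op.eval (s.get x) (s.get y))).tick 1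
  | .value dst ε x, s => (s.set dst (Ψ (s.get ε) (s.vec d x))).tick (d + 1)
  | .gradient dst ε x, s => (s.setVec dst (grad (Ψ (s.get ε)) (s.vec d x))).tick (d + 1)
  | .seq P Q, s => Q.exec Ψ (P.exec Ψ s)
  | .ifNat a b P Q, s => if s.reg a < s.reg b then P.exec Ψ (s.tick 1) else Q.exec Ψ (s.tick 1)
  | .ifReal x y P Q, s =>
      open Classical in
      if s.get x < s.get y then P.exec Ψ (s.tick 1) else Q.exec Ψ (s.tick 1)
  | .loop r P, s => (fun t => P.exec Ψ (Store.tick t 1))^[s.reg r] (s.tick 1)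

/-! ### Bandits with vector costs -/

/-- A bandit algorithm: a program run once at the start, a program that selects the arm of each
round, and a program that processes the feedback of each round. -/
structure BanditAlgorithm where
  init : Prog
  select : Prog
  update : Prog

/-- The parameters known to the algorithm before the first round: the number `n` of actions, the
dimension `d`, the horizon `T`, the failure probability `p`, the errors `α`, `γ` of the
gradient-stable approximation, and the norm `‖1‖` of the all-ones vector. -/
structure Params where
  n : ℕ
  d : ℕ
  T : ℕ
  p : ℝ
  α : ℝ
  γ : ℝ
  normOne : ℝ

/-- The initial memory: registers `1, 2, 3` hold `n, d, T`, array `0` starts with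
`p, α, γ, ‖1‖`, and everything else is zero. -/
def Params.store (q : Params) : Store where
  reg := fun r => if r = 1 then q.n else if r = 2 then q.d else if r = 3 then q.T else 0
  arr := fun a k => if a = 0 then
      (if k = 0 then q.p else if k = 1 then q.α else if k = 2 then q.γ
        else if k = 3 then q.normOne else 0)
    else 0
  steps := 0

/-- An adaptive adversary: it picks the cost matrix of a round as a function of the actions that
the algorithm took in the previous rounds (listed with the latest first). -/
abbrev Adversary (d n : ℕ) := List (Fin n) → Matrix (Fin d) (Fin n) ℝ

/-- All costs lie in `[0,1]`. -/
def Adversary.IsBounded {d n : ℕ} (C : Adversary d n) : Prop :=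
  ∀ h i j, C h i j ∈ Set.Icc (0 : ℝ) 1

/-- The state of the interaction after some rounds: the memory of the algorithm and the list of the
actions taken so far, the latest first. -/
structure Play (n : ℕ) where
  store : Store
  history : List (Fin n)

/-- Memory after the selection step of a round: the fresh random number `u` of the round is put
into entry `0` of array `1`, and `select` is run. -/
noncomputable def BanditAlgorithm.selected {d : ℕ} (A : BanditAlgorithm)
    (Ψ : ℝ → (Fin d → ℝ) → ℝ) (u : ℝ) (s : Store) : Store :=
  A.select.exec Ψ (s.setEntry 1 0 u)

/-- The action played: the content of register `0` after the selection step, modulo `n`. -/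
def Store.action (s : Store) (n : ℕ) [NeZero n] : Fin n := Fin.ofNat n (s.reg 0)

/-- One round with random number `u`. The feedback, which is the column of the cost matrix that
belongs to the action played and nothing else, is put into array `2`, and `update` is run. -/
noncomputable def BanditAlgorithm.round {n d : ℕ} [NeZero n] (A : BanditAlgorithm)
    (Ψ : ℝ → (Fin d → ℝ) → ℝ) (C : Adversary d n) (u : ℝ) (g : Play n) : Play n :=
  let s := A.selected Ψ u g.store
  let a := s.action n
  { store := A.update.exec Ψ (s.setVec 2 fun i => C g.history i a)
    history := a :: g.history }

/-- The interaction after `t` rounds, given the random numbers `ω 0, ω 1, …`. -/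
noncomputable def BanditAlgorithm.play {n d : ℕ} [NeZero n] (A : BanditAlgorithm)
    (Ψ : ℝ → (Fin d → ℝ) → ℝ) (q : Params) (C : Adversary d n) (ω : ℕ → unitInterval) :
    ℕ → Play n
  | 0 => { store := A.init.exec Ψ q.store, history := [] }
  | t + 1 => A.round Ψ C (ω t) (A.play Ψ q C ω t)

/-- The cost matrix of round `t` (rounds are numbered from `0`). -/
noncomputable def BanditAlgorithm.costMatrix {n d : ℕ} [NeZero n] (A : BanditAlgorithm)
    (Ψ : ℝ → (Fin d → ℝ) → ℝ) (q : Params) (C : Adversary d n) (ω : ℕ → unitInterval) (t : ℕ) :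
    Matrix (Fin d) (Fin n) ℝ :=
  C (A.play Ψ q C ω t).history

/-- The action taken in round `t`, as a standard unit vector. -/
noncomputable def BanditAlgorithm.actionVector {n d : ℕ} [NeZero n] (A : BanditAlgorithm)
    (Ψ : ℝ → (Fin d → ℝ) → ℝ) (q : Params) (C : Adversary d n) (ω : ℕ → unitInterval) (t : ℕ) :
    Fin n → ℝ :=
  Pi.single ((A.selected Ψ (ω t) (A.play Ψ q C ω t).store).action n) 1

/-- The law of the random numbers: independent and uniform on `[0,1]`. -/
noncomputable def seedLaw : MeasureTheory.Measure (ℕ → unitInterval) :=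
  MeasureTheory.Measure.infinitePi fun _ => MeasureTheory.volume

end VectorBandits

/-!
The algorithm is a learner that runs in two phases.

After the exploration it runs exponential weights on the losses
`ℓ i = (Ψ_ε (Λ + C e_i) - Ψ_ε Λ) / (α ‖1‖)`, where `Λ` is the load accumulated so far. They lie in
`[0, 1]`, because stretching an increment and letting its additive error become negligible gives
`Ψ_ε (x + y) - Ψ_ε x ≤ α ‖y‖` (`IsGradStableAt.increment_le`). The losses of the algorithm telescope
to the increase of the potential, and two value queries reveal the loss of the arm that was played.
The loss of a comparator is, by convexity and gradient stability, at most
`exp (3 / 8)` times a derivative of `Ψ_ε` at the sum of the loads of the algorithm and of the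
comparator, and the derivatives for the algorithm and the comparator together telescope
(`Regime.comparator_step`). Hence the potential `V` at the end satisfies
`2 V ≤ exp (3 / 8) V + O((α + γ) ‖S‖ + α ‖1‖ √(T n log (n / p)))` if `ε` is about `1 / ‖S‖`, where `S`
is the load of the comparator, and `exp (3 / 8) < 2`. As `‖S‖` is unknown, it is guessed, and a stage
is given up and the guess doubled as soon as the potential exceeds what a correct guess would allow
(`Regime.guess_lt_of_bound_lt`). The observed losses are estimated by implicit exploration, a
downward bias that makes the average over the arms of `exp (η (estimated loss - loss))` a
supermartingale. A single supermartingale serves all stages (`Ledger.value`): stage `k` gets the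
budget `2 ^ (-(k + 1))`. By Markov's inequality it stays below `1 / p` with probability at least
`1 - p`.

A gradient-stable approximation has an additive error `γ / ε ≥ γ ‖1‖` for all useful `ε`, while the
theorem only allows an additive error without `γ`. The deterministic exploration therefore makes
sure that either the load of the algorithm is `O(α ‖1‖ √(T n log (n / p)))`, or every comparator has
a load of norm greater than `‖1‖`. It plays all remaining arms equally often in batches, prices what
an arm has contributed to the load of a batch with the gradient of a potential with negligible
additive error, discounts the prices harmonically, and drops an arm when its score is large. A
comparator with a small load accumulates only a logarithmic score, so some of its arms survive
(`Regime.norm_lt_of_dropped`), and the price of what is played stays bounded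
(`Regime.norm_total_explore_le`).

The probabilistic part needs no measurability of the interaction: a history of positive
probability satisfies the invariants (`Regime.runInv`), and the random numbers that lead to a given
history lie in a box whose volume is at most the product of the probabilities of its actions
(`seedLaw_history_le`), so all expectations are finite sums over histories. The program represents
the learner exactly (`play_represents`), and it is efficient because its loops have the lengths `n`
and `d` (`BanditAlgorithm.exists_steps_le`).
-/

/-! ### Programs: frames, loops and running time -/

namespace VectorBandits

namespace Store

@[simp] theorem tick_reg (s : Store) (k : ℕ) : (s.tick k).reg = s.reg := rfl
@[simp] theorem tick_arr (s : Store) (k : ℕ) : (s.tick k).arr = s.arr := rfl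
@[simp] theorem tick_steps (s : Store) (k : ℕ) : (s.tick k).steps = s.steps + k := rfl
@[simp] theorem setReg_reg (s : Store) (r v : ℕ) :
    (s.setReg r v).reg = Function.update s.reg r v := rfl
@[simp] theorem setReg_arr (s : Store) (r v : ℕ) : (s.setReg r v).arr = s.arr := rfl
@[simp] theorem setReg_steps (s : Store) (r v : ℕ) : (s.setReg r v).steps = s.steps := rfl
@[simp] theorem setEntry_reg (s : Store) (a k : ℕ) (v : ℝ) : (s.setEntry a k v).reg = s.reg := rfl
@[simp] theorem setEntry_arr (s : Store) (a k : ℕ) (v : ℝ) :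
    (s.setEntry a k v).arr = Function.update s.arr a (Function.update (s.arr a) k v) := rfl
@[simp] theorem setEntry_steps (s : Store) (a k : ℕ) (v : ℝ) :
    (s.setEntry a k v).steps = s.steps := rfl
@[simp] theorem set_reg (s : Store) (l : Loc) (v : ℝ) : (s.set l v).reg = s.reg := rfl
@[simp] theorem set_arr (s : Store) (l : Loc) (v : ℝ) :
    (s.set l v).arr = Function.update s.arr l.array
      (Function.update (s.arr l.array) (s.reg l.index) v) := rfl
@[simp] theorem set_steps (s : Store) (l : Loc) (v : ℝ) : (s.set l v).steps = s.steps := rfl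
@[simp] theorem setVec_reg (s : Store) {d : ℕ} (a : ℕ) (v : Fin d → ℝ) :
    (s.setVec a v).reg = s.reg := rfl
@[simp] theorem setVec_steps (s : Store) {d : ℕ} (a : ℕ) (v : Fin d → ℝ) :
    (s.setVec a v).steps = s.steps := rfl

theorem setVec_arr_self (s : Store) {d : ℕ} (a : ℕ) (v : Fin d → ℝ) (j : Fin d) :
    (s.setVec a v).arr a j = v j := by
  simp [setVec]

theorem setVec_arr_of_ne (s : Store) {d : ℕ} {a b : ℕ} (v : Fin d → ℝ) (h : b ≠ a) :
    (s.setVec a v).arr b = s.arr b := by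
  simp [setVec, h]

end Store

namespace Prog

variable {d : ℕ} (Ψ : ℝ → (Fin d → ℝ) → ℝ)

/-- The integer registers that a program may write. -/
def regW : Prog → List ℕ
  | const r _ => [r]
  | natAdd r _ _ => [r]
  | natSub r _ _ => [r]
  | seq P Q => P.regW ++ Q.regW
  | ifNat _ _ P Q => P.regW ++ Q.regW
  | ifReal _ _ P Q => P.regW ++ Q.regW
  | loop _ P => P.regW
  | _ => []

/-- The arrays that a program may write. -/
def arrW : Prog → List ℕ
  | cast l _ => [l.array]
  | copy l _ => [l.array]
  | un _ l _ => [l.array]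
  | bin _ l _ _ => [l.array]
  | value l _ _ => [l.array]
  | gradient a _ _ => [a]
  | seq P Q => P.arrW ++ Q.arrW
  | ifNat _ _ P Q => P.arrW ++ Q.arrW
  | ifReal _ _ P Q => P.arrW ++ Q.arrW
  | loop _ P => P.arrW
  | _ => []

/-- The registers that hold the lengths of the loops of a program. -/
def loopR : Prog → List ℕ
  | seq P Q => P.loopR ++ Q.loopR
  | ifNat _ _ P Q => P.loopR ++ Q.loopR
  | ifReal _ _ P Q => P.loopR ++ Q.loopR
  | loop r P => r :: P.loopR
  | _ => []

variable {Ψ}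

theorem exec_seq (P Q : Prog) (s : Store) : (seq P Q).exec Ψ s = Q.exec Ψ (P.exec Ψ s) := rfl

theorem exec_reg (P : Prog) (s : Store) {r : ℕ} (h : r ∉ P.regW) :
    (P.exec Ψ s).reg r = s.reg r := by
  induction P generalizing s with
  | seq P Q hP hQ =>
    simp only [regW, List.mem_append, not_or] at h
    rw [exec_seq, hQ _ h.2, hP _ h.1]
  | ifNat a b P Q hP hQ =>
    simp only [regW, List.mem_append, not_or] at h
    unfold exec
    split_ifs
    · rw [hP _ h.1]; rfl
    · rw [hQ _ h.2]; rfl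
  | ifReal a b P Q hP hQ =>
    simp only [regW, List.mem_append, not_or] at h
    unfold exec
    split_ifs
    · rw [hP _ h.1]; rfl
    · rw [hQ _ h.2]; rfl
  | loop a P hP =>
    have key : ∀ (m : ℕ) (t : Store),
        ((fun t => P.exec Ψ (Store.tick t 1))^[m] t).reg r = t.reg r := by
      intro m
      induction m with
      | zero => intro t; rfl
      | succ m ih => intro t; rw [Function.iterate_succ_apply, ih, hP _ h]; rfl
    unfold exec
    rw [key]; rfl
  | _ => simp_all [exec, regW]

theorem exec_arr (P : Prog) (s : Store) {a : ℕ} (h : a ∉ P.arrW) :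
    (P.exec Ψ s).arr a = s.arr a := by
  induction P generalizing s with
  | seq P Q hP hQ =>
    simp only [arrW, List.mem_append, not_or] at h
    rw [exec_seq, hQ _ h.2, hP _ h.1]
  | ifNat i j P Q hP hQ =>
    simp only [arrW, List.mem_append, not_or] at h
    unfold exec
    split_ifs
    · rw [hP _ h.1]; rfl
    · rw [hQ _ h.2]; rfl
  | ifReal x y P Q hP hQ =>
    simp only [arrW, List.mem_append, not_or] at h
    unfold exec
    split_ifs
    · rw [hP _ h.1]; rfl
    · rw [hQ _ h.2]; rfl
  | loop r P hP =>
    have key : ∀ (m : ℕ) (t : Store),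
        ((fun t => P.exec Ψ (Store.tick t 1))^[m] t).arr a = t.arr a := by
      intro m
      induction m with
      | zero => intro t; rfl
      | succ m ih => intro t; rw [Function.iterate_succ_apply, ih, hP _ h]; rfl
    unfold exec
    rw [key]; rfl
  | gradient b ε x =>
    simp only [arrW, List.mem_singleton] at h
    simp [exec, Store.setVec_arr_of_ne _ _ h]
  | _ => simp_all [exec, arrW]

/-- Invariant rule for loops. -/
theorem exec_loop_inv {r : ℕ} {P : Prog} {s : Store} (Inv : ℕ → Store → Prop)
    (h0 : Inv 0 (s.tick 1))
    (hs : ∀ k t, k < s.reg r → Inv k t → Inv (k + 1) (P.exec Ψ (t.tick 1))) :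
    Inv (s.reg r) ((loop r P).exec Ψ s) := by
  have key : ∀ m, m ≤ s.reg r →
      Inv m ((fun t => P.exec Ψ (Store.tick t 1))^[m] (s.tick 1)) := by
    intro m
    induction m with
    | zero => intro _; exact h0
    | succ m ih =>
      intro hm
      rw [Function.iterate_succ_apply']
      exact hs m _ hm (ih (by omega))
  exact key _ le_rfl

/-- `for i in 0, …, reg r - 1 do P`; register `5` is expected to hold the number one. -/
def forLoop (r i : ℕ) (P : Prog) : Prog :=
  seq (const i 0) (loop r (seq P (natAdd i i 5)))

/-- Invariant rule for counting loops. The invariant only has to speak about what the body writes: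
everything else is known to be unchanged. -/
theorem exec_for {r i : ℕ} {P : Prog} {s : Store} (Inv : ℕ → Store → Prop) (m : ℕ)
    (hm : s.reg r = m) (h5 : s.reg 5 = 1)
    (hi : i ∉ 5 :: r :: P.regW) (h5W : 5 ∉ P.regW)
    (h0 : ∀ t : Store, t.arr = s.arr → (∀ r', r' ≠ i → t.reg r' = s.reg r') → Inv 0 t)
    (hs : ∀ (k : ℕ) (t t' : Store), k < m → t.reg i = k →
      (∀ r', r' ∉ i :: P.regW → t.reg r' = s.reg r') →
      (∀ a, a ∉ P.arrW → t.arr a = s.arr a) →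
      t'.arr = (P.exec Ψ t).arr → (∀ r', r' ≠ i → t'.reg r' = (P.exec Ψ t).reg r') →
      Inv k t → Inv (k + 1) t') :
    Inv m ((forLoop r i P).exec Ψ s) := by
  simp only [List.mem_cons, not_or] at hi
  have hreg : ((const i 0).exec Ψ s).reg r = m := by
    simp [exec, Function.update_of_ne (Ne.symm hi.2.1), hm]
  have := exec_loop_inv (Ψ := Ψ) (r := r) (P := seq P (natAdd i i 5))
    (s := (const i 0).exec Ψ s)
    (fun k t => t.reg i = k ∧ (∀ r', r' ∉ i :: P.regW → t.reg r' = s.reg r') ∧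
      (∀ a, a ∉ P.arrW → t.arr a = s.arr a) ∧
      ∀ t' : Store, t'.arr = t.arr → (∀ r', r' ≠ i → t'.reg r' = t.reg r') → Inv k t') ?_ ?_
  · rw [hreg] at this
    exact this.2.2.2 _ rfl fun _ _ => rfl
  · refine ⟨by simp [exec], ?_, ?_, fun t' e1 e2 => h0 _ e1 ?_⟩
    · intro r' hr'
      simp only [List.mem_cons, not_or] at hr'
      simp [exec, Function.update_of_ne hr'.1]
    · intro a _; rfl
    · intro r' hr'
      rw [e2 r' hr']
      simp [exec, Function.update_of_ne hr']
  · rintro k t hk ⟨h1, h2, h3, h4⟩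
    rw [hreg] at hk
    have e5 : (P.exec Ψ (t.tick 1)).reg 5 = 1 := by
      rw [exec_reg P _ h5W, Store.tick_reg, h2 5 (by simp [Ne.symm hi.1, h5W]), h5]
    have ei : (P.exec Ψ (t.tick 1)).reg i = k := by
      rw [exec_reg P _ hi.2.2, Store.tick_reg, h1]
    refine ⟨?_, ?_, ?_, ?_⟩
    · simp [exec, e5, ei]
    · intro r' hr'
      have hr2 := hr'
      simp only [List.mem_cons, not_or] at hr'
      simp only [exec, Store.tick_reg, Store.setReg_reg]
      rw [Function.update_of_ne hr'.1, exec_reg P _ hr'.2]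
      exact h2 r' hr2
    · intro a ha
      simp only [exec, Store.tick_arr, Store.setReg_arr]
      rw [exec_arr P _ ha]
      exact h3 a ha
    · intro t' e1 e2
      refine hs k (t.tick 1) _ hk h1 h2 h3 e1 ?_ (h4 _ rfl fun _ _ => rfl)
      intro r' hr'
      rw [e2 r' hr']
      simp [exec, Function.update_of_ne hr']

/-- An upper bound for the number of steps, when the loop registers hold the values `v`. -/
def cost (d : ℕ) (v : ℕ → ℕ) : Prog → ℕ
  | value _ _ _ => d + 1
  | gradient _ _ _ => d + 1
  | seq P Q => P.cost d v + Q.cost d v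
  | ifNat _ _ P Q => 1 + (P.cost d v + Q.cost d v)
  | ifReal _ _ P Q => 1 + (P.cost d v + Q.cost d v)
  | loop r P => 1 + v r * (1 + P.cost d v)
  | _ => 1

theorem exec_steps_le (P : Prog) (v : ℕ → ℕ) (s : Store) (hW : ∀ r ∈ P.loopR, s.reg r = v r)
    (L : List ℕ) (hL : ∀ r ∈ P.loopR, r ∈ L) (hP : ∀ r ∈ L, r ∉ P.regW) :
    (P.exec Ψ s).steps ≤ s.steps + P.cost d v := by
  induction P generalizing s with
  | seq P Q ihP ihQ =>
    simp only [loopR, regW, List.mem_append, not_or] at hW hL hP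
    have h1 := ihP s (fun r h => hW r (.inl h)) (fun r h => hL r (.inl h))
      (fun r h => (hP r h).1)
    have h2 := ihQ (P.exec Ψ s)
      (fun r h => by rw [exec_reg P s (hP r (hL r (.inr h))).1, hW r (.inr h)])
      (fun r h => hL r (.inr h)) (fun r h => (hP r h).2)
    rw [exec_seq]
    simp only [cost]
    omega
  | ifNat a b P Q ihP ihQ =>
    simp only [loopR, regW, List.mem_append, not_or] at hW hL hP
    have h1 := ihP (s.tick 1) (fun r h => hW r (.inl h)) (fun r h => hL r (.inl h))
      (fun r h => (hP r h).1)
    have h2 := ihQ (s.tick 1) (fun r h => hW r (.inr h)) (fun r h => hL r (.inr h))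
      (fun r h => (hP r h).2)
    simp only [Store.tick_steps] at h1 h2
    unfold exec
    simp only [cost]
    split_ifs <;> omega
  | ifReal a b P Q ihP ihQ =>
    simp only [loopR, regW, List.mem_append, not_or] at hW hL hP
    have h1 := ihP (s.tick 1) (fun r h => hW r (.inl h)) (fun r h => hL r (.inl h))
      (fun r h => (hP r h).1)
    have h2 := ihQ (s.tick 1) (fun r h => hW r (.inr h)) (fun r h => hL r (.inr h))
      (fun r h => (hP r h).2)
    simp only [Store.tick_steps] at h1 h2
    unfold exec
    simp only [cost]
    split_ifs <;> omega
  | loop r P ih =>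
    simp only [loopR, regW, List.mem_cons] at hW hL hP
    have key := exec_loop_inv (Ψ := Ψ) (r := r) (P := P) (s := s)
      (fun k t => (∀ r ∈ P.loopR, t.reg r = v r) ∧
        t.steps ≤ s.steps + 1 + k * (1 + P.cost d v)) ?_ ?_
    · have h := key.2
      rw [hW r (.inl rfl)] at h
      simp only [cost]
      omega
    · exact ⟨fun r h => hW r (.inr h), by simp⟩
    · rintro k t _ ⟨h1, h2⟩
      have h3 := ih (t.tick 1) h1 (fun r h => hL r (.inr h)) hP
      simp only [Store.tick_steps] at h3
      refine ⟨fun r h => ?_, ?_⟩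
      · rw [exec_reg P _ (hP r (hL r (.inr h)))]
        exact h1 r h
      · rw [add_mul]
        omega
  | _ => simp [exec, cost]

/-- Loops whose lengths are bounded by `X` take time polynomial in `X`. -/
theorem exists_cost_le (P : Prog) : ∃ k : ℕ, ∀ (d X : ℕ) (v : ℕ → ℕ), 1 ≤ X → d + 1 ≤ X →
    (∀ r ∈ P.loopR, v r ≤ X) → P.cost d v ≤ k * X ^ k := by
  have mono : ∀ (k l X : ℕ), 1 ≤ X → k ≤ l → k * X ^ k ≤ l * X ^ l := fun k l X h1 h =>
    Nat.mul_le_mul h (Nat.pow_le_pow_right h1 h)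
  have pair : ∀ P Q : Prog,
      (∃ k : ℕ, ∀ (d X : ℕ) (v : ℕ → ℕ), 1 ≤ X → d + 1 ≤ X →
        (∀ r ∈ P.loopR, v r ≤ X) → P.cost d v ≤ k * X ^ k) →
      (∃ k : ℕ, ∀ (d X : ℕ) (v : ℕ → ℕ), 1 ≤ X → d + 1 ≤ X →
        (∀ r ∈ Q.loopR, v r ≤ X) → Q.cost d v ≤ k * X ^ k) →
      ∃ k : ℕ, ∀ (d X : ℕ) (v : ℕ → ℕ), 1 ≤ X → d + 1 ≤ X →
        (∀ r ∈ P.loopR ++ Q.loopR, v r ≤ X) → 1 + (P.cost d v + Q.cost d v) ≤ k * X ^ k := by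
    rintro P Q ⟨k, hk⟩ ⟨l, hl⟩
    refine ⟨1 + k + l, fun d X v h1 h2 h3 => ?_⟩
    have e1 := hk d X v h1 h2 (fun r h => h3 r (List.mem_append_left _ h))
    have e2 := hl d X v h1 h2 (fun r h => h3 r (List.mem_append_right _ h))
    have e3 : X ^ k ≤ X ^ (1 + k + l) := Nat.pow_le_pow_right h1 (by omega)
    have e4 : X ^ l ≤ X ^ (1 + k + l) := Nat.pow_le_pow_right h1 (by omega)
    have e5 : 1 ≤ X ^ (1 + k + l) := Nat.one_le_pow _ _ h1
    have e6 := Nat.mul_le_mul_left k e3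
    have e7 := Nat.mul_le_mul_left l e4
    rw [add_mul, add_mul]
    omega
  induction P with
  | seq P Q ihP ihQ =>
    obtain ⟨k, hk⟩ := pair P Q ihP ihQ
    exact ⟨k, fun d X v h1 h2 h3 => by
      have := hk d X v h1 h2 h3
      simp only [cost]
      omega⟩
  | ifNat a b P Q ihP ihQ => exact pair P Q ihP ihQ
  | ifReal a b P Q ihP ihQ => exact pair P Q ihP ihQ
  | loop r P ih =>
    obtain ⟨k, hk⟩ := ih
    refine ⟨k + 2, fun d X v h1 h2 h3 => ?_⟩
    have e1 := hk d X v h1 h2 (fun r h => h3 r (List.mem_cons_of_mem _ h))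
    have e2 := h3 r (by simp [loopR])
    have e3 : X * X ^ k = X ^ (k + 1) := by ring
    have e4 : X ^ (k + 1) ≤ X ^ (k + 2) := Nat.pow_le_pow_right h1 (by omega)
    have e5 : X ≤ X ^ (k + 2) := Nat.le_self_pow (by omega) X
    have e6 : v r * (1 + P.cost d v) ≤ X * (1 + k * X ^ k) := Nat.mul_le_mul e2 (by omega)
    have e7 : X * (1 + k * X ^ k) = X + k * X ^ (k + 1) := by ring
    have e8 := Nat.mul_le_mul_left k e4
    simp only [cost]
    rw [add_mul]
    omega
  | value => exact ⟨1, fun d X v h1 h2 _ => by simpa [cost] using h2⟩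
  | gradient => exact ⟨1, fun d X v h1 h2 _ => by simpa [cost] using h2⟩
  | _ => exact ⟨1, fun d X v h1 h2 _ => by simpa [cost] using h1⟩

end Prog

/-- A bandit algorithm none of whose loops runs longer than `n`, `d` or `T` is efficient. -/
theorem BanditAlgorithm.exists_steps_le (A : BanditAlgorithm)
    (hI : (∀ r ∈ A.init.loopR, r ∈ [1, 2, 3]) ∧ ∀ r ∈ [1, 2, 3], r ∉ A.init.regW)
    (hS : (∀ r ∈ A.select.loopR, r ∈ [1, 2, 3]) ∧ ∀ r ∈ [1, 2, 3], r ∉ A.select.regW)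
    (hU : (∀ r ∈ A.update.loopR, r ∈ [1, 2, 3]) ∧ ∀ r ∈ [1, 2, 3], r ∉ A.update.regW) :
    ∃ k : ℕ, ∀ (n d T : ℕ) [NeZero n] (p α γ ν : ℝ) (Ψ : ℝ → (Fin d → ℝ) → ℝ)
      (C : Adversary d n) (ω : ℕ → unitInterval),
      (A.play Ψ ⟨n, d, T, p, α, γ, ν⟩ C ω T).store.steps ≤ k * (n + d + T + 1) ^ k := by
  obtain ⟨k₁, h₁⟩ := A.init.exists_cost_le
  obtain ⟨k₂, h₂⟩ := A.select.exists_cost_le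
  obtain ⟨k₃, h₃⟩ := A.update.exists_cost_le
  refine ⟨k₁ + k₂ + k₃ + 1, fun n d T _ p α γ ν Ψ C ω => ?_⟩
  set X := n + d + T + 1 with hX
  have hX1 : 1 ≤ X := by omega
  have hdX : d + 1 ≤ X := by omega
  let v : ℕ → ℕ := (Params.store ⟨n, d, T, p, α, γ, ν⟩).reg
  have hv : ∀ r ∈ [1, 2, 3], v r ≤ X := by
    intro r hr
    simp only [List.mem_cons, List.not_mem_nil, or_false] at hr
    rcases hr with rfl | rfl | rfl <;> simp [v, Params.store] <;> omega
  have key : ∀ t, (∀ r ∈ [1, 2, 3],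
        (A.play Ψ ⟨n, d, T, p, α, γ, ν⟩ C ω t).store.reg r = v r) ∧
      (A.play Ψ ⟨n, d, T, p, α, γ, ν⟩ C ω t).store.steps ≤
        A.init.cost d v + t * (A.select.cost d v + A.update.cost d v) := by
    intro t
    induction t with
    | zero =>
      refine ⟨fun r hr => ?_, ?_⟩
      · simp only [BanditAlgorithm.play]
        rw [Prog.exec_reg _ _ (hI.2 r hr)]
      · have := Prog.exec_steps_le (Ψ := Ψ) A.init v (Params.store ⟨n, d, T, p, α, γ, ν⟩)
          (fun _ _ => rfl) _ hI.1 hI.2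
        simpa [BanditAlgorithm.play, Params.store] using this
    | succ t ih =>
      obtain ⟨ih1, ih2⟩ := ih
      set g := A.play Ψ ⟨n, d, T, p, α, γ, ν⟩ C ω t
      have s1 := Prog.exec_steps_le (Ψ := Ψ) A.select v (g.store.setEntry 1 0 (ω t))
          (fun r hr => ih1 r (hS.1 r hr)) _ hS.1 hS.2
      have r1 : ∀ r ∈ [1, 2, 3], (A.selected Ψ (ω t) g.store).reg r = v r := fun r hr => by
        rw [BanditAlgorithm.selected, Prog.exec_reg _ _ (hS.2 r hr)]
        exact ih1 r hr
      have s2 := Prog.exec_steps_le (Ψ := Ψ) A.update v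
          ((A.selected Ψ (ω t) g.store).setVec 2
            fun i => C g.history i ((A.selected Ψ (ω t) g.store).action n))
          (fun r hr => r1 r (hU.1 r hr)) _ hU.1 hU.2
      refine ⟨fun r hr => ?_, ?_⟩
      · simp only [BanditAlgorithm.play, BanditAlgorithm.round]
        rw [Prog.exec_reg _ _ (hU.2 r hr)]
        exact r1 r hr
      · simp only [Store.setVec_steps, Store.setEntry_steps] at s1 s2
        have s3 : (A.selected Ψ (ω t) g.store).steps ≤ g.store.steps + A.select.cost d v := s1
        refine s2.trans ?_
        rw [add_mul, one_mul]
        omega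
  have c1 := h₁ d X v hX1 hdX (fun r hr => hv r (hI.1 r hr))
  have c2 := h₂ d X v hX1 hdX (fun r hr => hv r (hS.1 r hr))
  have c3 := h₃ d X v hX1 hdX (fun r hr => hv r (hU.1 r hr))
  refine (key T).2.trans ?_
  set k := k₁ + k₂ + k₃ + 1
  have p1 : X ^ k₁ ≤ X ^ k := Nat.pow_le_pow_right hX1 (by omega)
  have p2 : X * X ^ k₂ ≤ X ^ k := by
    rw [← pow_succ']; exact Nat.pow_le_pow_right hX1 (by omega)
  have p3 : X * X ^ k₃ ≤ X ^ k := by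
    rw [← pow_succ']; exact Nat.pow_le_pow_right hX1 (by omega)
  calc A.init.cost d v + T * (A.select.cost d v + A.update.cost d v)
      ≤ k₁ * X ^ k₁ + X * (k₂ * X ^ k₂ + k₃ * X ^ k₃) :=
        Nat.add_le_add c1 (Nat.mul_le_mul (by omega) (Nat.add_le_add c2 c3))
    _ = k₁ * X ^ k₁ + k₂ * (X * X ^ k₂) + k₃ * (X * X ^ k₃) := by ring
    _ ≤ k₁ * X ^ k + k₂ * X ^ k + k₃ * X ^ k := by gcongr
    _ ≤ (k₁ + k₂ + k₃ + 1) * X ^ k := by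
        rw [add_mul, add_mul, add_mul]; omega

end VectorBandits

/-! ### First-order calculus of gradient-stable approximations -/

namespace VectorBandits

section Calculus

variable {d : ℕ}

theorem add_mem_orthant {x y : Fin d → ℝ} (hx : x ∈ orthant d) (hy : y ∈ orthant d) :
    x + y ∈ orthant d := fun i => add_nonneg (hx i) (hy i)

theorem smul_mem_orthant {x : Fin d → ℝ} {c : ℝ} (hc : 0 ≤ c) (hx : x ∈ orthant d) :
    c • x ∈ orthant d := fun i => mul_nonneg hc (hx i)

theorem zero_mem_orthant : (0 : Fin d → ℝ) ∈ orthant d := fun _ => le_rfl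

theorem one_mem_orthant : (1 : Fin d → ℝ) ∈ orthant d := fun _ => zero_le_one

theorem sum_mem_orthant {ι : Type*} (s : Finset ι) (f : ι → Fin d → ℝ)
    (h : ∀ i ∈ s, f i ∈ orthant d) : ∑ i ∈ s, f i ∈ orthant d := fun j => by
  rw [Finset.sum_apply]
  exact Finset.sum_nonneg fun i hi => h i hi j

/-- The derivative of `ψ` at `x` in direction `y`, relative to the orthant. -/
noncomputable def dirDeriv (ψ : (Fin d → ℝ) → ℝ) (x y : Fin d → ℝ) : ℝ :=
  ∑ i, grad ψ x i * y i

theorem dirDeriv_eq_fderivWithin (ψ : (Fin d → ℝ) → ℝ) (x y : Fin d → ℝ) :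
    dirDeriv ψ x y = fderivWithin ℝ ψ (orthant d) x y := by
  conv_rhs => rw [← Finset.univ_sum_single y]
  rw [map_sum, dirDeriv]
  refine Finset.sum_congr rfl fun i _ => ?_
  have : Pi.single i (y i) = y i • (Pi.single i (1 : ℝ) : Fin d → ℝ) := by
    rw [← Pi.single_smul]; simp
  rw [this, map_smul, smul_eq_mul, mul_comm, grad]

theorem dirDeriv_sum {ι : Type*} (ψ : (Fin d → ℝ) → ℝ) (x : Fin d → ℝ) (s : Finset ι)
    (c : ι → ℝ) (y : ι → Fin d → ℝ) :
    dirDeriv ψ x (∑ i ∈ s, c i • y i) = ∑ i ∈ s, c i * dirDeriv ψ x (y i) := by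
  simp only [dirDeriv_eq_fderivWithin, map_sum, map_smul, smul_eq_mul]

theorem dirDeriv_neg (ψ : (Fin d → ℝ) → ℝ) (x y : Fin d → ℝ) :
    dirDeriv ψ x (-y) = -dirDeriv ψ x y := by
  simp only [dirDeriv_eq_fderivWithin, map_neg]

/-- A convex function lies above its tangents. -/
theorem dirDeriv_sub_le {ψ : (Fin d → ℝ) → ℝ} (hc : ConvexOn ℝ (orthant d) ψ)
    (hd : DifferentiableOn ℝ ψ (orthant d)) {x z : Fin d → ℝ} (hx : x ∈ orthant d)
    (hz : z ∈ orthant d) : dirDeriv ψ x (z - x) ≤ ψ z - ψ x := by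
  rw [dirDeriv_eq_fderivWithin]
  have h1 : HasFDerivWithinAt ψ (fderivWithin ℝ ψ (orthant d) x) (orthant d) x :=
    (hd x hx).hasFDerivWithinAt
  have hline : HasDerivWithinAt (fun t : ℝ => x + t • (z - x)) (z - x) (Set.Ioc 0 1) 0 := by
    have := ((hasDerivAt_id (0 : ℝ)).smul_const (z - x)).const_add x
    simpa using this.hasDerivWithinAt
  have hmem : ∀ t ∈ Set.Ioc (0 : ℝ) 1, x + t • (z - x) ∈ orthant d := by
    intro t ht i
    have e : (x + t • (z - x)) i = (1 - t) * x i + t * z i := by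
      simp only [Pi.add_apply, Pi.smul_apply, Pi.sub_apply, smul_eq_mul]; ring
    rw [e]
    exact add_nonneg (mul_nonneg (by linarith [ht.2]) (hx i)) (mul_nonneg ht.1.le (hz i))
  have h2 := HasFDerivWithinAt.comp_hasDerivWithinAt (x := (0 : ℝ)) (t := orthant d)
    (l := ψ) (l' := fderivWithin ℝ ψ (orthant d) x) (by simpa using h1) hline hmem
  rw [hasDerivWithinAt_iff_tendsto_slope' (by simp)] at h2
  have hne : (nhdsWithin (0 : ℝ) (Set.Ioc 0 1)).NeBot := by
    rw [nhdsWithin_Ioc_eq_nhdsGT one_pos]; infer_instance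
  refine le_of_tendsto h2 ?_
  filter_upwards [self_mem_nhdsWithin] with t ht
  have hconv := hc.2 hx hz (show (0 : ℝ) ≤ 1 - t by linarith [ht.2]) ht.1.le (by ring)
  have e : (1 - t) • x + t • z = x + t • (z - x) := by
    ext i; simp only [Pi.add_apply, Pi.smul_apply, Pi.sub_apply, smul_eq_mul]; ring
  rw [e] at hconv
  simp only [smul_eq_mul] at hconv
  simp only [slope_def_field, Function.comp_apply, zero_smul, add_zero, sub_zero]
  rw [div_le_iff₀ ht.1]
  linarith

theorem N_mono {N : Seminorm ℝ (Fin d → ℝ)} (hN : IsMonotoneNorm N) {x y : Fin d → ℝ}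
    (hx : x ∈ orthant d) (h : ∀ i, x i ≤ y i) : N x ≤ N y := hN.mono y x hx h

theorem IsMonotoneNorm.one_pos [NeZero d] {N : Seminorm ℝ (Fin d → ℝ)} (hN : IsMonotoneNorm N) :
    0 < N 1 := by
  refine lt_of_le_of_ne (apply_nonneg N 1) fun h => ?_
  have := congrFun (hN.eq_zero 1 h.symm) (0 : Fin d)
  simp at this

namespace IsGradStableAt

variable {N : Seminorm ℝ (Fin d → ℝ)} {δ α γ ε : ℝ} {ψ : (Fin d → ℝ) → ℝ}

theorem dirDeriv_le (h : IsGradStableAt N δ α γ ε ψ) {x y : Fin d → ℝ} (hx : x ∈ orthant d)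
    (hy : y ∈ orthant d) : dirDeriv ψ x y ≤ ψ (x + y) - ψ x := by
  have := dirDeriv_sub_le h.convex h.differentiable hx (add_mem_orthant hx hy)
  rwa [add_sub_cancel_left] at this

theorem le_dirDeriv (h : IsGradStableAt N δ α γ ε ψ) {x y : Fin d → ℝ} (hx : x ∈ orthant d)
    (hy : y ∈ orthant d) : ψ (x + y) - ψ x ≤ dirDeriv ψ (x + y) y := by
  have := dirDeriv_sub_le h.convex h.differentiable (add_mem_orthant hx hy) hx
  rw [sub_add_cancel_left, dirDeriv_neg] at this
  linarith

/-- Increments are controlled by the norm without the additive error: stretch the increment, and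
the additive error is divided by the stretching factor. -/
theorem increment_le (h : IsGradStableAt N δ α γ ε ψ) {x y : Fin d → ℝ} (hx : x ∈ orthant d)
    (hy : y ∈ orthant d) : ψ (x + y) - ψ x ≤ α * N y := by
  by_contra! hlt
  set c := ψ (x + y) - ψ x - α * N y with hc
  have hcpos : 0 < c := by linarith
  obtain ⟨k, hk⟩ := exists_nat_gt (γ / ε / c)
  have hk' : γ / ε < k * c := by rwa [div_lt_iff₀ hcpos] at hk
  have hk1 : (1 : ℝ) ≤ (k : ℝ) + 1 := by linarith [k.cast_nonneg (α := ℝ)]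
  have hK : (0 : ℝ) < (k : ℝ) + 1 := by linarith
  have hky := smul_mem_orthant hK.le hy
  have hconv := h.convex.2 hx (add_mem_orthant hx hky)
    (show (0 : ℝ) ≤ 1 - ((k : ℝ) + 1)⁻¹ by have := inv_le_one_of_one_le₀ hk1; linarith)
    (inv_nonneg.mpr hK.le) (by ring)
  have e : (1 - ((k : ℝ) + 1)⁻¹) • x + ((k : ℝ) + 1)⁻¹ • (x + ((k : ℝ) + 1) • y) = x + y := by
    ext i
    simp only [Pi.add_apply, Pi.smul_apply, smul_eq_mul]
    field_simp
    ring
  rw [e] at hconv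
  simp only [smul_eq_mul] at hconv
  have hsub := h.subadditive x hx _ hky
  have hle := h.le_norm _ hky
  rw [map_smul_eq_mul, Real.norm_of_nonneg hK.le] at hle
  have h3 : ((k : ℝ) + 1) * (ψ (x + y) - ψ x) ≤ ψ (x + ((k : ℝ) + 1) • y) - ψ x := by
    have := mul_le_mul_of_nonneg_left hconv hK.le
    have e2 : ((k : ℝ) + 1) * ((1 - ((k : ℝ) + 1)⁻¹) * ψ x +
        ((k : ℝ) + 1)⁻¹ * ψ (x + ((k : ℝ) + 1) • y)) =
        (k : ℝ) * ψ x + ψ (x + ((k : ℝ) + 1) • y) := by field_simp; ring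
    rw [e2] at this
    linarith
  have h4 : ((k : ℝ) + 1) * (ψ (x + y) - ψ x) ≤ α * (((k : ℝ) + 1) * N y) + γ / ε := by linarith
  have h5 : ((k : ℝ) + 1) * c ≤ γ / ε := by rw [hc]; linarith
  linarith

theorem dirDeriv_le_norm (h : IsGradStableAt N δ α γ ε ψ) {x y : Fin d → ℝ} (hx : x ∈ orthant d)
    (hy : y ∈ orthant d) : dirDeriv ψ x y ≤ α * N y :=
  (h.dirDeriv_le hx hy).trans (h.increment_le hx hy)

theorem increment_nonneg (h : IsGradStableAt N δ α γ ε ψ) {x y : Fin d → ℝ} (hx : x ∈ orthant d)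
    (hy : y ∈ orthant d) : 0 ≤ ψ (x + y) - ψ x :=
  sub_nonneg.mpr (h.mono x hx _ (add_mem_orthant hx hy) fun i => by simpa using hy i)

theorem nonneg (h : IsGradStableAt N δ α γ ε ψ) {x : Fin d → ℝ} (hx : x ∈ orthant d) :
    0 ≤ ψ x := (apply_nonneg N x).trans (h.norm_le x hx)

theorem zero_le_div (h : IsGradStableAt N δ α γ ε ψ) : ψ 0 ≤ γ / ε := by
  simpa using h.le_norm 0 zero_mem_orthant

/-- Gradient stability in a nonnegative direction. -/
theorem dirDeriv_stable (h : IsGradStableAt N δ α γ ε ψ) {x y z : Fin d → ℝ} {M : ℝ}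
    (hx : x ∈ orthant d) (hy : y ∈ orthant d) (hz : z ∈ orthant d) (hM : ε * N y + δ ≤ M)
    (hpos : 0 ≤ dirDeriv ψ x z) :
    dirDeriv ψ x z ≤ Real.exp M * dirDeriv ψ (x + y) z := by
  have h1 : Real.exp (-(ε * N y) - δ) * dirDeriv ψ x z ≤ dirDeriv ψ (x + y) z := by
    rw [dirDeriv, dirDeriv, Finset.mul_sum]
    refine Finset.sum_le_sum fun i _ => ?_
    rw [← mul_assoc]
    exact mul_le_mul_of_nonneg_right (h.gradient_stable x hx y hy i) (hz i)
  have h2 : Real.exp (-M) * dirDeriv ψ x z ≤ dirDeriv ψ (x + y) z :=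
    (mul_le_mul_of_nonneg_right (Real.exp_le_exp.mpr (by linarith)) hpos).trans h1
  have h3 := mul_le_mul_of_nonneg_left h2 (Real.exp_pos M).le
  rwa [← mul_assoc, ← Real.exp_add, add_neg_cancel, Real.exp_zero, one_mul] at h3

end IsGradStableAt

theorem nonneg_of_le_nonneg_at_zero {N : Seminorm ℝ (Fin d → ℝ)} {δ α γ : ℝ}
    {Ψ : ℝ → (Fin d → ℝ) → ℝ} (h : IsGradStableApprox N δ α γ Ψ) : 0 ≤ γ := by
  have h1 := h 1 one_pos
  have := (h1.nonneg zero_mem_orthant).trans h1.zero_le_div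
  simpa using this

theorem one_le_of_isGradStableApprox [NeZero d] {N : Seminorm ℝ (Fin d → ℝ)}
    (hN : IsMonotoneNorm N) {δ α γ : ℝ} {Ψ : ℝ → (Fin d → ℝ) → ℝ}
    (h : IsGradStableApprox N δ α γ Ψ) : 1 ≤ α := by
  have hγ := nonneg_of_le_nonneg_at_zero h
  have hpos := hN.one_pos
  by_contra! hlt
  have hc : 0 < (1 - α) * N 1 := mul_pos (by linarith) hpos
  have hε : 0 < (γ + 1) / ((1 - α) * N 1) := div_pos (by linarith) hc
  have h1 := h _ hε
  have h2 := (h1.norm_le 1 one_mem_orthant).trans (h1.le_norm 1 one_mem_orthant)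
  have h3 : γ / ((γ + 1) / ((1 - α) * N 1)) = γ / (γ + 1) * ((1 - α) * N 1) := by
    field_simp
  rw [h3] at h2
  have h4 : γ / (γ + 1) < 1 := by rw [div_lt_one (by linarith)]; linarith
  nlinarith

end Calculus

end VectorBandits

/-! ### The parameters of the algorithm -/

namespace VectorBandits

namespace Params

variable (q : Params)

/-- `log (n / p)`. -/
noncomputable def logTerm : ℝ := Real.log (q.n / q.p)

/-- The regret scale `√(T n log (n / p))`, written with the operations of the machine. -/
noncomputable def scale : ℝ := Real.exp (Real.log (q.T * q.n * q.logTerm) / 2)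

theorem scale_pos : 0 < q.scale := Real.exp_pos _

/-- The learning rate of exponential weights. -/
noncomputable def rate : ℝ := q.logTerm / q.scale

theorem rate_mul_scale : q.rate * q.scale = q.logTerm := by
  rw [rate, div_mul_cancel₀ _ q.scale_pos.ne']

/-- How often an arm is played in a batch of the exploration. -/
noncomputable def quota : ℝ := q.scale / q.n

/-- The number added to the index of a batch in the discount of its scores. -/
noncomputable def offset : ℝ := q.quota / q.logTerm

/-- A bound `α ‖1‖` for the increase of the potential in one round. -/
noncomputable def unit : ℝ := q.α * q.normOne

/-- The score above which an arm is dropped during the exploration. -/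
noncomputable def cutoff : ℝ := 4 * (q.logTerm * q.unit)

/-- The scale at which the exploration queries the potential, so large that the additive error of
the potential is negligible. -/
noncomputable def exploreEps : ℝ := (q.γ + 1) * q.offset / q.normOne

/-- The first guess for the norm of the load of the comparator. -/
noncomputable def guess : ℝ := q.normOne + q.unit * q.scale / (q.α + q.γ)

/-- The scale of the potential in stage `k`, where the guess is `2 ^ k * guess`. -/
noncomputable def eps (k : ℕ) : ℝ := 1 / (16 * q.guess) / 2 ^ k

/-- The value of the potential at which stage `k` is given up. -/
noncomputable def bound (k : ℕ) : ℝ := 128 * ((q.α + q.γ) * q.guess) * 2 ^ k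

end Params

/-- The nontrivial instances of the problem. -/
structure Regime (n d : ℕ) (q : Params) (N : Seminorm ℝ (Fin d → ℝ))
    (Ψ : ℝ → (Fin d → ℝ) → ℝ) : Prop where
  n_eq : q.n = n
  two_le : 2 ≤ n
  d_ne : d ≠ 0
  p_pos : 0 < q.p
  p_le : q.p ≤ 1
  norm_eq : q.normOne = N 1
  long : n * q.logTerm ≤ q.T
  norm : IsMonotoneNorm N
  approx : IsGradStableApprox N (1 / 4) q.α q.γ Ψ

namespace Regime

variable {n d : ℕ} {q : Params} {N : Seminorm ℝ (Fin d → ℝ)} {Ψ : ℝ → (Fin d → ℝ) → ℝ}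
  (R : Regime n d q N Ψ)
include R

theorem n_two : (2 : ℝ) ≤ n := by exact_mod_cast R.two_le

theorem norm_pos : 0 < N 1 := by
  have : NeZero d := ⟨R.d_ne⟩
  exact R.norm.one_pos

theorem one_le_α : 1 ≤ q.α := by
  have : NeZero d := ⟨R.d_ne⟩
  exact one_le_of_isGradStableApprox R.norm R.approx

theorem γ_nonneg : 0 ≤ q.γ := nonneg_of_le_nonneg_at_zero R.approx

theorem n_le_div : (n : ℝ) ≤ q.n / q.p := by
  rw [R.n_eq, le_div_iff₀ R.p_pos]
  have := R.n_two
  nlinarith [R.p_le]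

theorem log_n_le : Real.log n ≤ q.logTerm :=
  Real.log_le_log (by linarith [R.n_two]) R.n_le_div

theorem log_two_le : Real.log 2 ≤ q.logTerm :=
  Real.log_le_log (by norm_num) (R.n_two.trans R.n_le_div)

theorem two_thirds_le : 2 / 3 ≤ q.logTerm := by
  have := Real.log_two_gt_d9
  linarith [R.log_two_le]

theorem logTerm_pos : 0 < q.logTerm := by linarith [R.two_thirds_le]

theorem exp_logTerm : Real.exp q.logTerm = n / q.p := by
  rw [Params.logTerm, R.n_eq]
  exact Real.exp_log (div_pos (by linarith [R.n_two]) R.p_pos)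

theorem T_pos : (0 : ℝ) < q.T := by
  have := R.n_two
  have := R.logTerm_pos
  have := R.long
  have : 0 < n * q.logTerm := by positivity
  linarith

theorem scale_sq : q.scale * q.scale = q.T * n * q.logTerm := by
  rw [Params.scale, ← Real.exp_add, add_halves, R.n_eq, Real.exp_log]
  have := R.n_two
  have := R.logTerm_pos
  have := R.T_pos
  positivity

theorem scale_eq_sqrt : q.scale = √(q.T * n * q.logTerm) := by
  rw [← R.scale_sq, Real.sqrt_mul_self q.scale_pos.le]

theorem le_scale : n * q.logTerm ≤ q.scale := by
  have h1 := R.n_two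
  have h2 := R.logTerm_pos
  refine (mul_self_le_mul_self_iff (by positivity) q.scale_pos.le).mpr ?_
  rw [R.scale_sq]
  have := mul_le_mul_of_nonneg_right R.long (show 0 ≤ n * q.logTerm by positivity)
  linarith

theorem n_le_scale : (n : ℝ) ≤ 3 / 2 * q.scale := by
  have h1 := R.n_two
  have h2 := R.two_thirds_le
  have h3 := R.le_scale
  nlinarith

theorem rate_pos : 0 < q.rate := div_pos R.logTerm_pos q.scale_pos

theorem rate_mul_rounds : q.rate * (n * q.T) = q.scale := by
  have h := R.scale_sq
  have h0 := q.scale_pos.ne'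
  rw [Params.rate]
  field_simp
  linarith

theorem quota_pos : 0 < q.quota :=
  div_pos q.scale_pos (by rw [R.n_eq]; linarith [R.n_two])

theorem n_mul_quota : n * q.quota = q.scale := by
  have := R.n_two
  rw [Params.quota, R.n_eq]
  field_simp

theorem offset_pos : 0 < q.offset := div_pos R.quota_pos R.logTerm_pos

theorem logTerm_mul_offset : q.logTerm * q.offset = q.quota := by
  rw [Params.offset, mul_div_cancel₀ _ R.logTerm_pos.ne']

theorem rounds_eq : (q.T : ℝ) = q.quota * (n * q.offset) := by
  have h := R.scale_sq
  have h1 := R.n_mul_quota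
  have h2 := R.logTerm_mul_offset
  have h3 := R.n_two
  have h4 := R.logTerm_pos
  have e : (q.T : ℝ) * (n * q.logTerm) = q.quota * (n * q.offset) * (n * q.logTerm) := by
    calc (q.T : ℝ) * (n * q.logTerm) = q.scale * q.scale := by rw [h]; ring
      _ = (n * q.quota) * (n * (q.logTerm * q.offset)) := by rw [h2, h1]
      _ = _ := by ring
  exact mul_right_cancel₀ (by positivity) e

theorem unit_pos : 0 < q.unit :=
  mul_pos (by linarith [R.one_le_α]) (by rw [R.norm_eq]; exact R.norm_pos)

theorem norm_le_unit : N 1 ≤ q.unit := by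
  rw [Params.unit, R.norm_eq]
  nlinarith [R.one_le_α, R.norm_pos]

theorem cutoff_pos : 0 < q.cutoff := by
  have := R.logTerm_pos
  have := R.unit_pos
  unfold Params.cutoff
  positivity

theorem exploreEps_pos : 0 < q.exploreEps :=
  div_pos (mul_pos (by linarith [R.γ_nonneg]) R.offset_pos) (by rw [R.norm_eq]; exact R.norm_pos)

theorem offset_mul_error_le : q.offset * (q.γ / q.exploreEps) ≤ N 1 := by
  have h1 := R.offset_pos
  have h2 := R.γ_nonneg
  have h3 := R.norm_pos
  have : q.offset * (q.γ / q.exploreEps) = q.γ / (q.γ + 1) * N 1 := by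
    rw [Params.exploreEps, R.norm_eq]
    field_simp
  rw [this]
  have h4 : q.γ / (q.γ + 1) ≤ 1 := by rw [div_le_one (by linarith)]; linarith
  nlinarith

theorem αγ_pos : 0 < q.α + q.γ := by linarith [R.one_le_α, R.γ_nonneg]

theorem αγ_mul_guess : (q.α + q.γ) * q.guess = (q.α + q.γ) * N 1 + q.unit * q.scale := by
  have := R.αγ_pos.ne'
  rw [Params.guess, R.norm_eq]
  field_simp

theorem norm_le_guess : N 1 ≤ q.guess := by
  have := R.αγ_pos
  have := R.unit_pos
  have := q.scale_pos
  rw [Params.guess, R.norm_eq]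
  have : 0 ≤ q.unit * q.scale / (q.α + q.γ) := by positivity
  linarith

theorem guess_pos : 0 < q.guess := R.norm_pos.trans_le R.norm_le_guess

theorem eps_pos (k : ℕ) : 0 < q.eps k := by
  have := R.guess_pos
  unfold Params.eps
  positivity

theorem div_eps (c : ℝ) (k : ℕ) : c / q.eps k = 16 * c * (2 ^ k * q.guess) := by
  have := R.guess_pos
  unfold Params.eps
  field_simp

theorem eps_mul_guess (k : ℕ) : q.eps k * (2 ^ k * q.guess) = 1 / 16 := by
  have := R.guess_pos
  unfold Params.eps
  field_simp

theorem stableAt (k : ℕ) : IsGradStableAt N (1 / 4) q.α q.γ (q.eps k) (Ψ (q.eps k)) :=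
  R.approx _ (R.eps_pos k)

theorem stableAt_explore :
    IsGradStableAt N (1 / 4) q.α q.γ q.exploreEps (Ψ q.exploreEps) :=
  R.approx _ R.exploreEps_pos

end Regime

/-! ### The learner and the ledger of the analysis -/

/-- The memory of the algorithm, as a mathematical object. The fields `arm`, `batches`, `part`,
`plays`, `score` matter during the exploration and `stage`, `est` after it; `load` is the cost
vector accumulated in the current batch of the exploration or in the current stage after it. -/
structure Learner (n d : ℕ) where
  exploring : Bool
  arm : Fin n
  batches : ℕ
  load : Fin d → ℝ
  part : Fin n → Fin d → ℝ
  plays : Fin n → ℝ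
  score : Fin n → ℝ
  stage : ℕ
  est : Fin n → ℝ

/-- The last index that satisfies a predicate (an arbitrary one if there is none). -/
noncomputable def lastArm {n : ℕ} [NeZero n] (P : Fin n → Prop) : Fin n :=
  open Classical in
  if h : ∃ i, P i ∧ ∀ j, i < j → ¬P j then h.choose else 0

theorem lastArm_eq {n : ℕ} [NeZero n] {P : Fin n → Prop} {i : Fin n} (hi : P i)
    (hj : ∀ j, i < j → ¬P j) : lastArm P = i := by
  have h : ∃ i, P i ∧ ∀ j, i < j → ¬P j := ⟨i, hi, hj⟩
  rw [lastArm, dif_pos h]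
  obtain ⟨h1, h2⟩ := h.choose_spec
  rcases lt_trichotomy h.choose i with hlt | heq | hgt
  · exact absurd hi (h2 i hlt)
  · exact heq
  · exact absurd h1 (hj _ hgt)

theorem lastArm_spec {n : ℕ} [NeZero n] {P : Fin n → Prop} (h : ∃ i, P i) : P (lastArm P) := by
  classical
  have hne : (Finset.univ.filter P).Nonempty := by
    obtain ⟨i, hi⟩ := h
    exact ⟨i, by simpa using hi⟩
  have h1 := Finset.max'_mem _ hne
  have h2 : ∀ j, (Finset.univ.filter P).max' hne < j → ¬P j := fun j hj hP =>
    absurd (Finset.le_max' (Finset.univ.filter P) j (by simpa using hP)) (not_le.mpr hj)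
  rw [lastArm_eq (by simpa using h1) h2]
  simpa using h1

namespace Learner

variable {n d : ℕ} [NeZero n] (Ψ : ℝ → (Fin d → ℝ) → ℝ) (q : Params)

/-- The initial state. -/
def start : Learner n d where
  exploring := true
  arm := 0
  batches := 0
  load := 0
  part := 0
  plays := 0
  score := 0
  stage := 0
  est := 0

/-- An arm that the current batch of the exploration still has to play. -/
def Playable (σ : Learner n d) (i : Fin n) : Prop := σ.score i ≤ q.cutoff ∧ σ.plays i < q.quota

/-- The bookkeeping of one round of the exploration. -/
def record (σ : Learner n d) (c : Fin d → ℝ) (a : Fin n) : Learner n d :=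
  { σ with
    load := σ.load + c
    part := Function.update σ.part a (σ.part a + c)
    plays := Function.update σ.plays a (σ.plays a + 1) }

/-- The end of a batch: the gradient of the potential at the load of the batch prices the load that
each arm has contributed to it, and the discounted price is added to the score of the arm. -/
noncomputable def closeBatch (σ : Learner n d) : Learner n d :=
  { σ with
    batches := σ.batches + 1
    load := 0
    part := 0
    plays := 0
    score := fun i => σ.score i +
      dirDeriv (Ψ q.exploreEps) σ.load (σ.part i) / (((σ.batches + 1 : ℕ) : ℝ) + q.offset)
    est := 0 }

/-- The weight of an arm in exponential weights. -/
noncomputable def weight (σ : Learner n d) (i : Fin n) : ℝ := Real.exp (-(q.rate * σ.est i))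

/-- The probability of playing an arm in the next round. -/
noncomputable def prob (σ : Learner n d) (a : Fin n) : ℝ :=
  if σ.exploring then if a = σ.arm then 1 else 0 else σ.weight q a / ∑ i, σ.weight q i

/-- The loss, relative to `Params.unit`, of an arm with cost vector `c`: the increase of the
potential. -/
noncomputable def loss (σ : Learner n d) (c : Fin d → ℝ) : ℝ :=
  (Ψ (q.eps σ.stage) (σ.load + c) - Ψ (q.eps σ.stage) σ.load) / q.unit

/-- The bookkeeping of one round after the exploration: the estimate for the loss of the arm played
is biased downwards (implicit exploration). -/
noncomputable def observe (σ : Learner n d) (c : Fin d → ℝ) (a : Fin n) : Learner n d :=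
  { σ with
    load := σ.load + c
    est := Function.update σ.est a
      (σ.est a + σ.loss Ψ q c / (σ.weight q a / ∑ i, σ.weight q i + q.rate / 2)) }

/-- The beginning of the next stage. -/
def restart (σ : Learner n d) : Learner n d :=
  { σ with stage := σ.stage + 1, load := 0, est := 0 }

/-- Choose the next arm of the exploration, or end it if all arms have been dropped. -/
noncomputable def choose (σ : Learner n d) : Learner n d :=
  open Classical in
  { σ with exploring := decide (∃ i, σ.Playable q i), arm := lastArm (σ.Playable q) }

/-- One round in which arm `a` is played and the cost vector `c` is observed. -/
noncomputable def step (σ : Learner n d) (c : Fin d → ℝ) (a : Fin n) : Learner n d :=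
  open Classical in
  if σ.exploring then
    if ∃ i, (σ.record c a).Playable q i then
      { σ.record c a with arm := lastArm ((σ.record c a).Playable q) }
    else ((σ.record c a).closeBatch Ψ q).choose q
  else if q.bound σ.stage < Ψ (q.eps σ.stage) (σ.load + c) then (σ.observe Ψ q c a).restart
  else σ.observe Ψ q c a

/-- The state after a sequence of actions (the latest first). -/
noncomputable def run (C : Adversary d n) : List (Fin n) → Learner n d
  | [] => start
  | a :: h => (run C h).step Ψ q (fun j => C h j a) a

end Learner

/-- Quantities that the algorithm does not know: the load of the algorithm and of each arm in all
rounds so far (`total`, `colTotal`), the undiscounted scores and the number of batches in which an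
arm took part (`price`, `active`), and for the current stage the load of each arm (`colStage`) and
its loss (`lossStage`); `past` is the contribution of the earlier stages to `Ledger.value`. -/
structure Ledger (n d : ℕ) where
  total : Fin d → ℝ
  colTotal : Fin n → Fin d → ℝ
  price : Fin n → ℝ
  active : Fin n → ℝ
  colStage : Fin n → Fin d → ℝ
  lossStage : Fin n → ℝ
  past : ℝ

namespace Ledger

variable {n d : ℕ} [NeZero n] (Ψ : ℝ → (Fin d → ℝ) → ℝ) (q : Params)

/-- The initial ledger. -/
def start : Ledger n d where
  total := 0
  colTotal := 0
  price := 0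
  active := 0
  colStage := 0
  lossStage := 0
  past := 0

/-- The average over the arms of the exponential of the scaled error of the estimated losses. -/
noncomputable def deviation (est loss : Fin n → ℝ) : ℝ :=
  (∑ i, Real.exp (q.rate * (est i - loss i))) / n

/-- One round with cost matrix `M` in which arm `a` is played in state `σ`. -/
noncomputable def step (g : Ledger n d) (σ : Learner n d) (M : Matrix (Fin d) (Fin n) ℝ)
    (a : Fin n) : Ledger n d :=
  let c : Fin d → ℝ := fun j => M j a
  let total := g.total + c
  let colTotal : Fin n → Fin d → ℝ := fun i j => g.colTotal i j + M j i
  open Classical in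
  if σ.exploring then
    if ∃ i, (σ.record c a).Playable q i then { g with total := total, colTotal := colTotal }
    else
      { g with
        total := total
        colTotal := colTotal
        price := fun i => g.price i +
          dirDeriv (Ψ q.exploreEps) (σ.record c a).load ((σ.record c a).part i)
        active := fun i => g.active i + if σ.score i ≤ q.cutoff then 1 else 0 }
  else
    let colStage : Fin n → Fin d → ℝ := fun i j => g.colStage i j + M j i
    let lossStage : Fin n → ℝ := fun i => g.lossStage i + σ.loss Ψ q fun j => M j i
    if q.bound σ.stage < Ψ (q.eps σ.stage) (σ.load + c) then
      { g with
        total := total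
        colTotal := colTotal
        colStage := 0
        lossStage := 0
        past := g.past + deviation q (σ.observe Ψ q c a).est lossStage / 2 ^ (σ.stage + 1) }
    else
      { g with
        total := total
        colTotal := colTotal
        colStage := colStage
        lossStage := lossStage }

/-- The ledger after a sequence of actions (the latest first). -/
noncomputable def run (C : Adversary d n) : List (Fin n) → Ledger n d
  | [] => start
  | a :: h => (run C h).step Ψ q (Learner.run Ψ q C h) (C h) a

/-- The supermartingale behind the regret bound. Stage `k` starts with the budget `2 ^ (-(k + 1))`,
which is multiplied by the deviation of the estimated losses in this stage; the last summand is the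
budget of the stages to come. -/
noncomputable def value (g : Ledger n d) (σ : Learner n d) : ℝ :=
  if σ.exploring then 1
  else g.past + (deviation q σ.est g.lossStage + 1) / 2 ^ (σ.stage + 1)

end Ledger

end VectorBandits

/-! ### The exploration -/

namespace VectorBandits

open Finset

section Combinations

variable {n d : ℕ}

theorem combination_mem {x : Fin n → ℝ} (hx : x ∈ stdSimplex ℝ (Fin n)) {G : Fin n → Fin d → ℝ}
    (hG : ∀ i, G i ∈ orthant d) : ∑ i, x i • G i ∈ orthant d :=
  sum_mem_orthant _ _ fun i _ => smul_mem_orthant (hx.1 i) (hG i)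

theorem combination_le {x : Fin n → ℝ} (hx : x ∈ stdSimplex ℝ (Fin n)) {G H : Fin n → Fin d → ℝ}
    (h : ∀ i j, G i j ≤ H i j) (j : Fin d) : (∑ i, x i • G i) j ≤ (∑ i, x i • H i) j := by
  simp only [Finset.sum_apply, Pi.smul_apply, smul_eq_mul]
  exact sum_le_sum fun i _ => mul_le_mul_of_nonneg_left (h i j) (hx.1 i)

theorem norm_combination_le {N : Seminorm ℝ (Fin d → ℝ)} (hN : IsMonotoneNorm N) {x : Fin n → ℝ}
    (hx : x ∈ stdSimplex ℝ (Fin n)) {G H : Fin n → Fin d → ℝ} (hG : ∀ i, G i ∈ orthant d)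
    (h : ∀ i j, G i j ≤ H i j) : N (∑ i, x i • G i) ≤ N (∑ i, x i • H i) :=
  N_mono hN (combination_mem hx hG) (combination_le hx h)

theorem sum_update_add {M : Type*} [AddCommMonoid M] (f : Fin n → M) (a : Fin n) (c : M) :
    ∑ i, Function.update f a (f a + c) i = ∑ i, f i + c := by
  classical
  rw [sum_update_of_mem (mem_univ a), ← add_sum_erase univ f (mem_univ a), sdiff_singleton_eq_erase]
  abel

end Combinations

/-- What holds during the exploration after `t` rounds. The upper bound on `price` says that the
undiscounted score of an arm stays within its share of the budget, the bound on the combinations of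
the scores that no comparator with a small load accumulates much score. -/
structure ExploreInv {n d : ℕ} (q : Params) (N : Seminorm ℝ (Fin d → ℝ)) (σ : Learner n d)
    (g : Ledger n d) (t : ℕ) : Prop where
  load_eq : σ.load = ∑ i, σ.part i
  part_mem : ∀ i, σ.part i ∈ orthant d
  part_le : ∀ i j, σ.part i j ≤ g.colTotal i j
  plays_nonneg : ∀ i, 0 ≤ σ.plays i
  plays_le : ∀ i, σ.plays i ≤ q.quota + 1
  norm_part_le : ∀ i, N (σ.part i) ≤ σ.plays i * N 1
  part_eq_zero : ∀ i, q.cutoff < σ.score i → σ.part i = 0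
  active_nonneg : ∀ i, 0 ≤ g.active i
  rounds : ∑ i, (q.quota * g.active i + σ.plays i) ≤ t
  batches_le : q.quota * σ.batches ≤ t
  score_nonneg : ∀ i, 0 ≤ σ.score i
  active_eq : ∀ i, σ.score i ≤ q.cutoff → g.active i = σ.batches
  price_le_score : ∀ i, σ.score i ≤ q.cutoff → g.price i ≤ (σ.batches + q.offset) * σ.score i
  price_le : ∀ i, g.price i ≤ (g.active i + q.offset) * q.cutoff + q.unit * (q.quota + 1)
  norm_closed_le : N (g.total - σ.load) ≤ ∑ i, g.price i + σ.batches * (q.γ / q.exploreEps)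
  score_comb_le : ∀ x ∈ stdSimplex ℝ (Fin n), ∑ i, x i * σ.score i ≤
    q.α * (Real.log (1 + σ.batches / q.offset) * N (∑ i, x i • g.colTotal i))

namespace Regime

variable {n d : ℕ} {q : Params} {N : Seminorm ℝ (Fin d → ℝ)} {Ψ : ℝ → (Fin d → ℝ) → ℝ}
  (R : Regime n d q N Ψ)
include R

theorem log_nonneg (r : ℕ) : 0 ≤ Real.log (1 + r / q.offset) := by
  have := R.offset_pos
  exact Real.log_nonneg (by have : (0 : ℝ) ≤ r / q.offset := by positivity
                            linarith)

theorem exploreInv_start [NeZero n] :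
    ExploreInv q N (Learner.start : Learner n d) Ledger.start 0 := by
  have h1 := R.quota_pos
  have h2 := R.offset_pos
  have h3 := R.cutoff_pos
  have h4 := R.unit_pos
  constructor <;> simp [Learner.start, Ledger.start, orthant]
  · linarith
  · positivity

theorem exploreInv_record {σ : Learner n d} {g : Ledger n d} {t : ℕ} (h : ExploreInv q N σ g t)
    {M : Matrix (Fin d) (Fin n) ℝ} (hM : ∀ i j, M i j ∈ Set.Icc (0 : ℝ) 1) {a : Fin n}
    (ha : σ.Playable q a) :
    ExploreInv q N (σ.record (fun j => M j a) a)
      { g with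
        total := g.total + fun j => M j a
        colTotal := fun i j => g.colTotal i j + M j i } (t + 1) := by
  have hc : (fun j => M j a) ∈ orthant d := fun j => (hM j a).1
  have hNc : N (fun j => M j a) ≤ N 1 := N_mono R.norm hc fun j => (hM j a).2
  constructor
  · simp only [Learner.record]
    rw [sum_update_add, h.load_eq]
  · intro i
    simp only [Learner.record]
    by_cases hi : i = a
    · subst hi; simpa using add_mem_orthant (h.part_mem i) hc
    · simpa [hi] using h.part_mem i
  · intro i j
    simp only [Learner.record]
    by_cases hi : i = a
    · subst hi; simpa using h.part_le i j
    · simp only [ne_eq, hi, not_false_eq_true, Function.update_of_ne]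
      linarith [h.part_le i j, (hM j i).1]
  · intro i
    simp only [Learner.record]
    by_cases hi : i = a
    · subst hi; simp; linarith [h.plays_nonneg i]
    · simpa [hi] using h.plays_nonneg i
  · intro i
    simp only [Learner.record]
    by_cases hi : i = a
    · subst hi; simpa using ha.2.le
    · simpa [hi] using h.plays_le i
  · intro i
    simp only [Learner.record]
    by_cases hi : i = a
    · subst hi
      simp only [Function.update_self, add_mul, one_mul]
      exact (map_add_le_add N _ _).trans (add_le_add (h.norm_part_le i) hNc)
    · simpa [hi] using h.norm_part_le i
  · intro i hi
    have hne : i ≠ a := by rintro rfl; exact absurd ha.1 (not_le.mpr hi)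
    simpa [Learner.record, hne] using h.part_eq_zero i hi
  · exact h.active_nonneg
  · have := h.rounds
    simp only [Learner.record, sum_add_distrib] at this ⊢
    rw [sum_update_add]
    push_cast
    linarith
  · have := h.batches_le
    simp only [Learner.record]
    push_cast
    linarith
  · exact h.score_nonneg
  · exact h.active_eq
  · exact h.price_le_score
  · exact h.price_le
  · simpa [Learner.record] using h.norm_closed_le
  · intro x hx
    refine (h.score_comb_le x hx).trans ?_
    have hmono : N (∑ i, x i • g.colTotal i) ≤
        N (∑ i, x i • (fun i j => g.colTotal i j + M j i) i) :=
      norm_combination_le R.norm hx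
        (fun i j => (h.part_mem i j).trans (h.part_le i j))
        (fun i j => by linarith [(hM j i).1])
    exact mul_le_mul_of_nonneg_left (mul_le_mul_of_nonneg_left hmono (R.log_nonneg _))
      (by linarith [R.one_le_α])

/-- One more term of the harmonic sum that bounds the discounted scores. -/
theorem inv_add_log_le (r : ℕ) :
    1 / (((r + 1 : ℕ) : ℝ) + q.offset) + Real.log (1 + r / q.offset) ≤
      Real.log (1 + ((r + 1 : ℕ) : ℝ) / q.offset) := by
  have h := R.offset_pos
  push_cast
  have hr : (0 : ℝ) ≤ r := r.cast_nonneg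
  have e1 : 1 + (r : ℝ) / q.offset = (r + q.offset) / q.offset := by field_simp; ring
  have e2 : 1 + ((r : ℝ) + 1) / q.offset = (r + 1 + q.offset) / q.offset := by field_simp; ring
  have h3 := Real.one_sub_inv_le_log_of_pos
    (show 0 < (r + 1 + q.offset) / (r + q.offset) by positivity)
  rw [Real.log_div (by positivity) (by positivity)] at h3
  rw [e1, e2, Real.log_div (by positivity) (by positivity),
    Real.log_div (by positivity) (by positivity)]
  have e3 : 1 - ((r + 1 + q.offset) / (r + q.offset))⁻¹ = 1 / ((r : ℝ) + 1 + q.offset) := by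
    field_simp; ring
  rw [e3] at h3
  linarith

theorem exploreInv_closeBatch {σ : Learner n d} {g : Ledger n d} {t : ℕ}
    (h : ExploreInv q N σ g t) (hex : ∃ i, σ.score i ≤ q.cutoff)
    (hno : ∀ i, ¬σ.Playable q i) :
    ExploreInv q N (σ.closeBatch Ψ q)
      { g with
        price := fun i => g.price i + dirDeriv (Ψ q.exploreEps) σ.load (σ.part i)
        active := fun i => g.active i + if σ.score i ≤ q.cutoff then 1 else 0 } t := by
  have hS := R.stableAt_explore
  have hq := R.quota_pos
  have hoff := R.offset_pos
  have hα := R.one_le_α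
  have hload : σ.load ∈ orthant d := by
    rw [h.load_eq]; exact sum_mem_orthant _ _ fun i _ => h.part_mem i
  set y : Fin n → ℝ := fun i => dirDeriv (Ψ q.exploreEps) σ.load (σ.part i) with hy
  -- Nonnegative although `Ψ` is only monotone: compare with the load without the arm.
  have hy0 : ∀ i, 0 ≤ y i := by
    intro i
    have hle : ∀ j, σ.part i j ≤ σ.load j := by
      intro j
      rw [h.load_eq, Finset.sum_apply]
      exact single_le_sum (f := fun i => σ.part i j) (fun k _ => h.part_mem k j) (mem_univ i)
    have hmem : σ.load - σ.part i ∈ orthant d := fun j => sub_nonneg.mpr (hle j)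
    have h1 := hS.le_dirDeriv hmem (h.part_mem i)
    have h2 := hS.increment_nonneg hmem (h.part_mem i)
    rw [sub_add_cancel] at h1 h2
    exact h2.trans h1
  have hyle : ∀ i, y i ≤ q.unit * (q.quota + 1) := by
    intro i
    have h1 := hS.dirDeriv_le_norm hload (h.part_mem i)
    have h2 := h.norm_part_le i
    have h3 := h.plays_le i
    have h4 := R.norm_pos
    calc y i ≤ q.α * N (σ.part i) := h1
      _ ≤ q.α * ((q.quota + 1) * N 1) :=
        mul_le_mul_of_nonneg_left (h2.trans (mul_le_mul_of_nonneg_right h3 h4.le)) (by linarith)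
      _ = q.unit * (q.quota + 1) := by rw [Params.unit, R.norm_eq]; ring
  have hyz : ∀ i, q.cutoff < σ.score i → y i = 0 := by
    intro i hi
    simp [hy, h.part_eq_zero i hi, dirDeriv]
  have hden : (0 : ℝ) < ((σ.batches + 1 : ℕ) : ℝ) + q.offset := by positivity
  have hscore : ∀ i, (σ.closeBatch Ψ q).score i =
      σ.score i + y i / (((σ.batches + 1 : ℕ) : ℝ) + q.offset) := fun i => rfl
  have hscore_le : ∀ i, σ.score i ≤ (σ.closeBatch Ψ q).score i := by
    intro i
    rw [hscore]
    have := div_nonneg (hy0 i) hden.le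
    linarith
  have hrounds : ∑ i, q.quota * (g.active i + if σ.score i ≤ q.cutoff then 1 else 0) ≤ t := by
    refine le_trans (sum_le_sum fun i _ => ?_) h.rounds
    split_ifs with hi
    · have : q.quota ≤ σ.plays i := by
        by_contra! hlt
        exact hno i ⟨hi, hlt⟩
      linarith
    · linarith [h.plays_nonneg i]
  have hact0 : ∀ i, 0 ≤ g.active i + if σ.score i ≤ q.cutoff then (1 : ℝ) else 0 := by
    intro i
    have := h.active_nonneg i
    split_ifs <;> linarith
  constructor
  · simp [Learner.closeBatch]
  · intro i; exact zero_mem_orthant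
  · intro i j
    exact (h.part_mem i j).trans (h.part_le i j)
  · intro i; simp [Learner.closeBatch]
  · intro i; simp [Learner.closeBatch]; linarith
  · intro i; simp [Learner.closeBatch]
  · intro i _; rfl
  · exact hact0
  · simpa [Learner.closeBatch] using hrounds
  -- A surviving arm has been played in all batches.
  · obtain ⟨i, hi⟩ := hex
    have h1 := single_le_sum
      (f := fun i => q.quota * (g.active i + if σ.score i ≤ q.cutoff then 1 else 0))
      (fun k _ => mul_nonneg hq.le (hact0 k)) (mem_univ i)
    simp only [hi, if_true, h.active_eq i hi] at h1
    have e : ((σ.closeBatch Ψ q).batches : ℝ) = σ.batches + 1 := by simp [Learner.closeBatch]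
    rw [e]
    exact h1.trans hrounds
  · intro i
    exact (h.score_nonneg i).trans (hscore_le i)
  · intro i hi
    have hi' := (hscore_le i).trans hi
    simp [hi', h.active_eq i hi', Learner.closeBatch]
  · intro i hi
    have hi' := (hscore_le i).trans hi
    have e : ((σ.closeBatch Ψ q).batches : ℝ) = ((σ.batches + 1 : ℕ) : ℝ) := rfl
    rw [hscore, e, mul_add, mul_div_cancel₀ _ hden.ne']
    have h1 := h.price_le_score i hi'
    have h2 := h.score_nonneg i
    push_cast
    show g.price i + y i ≤ _
    nlinarith
  · intro i
    show g.price i + y i ≤ ((g.active i + if σ.score i ≤ q.cutoff then 1 else 0) + q.offset) * _ + _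
    by_cases hi : σ.score i ≤ q.cutoff
    · have h1 := h.price_le_score i hi
      have h2 : (σ.batches + q.offset) * σ.score i ≤ (σ.batches + q.offset) * q.cutoff :=
        mul_le_mul_of_nonneg_left hi (by positivity)
      have h3 := R.cutoff_pos
      have h4 := hyle i
      simp only [hi, if_true, h.active_eq i hi]
      nlinarith
    · rw [hyz i (not_le.mp hi)]
      simpa [hi] using h.price_le i
  -- By convexity the price of the whole batch is at least the potential at its load, up to the
  -- additive error.
  · have h1 := h.norm_closed_le
    have h2 : N g.total ≤ N (g.total - σ.load) + N σ.load := by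
      have := map_add_le_add N (g.total - σ.load) σ.load
      rwa [sub_add_cancel] at this
    have h3 := hS.norm_le _ hload
    have h4 := hS.le_dirDeriv zero_mem_orthant hload
    rw [zero_add] at h4
    have h5 := hS.zero_le_div
    have h6 : dirDeriv (Ψ q.exploreEps) σ.load σ.load = ∑ i, y i := by
      have := dirDeriv_sum (Ψ q.exploreEps) σ.load univ (fun _ => 1) σ.part
      simp only [one_smul, one_mul, ← h.load_eq] at this
      exact this
    have e : ((σ.closeBatch Ψ q).batches : ℝ) = σ.batches + 1 := by simp [Learner.closeBatch]
    show N (g.total - 0) ≤ ∑ i, (g.price i + y i) + _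
    rw [sub_zero, sum_add_distrib, e]
    linarith
  -- The price of the comparator is bounded by the norm of its load, in every batch.
  · intro x hx
    have h1 := h.score_comb_le x hx
    have h2 : ∑ i, x i * y i ≤ q.α * N (∑ i, x i • g.colTotal i) := by
      rw [hy, ← dirDeriv_sum]
      refine (hS.dirDeriv_le_norm hload (combination_mem hx h.part_mem)).trans ?_
      exact mul_le_mul_of_nonneg_left (norm_combination_le R.norm hx h.part_mem h.part_le)
        (by linarith)
    have e1 : ∑ i, x i * (σ.closeBatch Ψ q).score i =
        ∑ i, x i * σ.score i + (∑ i, x i * y i) * (1 / (((σ.batches + 1 : ℕ) : ℝ) + q.offset)) := by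
      rw [sum_mul, ← sum_add_distrib]
      refine sum_congr rfl fun i _ => ?_
      rw [hscore]; ring
    have h3 := mul_le_mul_of_nonneg_right h2 (one_div_pos.mpr hden).le
    have h4 := mul_le_mul_of_nonneg_left (R.inv_add_log_le σ.batches)
      (mul_nonneg (show 0 ≤ q.α by linarith) (apply_nonneg N (∑ i, x i • g.colTotal i)))
    rw [e1]
    show _ ≤ q.α * (Real.log (1 + ((σ.batches + 1 : ℕ) : ℝ) / q.offset) *
      N (∑ i, x i • g.colTotal i))
    linarith

theorem batches_le {σ : Learner n d} {g : Ledger n d} {t : ℕ} (h : ExploreInv q N σ g t)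
    (ht : t ≤ q.T) : (σ.batches : ℝ) ≤ n * q.offset := by
  have h1 := h.batches_le
  have h2 := R.rounds_eq
  have h3 : (t : ℝ) ≤ q.T := by exact_mod_cast ht
  exact le_of_mul_le_mul_left (by linarith) R.quota_pos

/-- The load of the exploration is small no matter what. -/
theorem norm_total_explore_le {σ : Learner n d} {g : Ledger n d} {t : ℕ}
    (h : ExploreInv q N σ g t) (ht : t ≤ q.T) : N g.total ≤ 16 * (q.unit * q.scale) := by
  have hq := R.quota_pos
  have hoff := R.offset_pos
  have hN := R.norm_pos
  have hU := R.unit_pos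
  have hc := R.cutoff_pos
  have hn := R.n_two
  have hNU := R.norm_le_unit
  have hr := R.batches_le h ht
  have hT : (t : ℝ) ≤ q.T := by exact_mod_cast ht
  have h1 : N g.total ≤ N (g.total - σ.load) + N σ.load := by
    have := map_add_le_add N (g.total - σ.load) σ.load
    rwa [sub_add_cancel] at this
  have h2 : N σ.load ≤ (n * (q.quota + 1)) * q.unit := by
    rw [h.load_eq]
    have e1 : N (∑ i, σ.part i) ≤ ∑ i, N (σ.part i) :=
      le_sum_of_subadditive N (map_zero N).le (map_add_le_add N) _ _
    have e2 : ∑ i, N (σ.part i) ≤ ∑ _i : Fin n, (q.quota + 1) * q.unit :=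
      sum_le_sum fun i _ => (h.norm_part_le i).trans
        (mul_le_mul (h.plays_le i) hNU hN.le (by linarith))
    refine (e1.trans e2).trans_eq ?_
    rw [sum_const, card_univ, Fintype.card_fin, nsmul_eq_mul, mul_assoc]
  have h3 : σ.batches * (q.γ / q.exploreEps) ≤ n * q.unit := by
    have e0 : 0 ≤ q.γ / q.exploreEps := div_nonneg R.γ_nonneg R.exploreEps_pos.le
    calc σ.batches * (q.γ / q.exploreEps) ≤ n * q.offset * (q.γ / q.exploreEps) :=
          mul_le_mul_of_nonneg_right hr e0
      _ = n * (q.offset * (q.γ / q.exploreEps)) := by ring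
      _ ≤ n * q.unit :=
          mul_le_mul_of_nonneg_left (R.offset_mul_error_le.trans hNU) (by linarith)
  have h4 : ∑ i, g.active i ≤ n * q.offset := by
    have e1 : q.quota * ∑ i, g.active i ≤ q.quota * (n * q.offset) := by
      rw [← R.rounds_eq, mul_sum]
      refine le_trans (sum_le_sum fun i _ => ?_) (h.rounds.trans hT)
      linarith [h.plays_nonneg i]
    exact le_of_mul_le_mul_left e1 hq
  have h5 : ∑ i, g.price i ≤
      (∑ i, g.active i + n * q.offset) * q.cutoff + n * (q.unit * (q.quota + 1)) := by
    refine (sum_le_sum fun i _ => h.price_le i).trans_eq ?_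
    rw [sum_add_distrib, ← sum_mul, sum_add_distrib]
    simp
  have h6 : (∑ i, g.active i + n * q.offset) * q.cutoff ≤ 8 * (q.unit * q.scale) := by
    calc (∑ i, g.active i + n * q.offset) * q.cutoff
        ≤ (n * q.offset + n * q.offset) * q.cutoff := by gcongr
      _ = 8 * (q.unit * (n * (q.logTerm * q.offset))) := by rw [Params.cutoff]; ring
      _ = 8 * (q.unit * q.scale) := by rw [R.logTerm_mul_offset, R.n_mul_quota]
  have h7 := mul_le_mul_of_nonneg_left R.n_le_scale hU.le
  have h8 : n * (q.unit * (q.quota + 1)) = q.unit * q.scale + q.unit * n := by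
    rw [← R.n_mul_quota]; ring
  have h9 := h.norm_closed_le
  have h10 : 0 < q.unit * q.scale := mul_pos hU q.scale_pos
  have h11 : n * (q.quota + 1) * q.unit = n * (q.unit * (q.quota + 1)) := by ring
  linarith

/-- If all arms have been dropped, then every comparator has a large load. -/
theorem norm_lt_of_dropped {σ : Learner n d} {g : Ledger n d} {t : ℕ}
    (h : ExploreInv q N σ g t) (ht : t ≤ q.T) (hall : ∀ i, q.cutoff < σ.score i)
    {x : Fin n → ℝ} (hx : x ∈ stdSimplex ℝ (Fin n)) : N 1 < N (∑ i, x i • g.colTotal i) := by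
  have hα := R.one_le_α
  have hl := R.logTerm_pos
  have hN := R.norm_pos
  have hn := R.n_two
  have h1 : q.cutoff ≤ ∑ i, x i * σ.score i := by
    calc q.cutoff = ∑ i, x i * q.cutoff := by rw [← sum_mul, hx.2, one_mul]
      _ ≤ _ := sum_le_sum fun i _ => mul_le_mul_of_nonneg_left (hall i).le (hx.1 i)
  have h2 : Real.log (1 + σ.batches / q.offset) ≤ 2 * q.logTerm := by
    have e1 : (σ.batches : ℝ) / q.offset ≤ n := by
      rw [div_le_iff₀ R.offset_pos]
      exact R.batches_le h ht
    have e2 : (0 : ℝ) ≤ σ.batches / q.offset := div_nonneg (Nat.cast_nonneg _) R.offset_pos.le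
    have e3 : Real.log (1 + σ.batches / q.offset) ≤ Real.log ((n : ℝ) ^ 2) :=
      Real.log_le_log (by linarith) (by nlinarith)
    rw [Real.log_pow] at e3
    have := R.log_n_le
    push_cast at e3
    linarith
  have h3 := h.score_comb_le x hx
  have h4 : q.α * (Real.log (1 + σ.batches / q.offset) * N (∑ i, x i • g.colTotal i)) ≤
      q.α * (2 * q.logTerm * N (∑ i, x i • g.colTotal i)) :=
    mul_le_mul_of_nonneg_left (mul_le_mul_of_nonneg_right h2 (apply_nonneg N _)) (by linarith)
  have h5 : (2 * q.α * q.logTerm) * (2 * N 1) ≤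
      (2 * q.α * q.logTerm) * N (∑ i, x i • g.colTotal i) := by
    have : q.cutoff = (2 * q.α * q.logTerm) * (2 * N 1) := by
      rw [Params.cutoff, Params.unit, R.norm_eq]; ring
    linarith
  have := le_of_mul_le_mul_left h5 (by positivity)
  linarith

end Regime

end VectorBandits

/-! ### The stages of exponential weights -/

namespace VectorBandits

open Finset

/-- What holds after `t` rounds if the exploration is over. The bound `potential` is the usual one
of exponential weights, where the loss of the algorithm telescopes to the increase of the potential.
The bound `comparator` is where gradient stability enters: the losses of a comparator are charged to
the potential at the sum of the loads of the algorithm and of the comparator. -/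
structure StageInv {n d : ℕ} (q : Params) (N : Seminorm ℝ (Fin d → ℝ))
    (Ψ : ℝ → (Fin d → ℝ) → ℝ) (σ : Learner n d) (g : Ledger n d) (t : ℕ) : Prop where
  load_mem : σ.load ∈ orthant d
  colStage_mem : ∀ i, g.colStage i ∈ orthant d
  colStage_le : ∀ i j, g.colStage i j ≤ g.colTotal i j
  potential : ∑ i, σ.weight q i ≤
    n * Real.exp (-(q.rate * ((Ψ (q.eps σ.stage) σ.load - Ψ (q.eps σ.stage) 0) / q.unit)) +
      q.rate ^ 2 * ∑ i, σ.est i)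
  comparator : ∀ x ∈ stdSimplex ℝ (Fin n),
    q.eps σ.stage * (N 1 + N (∑ i, x i • g.colStage i)) ≤ 1 / 8 →
    q.unit * ∑ i, x i * g.lossStage i ≤
      Real.exp (3 / 8) * (Ψ (q.eps σ.stage) (σ.load + 1 + ∑ i, x i • g.colStage i) -
        Ψ (q.eps σ.stage) 1) - (Ψ (q.eps σ.stage) σ.load - Ψ (q.eps σ.stage) 0)
  lossStage_le : ∀ i, g.lossStage i ≤ t
  norm_past_le : N (g.total - σ.load) ≤
    16 * (q.unit * q.scale) + (2 ^ σ.stage - 1) * (129 * ((q.α + q.γ) * q.guess))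
  past_nonneg : 0 ≤ g.past
  explored : ∀ x ∈ stdSimplex ℝ (Fin n), N 1 < N (∑ i, x i • g.colTotal i)
  guess_lt : g.past < 1 / q.p → ∀ x ∈ stdSimplex ℝ (Fin n), ∀ k, k + 1 = σ.stage →
    2 ^ k * q.guess < N (∑ i, x i • g.colTotal i)

theorem exp_neg_le_quadratic {z : ℝ} (hz : 0 ≤ z) : Real.exp (-z) ≤ 1 - z + z ^ 2 / 2 := by
  have h1 := Real.quadratic_le_exp_of_nonneg hz
  have h2 : Real.exp (-z) * Real.exp z = 1 := by rw [← Real.exp_add]; simp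
  have h3 := Real.exp_pos (-z)
  have h4 := mul_le_mul_of_nonneg_left h1 h3.le
  rw [h2] at h4
  have h5 : (1 : ℝ) ≤ (1 - z + z ^ 2 / 2) * (1 + z + z ^ 2 / 2) := by
    have : (1 - z + z ^ 2 / 2) * (1 + z + z ^ 2 / 2) = 1 + (z ^ 2) ^ 2 / 4 := by ring
    rw [this]; exact le_add_of_nonneg_right (by positivity)
  exact le_of_mul_le_mul_right (h4.trans h5) (show 0 < 1 + z + z ^ 2 / 2 by positivity)

/-- One step of exponential weights with implicit exploration. -/
theorem exp_weights_step {P ℓ η : ℝ} (hP : 0 < P) (hℓ : 0 ≤ ℓ) (hℓ1 : ℓ ≤ 1)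
    (hη : 0 < η) :
    1 - P + P * Real.exp (-(η * (ℓ / (P + η / 2)))) ≤
      Real.exp (-(η * ℓ) + η ^ 2 * (ℓ / (P + η / 2))) := by
  have hD : 0 < P + η / 2 := by positivity
  set e := ℓ / (P + η / 2) with he
  have he0 : 0 ≤ e := by positivity
  have heq : P * e = ℓ - η / 2 * e := by
    have : e * (P + η / 2) = ℓ := div_mul_cancel₀ _ hD.ne'
    linarith
  have h1 := exp_neg_le_quadratic (mul_nonneg hη.le he0)
  have h2 : P * e * e ≤ e := by
    have : P * e ≤ 1 := by
      rw [heq]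
      have : 0 ≤ η / 2 * e := by positivity
      linarith
    nlinarith
  have h3 := Real.add_one_le_exp (-(η * ℓ) + η ^ 2 * e)
  refine le_trans ?_ h3
  have h4 := mul_le_mul_of_nonneg_left h1 hP.le
  have h5 : P * (1 - η * e + (η * e) ^ 2 / 2) =
      P - η * (P * e) + η ^ 2 / 2 * (P * e * e) := by ring
  rw [h5, heq] at h4
  have h6 : η ^ 2 / 2 * ((ℓ - η / 2 * e) * e) ≤ η ^ 2 / 2 * e := by
    rw [← heq]
    exact mul_le_mul_of_nonneg_left h2 (by positivity)
  nlinarith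

/-- The bias of implicit exploration makes the exponential of the scaled estimate integrable to
that of the loss. -/
theorem implicit_exploration_step {P ℓ η : ℝ} (hP : 0 < P) (hℓ : 0 ≤ ℓ) (hℓ1 : ℓ ≤ 1)
    (hη : 0 < η) :
    1 - P + P * Real.exp (η * (ℓ / (P + η / 2))) ≤ Real.exp (η * ℓ) := by
  have hz : 0 ≤ η * ℓ / P := by positivity
  -- `2 z / (z + 2) ≤ log (1 + z)` for `z = η ℓ / P`; the bias `η / 2` is chosen for this bound.
  have h1 := Real.le_log_one_add_of_nonneg hz
  have h2 : η * (ℓ / (P + η / 2)) ≤ 2 * (η * ℓ / P) / (η * ℓ / P + 2) := by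
    have e : 2 * (η * ℓ / P) / (η * ℓ / P + 2) = η * (ℓ / (P + η / 2 * ℓ)) := by
      have : 0 < η * ℓ + P * 2 := by positivity
      field_simp
      ring
    rw [e]
    gcongr
    nlinarith
  have h3 : Real.exp (η * (ℓ / (P + η / 2))) ≤ 1 + η * ℓ / P := by
    rw [← Real.exp_log (show 0 < 1 + η * ℓ / P by positivity)]
    exact Real.exp_le_exp.mpr (h2.trans h1)
  have h4 := mul_le_mul_of_nonneg_left h3 hP.le
  have h5 : P * (1 + η * ℓ / P) = P + η * ℓ := by field_simp
  have h6 := Real.add_one_le_exp (η * ℓ)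
  linarith

theorem exp_three_eighths_le : Real.exp (3 / 8) ≤ 146 / 100 := by
  refine le_of_pow_le_pow_left₀ (n := 8) (by norm_num) (by norm_num) ?_
  rw [← Real.exp_nat_mul]
  have h1 : ((8 : ℕ) : ℝ) * (3 / 8) = ((3 : ℕ) : ℝ) * 1 := by norm_num
  rw [h1, Real.exp_nat_mul]
  have h2 := Real.exp_one_lt_d9
  calc Real.exp 1 ^ 3 ≤ 2.7182818286 ^ 3 := pow_le_pow_left₀ (Real.exp_pos 1).le h2.le 3
    _ ≤ (146 / 100) ^ 8 := by norm_num

theorem Learner.sum_weight_pos {n d : ℕ} [NeZero n] (q : Params) (σ : Learner n d) :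
    0 < ∑ i, σ.weight q i :=
  sum_pos (fun _ _ => Real.exp_pos _) univ_nonempty

theorem Learner.weight_div_pos {n d : ℕ} [NeZero n] (q : Params) (σ : Learner n d) (a : Fin n) :
    0 < σ.weight q a / ∑ i, σ.weight q i := div_pos (Real.exp_pos _) (σ.sum_weight_pos q)

/-- A stage starts with the invariant. -/
theorem StageInv.fresh {n d : ℕ} {q : Params} {N : Seminorm ℝ (Fin d → ℝ)}
    {Ψ : ℝ → (Fin d → ℝ) → ℝ} {σ : Learner n d} {g : Ledger n d} {t : ℕ} (hload : σ.load = 0)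
    (hest : σ.est = 0) (hcol : g.colStage = 0) (hloss : g.lossStage = 0)
    (hcolT : ∀ i, g.colTotal i ∈ orthant d)
    (hnorm : N g.total ≤
      16 * (q.unit * q.scale) + (2 ^ σ.stage - 1) * (129 * ((q.α + q.γ) * q.guess)))
    (hpast : 0 ≤ g.past)
    (hexp : ∀ x ∈ stdSimplex ℝ (Fin n), N 1 < N (∑ i, x i • g.colTotal i))
    (hlt : g.past < 1 / q.p → ∀ x ∈ stdSimplex ℝ (Fin n), ∀ k, k + 1 = σ.stage →
      2 ^ k * q.guess < N (∑ i, x i • g.colTotal i)) :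
    StageInv q N Ψ σ g t := by
  constructor
  · rw [hload]; exact zero_mem_orthant
  · intro i; rw [hcol]; exact zero_mem_orthant
  · intro i j; rw [hcol]; exact hcolT i j
  · simp [Learner.weight, hload, hest]
  · intro x _ _
    simp [hload, hcol, hloss]
  · intro i; simp [hloss]
  · simpa [hload] using hnorm
  · exact hpast
  · exact hexp
  · exact hlt

namespace Regime

variable {n d : ℕ} {q : Params} {N : Seminorm ℝ (Fin d → ℝ)}
  {Ψ : ℝ → (Fin d → ℝ) → ℝ} (R : Regime n d q N Ψ)
include R

theorem loss_nonneg {σ : Learner n d} (hσ : σ.load ∈ orthant d) {c : Fin d → ℝ}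
    (hc : ∀ j, c j ∈ Set.Icc (0 : ℝ) 1) : 0 ≤ σ.loss Ψ q c :=
  div_nonneg ((R.stableAt _).increment_nonneg hσ fun j => (hc j).1) R.unit_pos.le

theorem loss_le_one {σ : Learner n d} (hσ : σ.load ∈ orthant d) {c : Fin d → ℝ}
    (hc : ∀ j, c j ∈ Set.Icc (0 : ℝ) 1) : σ.loss Ψ q c ≤ 1 := by
  rw [Learner.loss, div_le_one R.unit_pos]
  refine ((R.stableAt _).increment_le hσ fun j => (hc j).1).trans ?_
  rw [Params.unit, R.norm_eq]
  exact mul_le_mul_of_nonneg_left (N_mono R.norm (fun j => (hc j).1) fun j => (hc j).2)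
    (by linarith [R.one_le_α])

theorem sum_weight_observe_le [NeZero n] {σ : Learner n d} (hσ : σ.load ∈ orthant d) {c : Fin d → ℝ}
    (hc : ∀ j, c j ∈ Set.Icc (0 : ℝ) 1) (a : Fin n) :
    ∑ i, (σ.observe Ψ q c a).weight q i ≤ (∑ i, σ.weight q i) *
      Real.exp (-(q.rate * σ.loss Ψ q c) +
        q.rate ^ 2 * (σ.loss Ψ q c / (σ.weight q a / ∑ i, σ.weight q i + q.rate / 2))) := by
  set W := ∑ i, σ.weight q i with hW
  have hWpos : 0 < W := σ.sum_weight_pos q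
  set P := σ.weight q a / W with hP
  set e := σ.loss Ψ q c / (P + q.rate / 2) with he
  have h1 : ∀ i, (σ.observe Ψ q c a).weight q i =
      Function.update (σ.weight q) a (σ.weight q a * Real.exp (-(q.rate * e))) i := by
    intro i
    by_cases hi : i = a
    · subst hi
      simp only [Learner.weight, Learner.observe, Function.update_self]
      rw [← Real.exp_add, he, hP, hW]
      congr 1
      simp only [Learner.weight]
      ring
    · simp [Learner.weight, Learner.observe, hi]
  have h2 : ∑ i, (σ.observe Ψ q c a).weight q i = W * (1 - P + P * Real.exp (-(q.rate * e))) := by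
    rw [sum_congr rfl fun i _ => h1 i, sum_update_of_mem (mem_univ a)]
    have h3 : W = σ.weight q a + ∑ i ∈ univ \ {a}, σ.weight q i := by
      rw [hW, ← add_sum_erase univ _ (mem_univ a), sdiff_singleton_eq_erase]
    have h4 : W * P = σ.weight q a := mul_div_cancel₀ _ hWpos.ne'
    have h5 : W * (1 - P + P * Real.exp (-(q.rate * e))) =
        W - W * P + W * P * Real.exp (-(q.rate * e)) := by ring
    rw [h5, h4]
    linarith
  rw [h2]
  exact mul_le_mul_of_nonneg_left (exp_weights_step (σ.weight_div_pos q a)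
    (R.loss_nonneg hσ hc) (R.loss_le_one hσ hc) R.rate_pos) hWpos.le

/-- The potential grows at least as much as the losses of both the algorithm and the comparator. -/
theorem comparator_step {k : ℕ} {v S : Fin d → ℝ} (hv : v ∈ orthant d) (hS : S ∈ orthant d)
    {M : Matrix (Fin d) (Fin n) ℝ} (hM : ∀ i j, M i j ∈ Set.Icc (0 : ℝ) 1) (a : Fin n)
    {x : Fin n → ℝ} (hx : x ∈ stdSimplex ℝ (Fin n))
    (hsmall : q.eps k * (N 1 + N (S + ∑ i, x i • fun j => M j i)) ≤ 1 / 8) :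
    ∑ i, x i * (Ψ (q.eps k) (v + fun j => M j i) - Ψ (q.eps k) v) +
        (Ψ (q.eps k) (v + fun j => M j a) - Ψ (q.eps k) v) ≤
      Real.exp (3 / 8) * (Ψ (q.eps k) ((v + fun j => M j a) + 1 + (S + ∑ i, x i • fun j => M j i)) -
        Ψ (q.eps k) (v + 1 + S)) := by
  have hψ := R.stableAt k
  have hε := R.eps_pos k
  have hcol : ∀ i, (fun j => M j i) ∈ orthant d := fun i j => (hM j i).1
  have hrest : ∀ i, (1 - fun j => M j i) ∈ orthant d := fun i j => by
    simpa using (hM j i).2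
  have hrest_le : ∀ i, N (1 - fun j => M j i) ≤ N 1 := fun i =>
    N_mono R.norm (hrest i) fun j => by simpa using (hM j i).1
  set s : Fin d → ℝ := ∑ i, x i • fun j => M j i with hs
  have hsmem : s ∈ orthant d := combination_mem hx hcol
  have hSs : N S ≤ N (S + s) := N_mono R.norm hS fun j => by simpa using hsmem j
  have move : ∀ (i : Fin n) (S' : Fin d → ℝ), S' ∈ orthant d → N S' ≤ N (S + s) →
      Ψ (q.eps k) (v + fun j => M j i) - Ψ (q.eps k) v ≤
        Real.exp (3 / 8) * dirDeriv (Ψ (q.eps k)) (v + 1 + S') fun j => M j i := by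
    intro i S' hS' hle
    have h1 := hψ.le_dirDeriv hv (hcol i)
    have h2 := hψ.increment_nonneg hv (hcol i)
    have e : v + 1 + S' = (v + fun j => M j i) + ((1 - fun j => M j i) + S') := by abel
    have h3 : q.eps k * N ((1 - fun j => M j i) + S') + 1 / 4 ≤ 3 / 8 := by
      have h4 := map_add_le_add N (1 - fun j => M j i) S'
      have h5 : q.eps k * N ((1 - fun j => M j i) + S') ≤ q.eps k * (N 1 + N (S + s)) :=
        mul_le_mul_of_nonneg_left (by linarith [hrest_le i]) hε.le
      linarith
    rw [e]
    exact h1.trans (hψ.dirDeriv_stable (add_mem_orthant hv (hcol i))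
      (add_mem_orthant (hrest i) hS') (hcol i) h3 (h2.trans h1))
  have hz : v + 1 + S ∈ orthant d := add_mem_orthant (add_mem_orthant hv one_mem_orthant) hS
  have hzs : v + 1 + (S + s) ∈ orthant d :=
    add_mem_orthant (add_mem_orthant hv one_mem_orthant) (add_mem_orthant hS hsmem)
  have h1 : ∑ i, x i * (Ψ (q.eps k) (v + fun j => M j i) - Ψ (q.eps k) v) ≤
      Real.exp (3 / 8) * (Ψ (q.eps k) (v + 1 + (S + s)) - Ψ (q.eps k) (v + 1 + S)) := by
    calc ∑ i, x i * (Ψ (q.eps k) (v + fun j => M j i) - Ψ (q.eps k) v)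
        ≤ ∑ i, x i * (Real.exp (3 / 8) * dirDeriv (Ψ (q.eps k)) (v + 1 + S) fun j => M j i) :=
          sum_le_sum fun i _ => mul_le_mul_of_nonneg_left (move i S hS hSs) (hx.1 i)
      _ = Real.exp (3 / 8) * dirDeriv (Ψ (q.eps k)) (v + 1 + S) s := by
          rw [hs, dirDeriv_sum, mul_sum]
          exact sum_congr rfl fun i _ => by ring
      _ ≤ _ := by
          refine mul_le_mul_of_nonneg_left ?_ (Real.exp_pos _).le
          have := hψ.dirDeriv_le hz hsmem
          rwa [add_assoc (v + 1) S s] at this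
  have h2 : Ψ (q.eps k) (v + fun j => M j a) - Ψ (q.eps k) v ≤ Real.exp (3 / 8) *
      (Ψ (q.eps k) ((v + fun j => M j a) + 1 + (S + s)) - Ψ (q.eps k) (v + 1 + (S + s))) := by
    refine (move a (S + s) (add_mem_orthant hS hsmem) le_rfl).trans ?_
    refine mul_le_mul_of_nonneg_left ?_ (Real.exp_pos _).le
    have := hψ.dirDeriv_le hzs (hcol a)
    have e : (v + fun j => M j a) + 1 + (S + s) = v + 1 + (S + s) + fun j => M j a := by abel
    rwa [e]
  rw [mul_sub] at h1 h2 ⊢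
  linarith

theorem stageInv_observe [NeZero n] {σ : Learner n d} {g : Ledger n d} {t : ℕ}
    (h : StageInv q N Ψ σ g t) {M : Matrix (Fin d) (Fin n) ℝ}
    (hM : ∀ i j, M i j ∈ Set.Icc (0 : ℝ) 1) (a : Fin n) :
    StageInv q N Ψ (σ.observe Ψ q (fun j => M j a) a)
      { g with
        total := g.total + fun j => M j a
        colTotal := fun i j => g.colTotal i j + M j i
        colStage := fun i j => g.colStage i j + M j i
        lossStage := fun i => g.lossStage i + σ.loss Ψ q fun j => M j i } (t + 1) := by
  have hcol : ∀ i, (fun j => M j i) ∈ orthant d := fun i j => (hM j i).1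
  have hc : ∀ i, ∀ j, (fun j => M j i) j ∈ Set.Icc (0 : ℝ) 1 := fun i j => hM j i
  have hU := R.unit_pos
  have htot : ∀ x ∈ stdSimplex ℝ (Fin n), N (∑ i, x i • g.colTotal i) ≤
      N (∑ i, x i • (fun i j => g.colTotal i j + M j i) i) := fun x hx =>
    norm_combination_le R.norm hx (fun i j => (h.colStage_mem i j).trans (h.colStage_le i j))
      (fun i j => by linarith [(hM j i).1])
  constructor
  · exact add_mem_orthant h.load_mem (hcol a)
  · intro i; exact add_mem_orthant (h.colStage_mem i) (hcol i)
  · intro i j; simpa using h.colStage_le i j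
  · refine (R.sum_weight_observe_le h.load_mem (hc a) a).trans ?_
    refine (mul_le_mul_of_nonneg_right h.potential (Real.exp_pos _).le).trans_eq ?_
    rw [mul_assoc, ← Real.exp_add]
    congr 2
    simp only [Learner.observe]
    rw [sum_update_add, Learner.loss]
    ring
  · intro x hx hsmall
    set S := ∑ i, x i • g.colStage i with hS
    have hSmem : S ∈ orthant d := combination_mem hx h.colStage_mem
    have e1 : ∑ i, x i • (fun i j => g.colStage i j + M j i) i = S + ∑ i, x i • fun j => M j i := by
      rw [hS, ← sum_add_distrib]
      exact sum_congr rfl fun i _ => by rw [← smul_add]; rfl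
    have hsmall' : q.eps σ.stage * (N 1 + N (S + ∑ i, x i • fun j => M j i)) ≤ 1 / 8 := by
      rw [← e1]; exact hsmall
    have h0 : q.eps σ.stage * (N 1 + N S) ≤ 1 / 8 := by
      refine le_trans (mul_le_mul_of_nonneg_left ?_ (R.eps_pos _).le) hsmall'
      have : N S ≤ N (S + ∑ i, x i • fun j => M j i) :=
        N_mono R.norm hSmem fun j => by simpa using combination_mem hx hcol j
      linarith
    have h1 := h.comparator x hx h0
    have h2 := R.comparator_step h.load_mem hSmem hM a hx hsmall'
    show q.unit * ∑ i, x i * (g.lossStage i + σ.loss Ψ q fun j => M j i) ≤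
      Real.exp (3 / 8) * (Ψ (q.eps σ.stage) ((σ.load + fun j => M j a) + 1 +
        ∑ i, x i • (fun i j => g.colStage i j + M j i) i) - Ψ (q.eps σ.stage) 1) -
        (Ψ (q.eps σ.stage) (σ.load + fun j => M j a) - Ψ (q.eps σ.stage) 0)
    rw [e1]
    have e2 : q.unit * ∑ i, x i * (g.lossStage i + σ.loss Ψ q fun j => M j i) =
        q.unit * ∑ i, x i * g.lossStage i +
        ∑ i, x i * (Ψ (q.eps σ.stage) (σ.load + fun j => M j i) - Ψ (q.eps σ.stage) σ.load) := by
      rw [mul_sum, mul_sum, ← sum_add_distrib]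
      refine sum_congr rfl fun i _ => ?_
      rw [Learner.loss]
      field_simp
    rw [e2]
    rw [mul_sub] at h1 h2 ⊢
    linarith
  · intro i
    have h1 := h.lossStage_le i
    have h2 := R.loss_le_one h.load_mem (hc i)
    push_cast
    exact add_le_add h1 h2
  · simpa [Learner.observe] using h.norm_past_le
  · exact h.past_nonneg
  · intro x hx
    exact (h.explored x hx).trans_le (htot x hx)
  · intro hp x hx k hk
    exact (h.guess_lt hp x hx k hk).trans_le (htot x hx)

/-- The regret bound of a stage whose estimated losses do not deviate much. -/
theorem increase_le {σ : Learner n d} {g : Ledger n d} {t : ℕ} (h : StageInv q N Ψ σ g t)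
    (ht : t ≤ q.T) (hdev : Ledger.deviation q σ.est g.lossStage < 2 ^ (σ.stage + 1) / q.p)
    {x : Fin n → ℝ} (hx : x ∈ stdSimplex ℝ (Fin n)) :
    Ψ (q.eps σ.stage) σ.load - Ψ (q.eps σ.stage) 0 ≤ q.unit * ∑ i, x i * g.lossStage i +
      (2 * σ.stage + 6) * (q.unit * q.scale) := by
  have hn := R.n_two
  have hη := R.rate_pos
  have hl := R.logTerm_pos
  have hU := R.unit_pos
  have hT : (t : ℝ) ≤ q.T := by exact_mod_cast ht
  set k := σ.stage with hk
  set A := (Ψ (q.eps k) σ.load - Ψ (q.eps k) 0) / q.unit with hA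
  have hest : ∀ i, q.rate * σ.est i ≤ q.rate * g.lossStage i + (k + 2) * q.logTerm := by
    intro i
    have h1 : Real.exp (q.rate * (σ.est i - g.lossStage i)) ≤
        n * Ledger.deviation q σ.est g.lossStage := by
      rw [Ledger.deviation, mul_div_cancel₀ _ (by linarith)]
      exact single_le_sum (f := fun i => Real.exp (q.rate * (σ.est i - g.lossStage i)))
        (fun _ _ => (Real.exp_pos _).le) (mem_univ i)
    have h2 : n * Ledger.deviation q σ.est g.lossStage ≤ n * (2 ^ (k + 1) / q.p) :=
      mul_le_mul_of_nonneg_left hdev.le (by linarith)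
    have h3 : (n : ℝ) * (2 ^ (k + 1) / q.p) =
        Real.exp (q.logTerm + (k + 1 : ℕ) * Real.log 2) := by
      rw [Real.exp_add, R.exp_logTerm, Real.exp_nat_mul, Real.exp_log (by norm_num)]
      ring
    rw [h3] at h2
    have h4 := Real.exp_le_exp.mp (h1.trans h2)
    have h5 : ((k + 1 : ℕ) : ℝ) * Real.log 2 ≤ (k + 1 : ℕ) * q.logTerm :=
      mul_le_mul_of_nonneg_left R.log_two_le (Nat.cast_nonneg _)
    push_cast at h4 h5
    linarith
  have hsum : q.rate ^ 2 * ∑ i, σ.est i ≤ (k + 3) * q.logTerm := by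
    have h1 : q.rate * ∑ i, σ.est i ≤ q.rate * (n * q.T) + (k + 2) * (n * q.logTerm) := by
      have e1 : ∑ i, q.rate * σ.est i ≤ ∑ _i : Fin n, (q.rate * q.T + (k + 2) * q.logTerm) := by
        refine sum_le_sum fun i _ => (hest i).trans ?_
        have := mul_le_mul_of_nonneg_left ((h.lossStage_le i).trans hT) hη.le
        linarith
      rw [← mul_sum, sum_const, card_univ, Fintype.card_fin, nsmul_eq_mul] at e1
      linarith
    rw [R.rate_mul_rounds] at h1
    have h2 : ((k : ℝ) + 2) * (n * q.logTerm) ≤ (k + 2) * q.scale :=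
      mul_le_mul_of_nonneg_left R.le_scale (by positivity)
    have h3 : q.rate * (q.rate * ∑ i, σ.est i) ≤ q.rate * ((k + 3) * q.scale) :=
      mul_le_mul_of_nonneg_left (by linarith) hη.le
    have h4 : q.rate * ((k + 3) * q.scale) = (k + 3) * q.logTerm := by
      rw [← q.rate_mul_scale]; ring
    rw [h4] at h3
    linarith
  have hAi : ∀ i, A ≤ g.lossStage i + (2 * k + 6) * q.scale := by
    intro i
    have h1 : Real.exp (-(q.rate * σ.est i)) ≤ ∑ i, σ.weight q i :=
      single_le_sum (f := fun i => σ.weight q i) (fun _ _ => (Real.exp_pos _).le) (mem_univ i)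
    have h2 := h1.trans h.potential
    rw [← Real.exp_log (show (0 : ℝ) < n by linarith), ← Real.exp_add] at h2
    have h3 := Real.exp_le_exp.mp h2
    have h4 := R.log_n_le
    have h5 := hest i
    have h6 : q.rate * A ≤ q.rate * (g.lossStage i + (2 * k + 6) * q.scale) := by
      have : q.rate * (g.lossStage i + (2 * k + 6) * q.scale) =
          q.rate * g.lossStage i + (2 * k + 6) * q.logTerm := by
        rw [← q.rate_mul_scale]; ring
      rw [this]
      linarith
    exact le_of_mul_le_mul_left h6 hη
  have h1 : A ≤ ∑ i, x i * g.lossStage i + (2 * k + 6) * q.scale := by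
    calc A = ∑ i, x i * A := by rw [← sum_mul, hx.2, one_mul]
      _ ≤ ∑ i, x i * (g.lossStage i + (2 * k + 6) * q.scale) :=
        sum_le_sum fun i _ => mul_le_mul_of_nonneg_left (hAi i) (hx.1 i)
      _ = _ := by simp only [mul_add, sum_add_distrib, ← sum_mul, hx.2, one_mul]
  have h2 : Ψ (q.eps k) σ.load - Ψ (q.eps k) 0 = q.unit * A := by
    rw [hA, mul_div_cancel₀ _ hU.ne']
  rw [h2]
  have := mul_le_mul_of_nonneg_left h1 hU.le
  linarith

/-- A stage is given up only if its guess was too small. Both the loss of the algorithm and that of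
the comparator are charged to the same potential, so the bound for the potential contains itself
with a factor `exp (3 / 8) / 2 < 1`. -/
theorem guess_lt_of_bound_lt {σ : Learner n d} {g : Ledger n d} {t : ℕ}
    (h : StageInv q N Ψ σ g t) (ht : t ≤ q.T)
    (hdev : Ledger.deviation q σ.est g.lossStage < 2 ^ (σ.stage + 1) / q.p)
    (hbound : q.bound σ.stage < Ψ (q.eps σ.stage) σ.load)
    {x : Fin n → ℝ} (hx : x ∈ stdSimplex ℝ (Fin n)) :
    2 ^ σ.stage * q.guess < N (∑ i, x i • g.colStage i) := by
  by_contra! hle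
  set k := σ.stage with hk
  set S := ∑ i, x i • g.colStage i with hS
  have hSmem : S ∈ orthant d := combination_mem hx h.colStage_mem
  have hψ := R.stableAt k
  have hγ := R.γ_nonneg
  have hα := R.one_le_α
  have hg := R.guess_pos
  have hpow : (1 : ℝ) ≤ 2 ^ k := one_le_pow₀ (by norm_num)
  have hsmall : q.eps k * (N 1 + N S) ≤ 1 / 8 := by
    have h1 : N 1 ≤ 2 ^ k * q.guess := by nlinarith [R.norm_le_guess]
    have h2 := mul_le_mul_of_nonneg_left (add_le_add h1 hle) (R.eps_pos k).le
    have h3 := R.eps_mul_guess k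
    linarith
  have h1 := R.increase_le h ht hdev hx
  have h2 := h.comparator x hx hsmall
  rw [← hk] at h1 h2
  have h3 : Ψ (q.eps k) (σ.load + 1 + S) ≤
      Ψ (q.eps k) σ.load + Ψ (q.eps k) 1 + Ψ (q.eps k) S := by
    have e1 := hψ.subadditive _ (add_mem_orthant h.load_mem one_mem_orthant) _ hSmem
    have e2 := hψ.subadditive _ h.load_mem _ one_mem_orthant
    linarith
  set B := (q.α + q.γ) * q.guess * 2 ^ k with hB
  have hB0 : 0 ≤ B := by
    have := R.αγ_pos
    positivity
  have h4 : Ψ (q.eps k) S ≤ 16 * B := by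
    have e1 := hψ.le_norm S hSmem
    rw [R.div_eps] at e1
    have e2 : q.α * N S ≤ q.α * (2 ^ k * q.guess) := mul_le_mul_of_nonneg_left hle (by linarith)
    have e3 : 0 ≤ q.α * (2 ^ k * q.guess) := by positivity
    rw [hB]
    linarith
  have h5 : Ψ (q.eps k) 0 ≤ 16 * B := by
    have e1 := hψ.zero_le_div
    rw [R.div_eps] at e1
    have e3 : 0 ≤ q.α * (2 ^ k * q.guess) := by positivity
    rw [hB]
    linarith
  have h6 : (2 * k + 6) * (q.unit * q.scale) ≤ 6 * B := by
    have e1 : q.unit * q.scale ≤ (q.α + q.γ) * q.guess := by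
      rw [R.αγ_mul_guess]
      have := R.αγ_pos
      have := R.norm_pos
      have : 0 < (q.α + q.γ) * N 1 := by positivity
      linarith
    have e2 : (2 * (k : ℝ) + 6) ≤ 6 * 2 ^ k := by
      have : (k : ℝ) + 1 ≤ 2 ^ k := by exact_mod_cast Nat.lt_two_pow_self
      linarith
    have e3 : 0 ≤ q.unit * q.scale := mul_nonneg R.unit_pos.le q.scale_pos.le
    calc (2 * k + 6) * (q.unit * q.scale) ≤ (6 * 2 ^ k) * ((q.α + q.γ) * q.guess) :=
          mul_le_mul e2 e1 e3 (by positivity)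
      _ = 6 * B := by rw [hB]; ring
  have h7 : q.bound k = 128 * B := by rw [Params.bound, hB]; ring
  rw [h7] at hbound
  have h8 := exp_three_eighths_le
  have h9 := hψ.nonneg h.load_mem
  have h10 := hψ.nonneg hSmem
  have h11 : Real.exp (3 / 8) * (Ψ (q.eps k) (σ.load + 1 + S) - Ψ (q.eps k) 1) ≤
      146 / 100 * (Ψ (q.eps k) σ.load + Ψ (q.eps k) S) :=
    mul_le_mul h8 (by linarith)
      (sub_nonneg.mpr (hψ.mono _ one_mem_orthant _
        (add_mem_orthant (add_mem_orthant h.load_mem one_mem_orthant) hSmem) fun j => by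
          have := h.load_mem j
          have := hSmem j
          simp only [Pi.add_apply]
          linarith)) (by norm_num)
  linarith

theorem potential_zero_le_bound (k : ℕ) : Ψ (q.eps k) 0 ≤ q.bound k := by
  have h1 := (R.stableAt k).zero_le_div
  rw [R.div_eps] at h1
  have := R.one_le_α
  have := R.γ_nonneg
  have := R.guess_pos
  have e : q.bound k = 128 * (q.α * (2 ^ k * q.guess)) + 112 * (q.γ * (2 ^ k * q.guess)) +
      16 * q.γ * (2 ^ k * q.guess) := by rw [Params.bound]; ring
  have : 0 ≤ q.α * (2 ^ k * q.guess) := by positivity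
  have : 0 ≤ q.γ * (2 ^ k * q.guess) := by positivity
  linarith

end Regime

end VectorBandits

/-! ### Invariants along a history, and the supermartingale -/

namespace VectorBandits

open Finset

/-- The probability of a history against the adversary `C`. -/
noncomputable def historyWeight {n d : ℕ} [NeZero n] (Ψ : ℝ → (Fin d → ℝ) → ℝ) (q : Params)
    (C : Adversary d n) : List (Fin n) → ℝ
  | [] => 1
  | a :: h => historyWeight Ψ q C h * (Learner.run Ψ q C h).prob q a

/-- The invariant of a state of the learner together with its ledger. -/
structure RunInv {n d : ℕ} [NeZero n] (q : Params) (N : Seminorm ℝ (Fin d → ℝ))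
    (Ψ : ℝ → (Fin d → ℝ) → ℝ) (σ : Learner n d) (g : Ledger n d) (t : ℕ) : Prop where
  explore : σ.exploring = true → ExploreInv q N σ g t ∧ σ.Playable q σ.arm ∧ σ.stage = 0 ∧
    g.colStage = 0 ∧ g.lossStage = 0 ∧ g.past = 0
  stage : σ.exploring = false → StageInv q N Ψ σ g t ∧
    Ψ (q.eps σ.stage) σ.load ≤ q.bound σ.stage

theorem Learner.prob_nonneg {n d : ℕ} [NeZero n] (q : Params) (σ : Learner n d) (a : Fin n) :
    0 ≤ σ.prob q a := by
  unfold Learner.prob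
  split_ifs
  · exact zero_le_one
  · exact le_rfl
  · exact (σ.weight_div_pos q a).le

theorem historyWeight_nonneg {n d : ℕ} [NeZero n] (Ψ : ℝ → (Fin d → ℝ) → ℝ) (q : Params)
    (C : Adversary d n) (h : List (Fin n)) : 0 ≤ historyWeight Ψ q C h := by
  induction h with
  | nil => exact zero_le_one
  | cons a h ih => exact mul_nonneg ih (Learner.prob_nonneg q _ a)

theorem Ledger.deviation_nonneg {n : ℕ} (q : Params) (est loss : Fin n → ℝ) :
    0 ≤ Ledger.deviation q est loss :=
  div_nonneg (sum_nonneg fun _ _ => (Real.exp_pos _).le) (Nat.cast_nonneg _)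

theorem Ledger.deviation_zero {n : ℕ} [NeZero n] (q : Params) :
    Ledger.deviation q (0 : Fin n → ℝ) 0 = 1 := by
  simp [Ledger.deviation, NeZero.ne n]

namespace Regime

variable {n d : ℕ} [NeZero n] {q : Params} {N : Seminorm ℝ (Fin d → ℝ)}
  {Ψ : ℝ → (Fin d → ℝ) → ℝ} (R : Regime n d q N Ψ)
include R

theorem runInv_explore_step {σ : Learner n d} {g : Ledger n d} {t : ℕ}
    (h : RunInv q N Ψ σ g t) (hex : σ.exploring = true) (ht : t + 1 ≤ q.T)
    {M : Matrix (Fin d) (Fin n) ℝ} (hM : ∀ i j, M i j ∈ Set.Icc (0 : ℝ) 1) :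
    RunInv q N Ψ (σ.step Ψ q (fun j => M j σ.arm) σ.arm) (g.step Ψ q σ M σ.arm) (t + 1) := by
  obtain ⟨h1, hplay, hk, hcs, hls, hp⟩ := h.explore hex
  have h2 := R.exploreInv_record h1 hM hplay
  by_cases hready : ∃ i, (σ.record (fun j => M j σ.arm) σ.arm).Playable q i
  · simp only [Learner.step, Ledger.step, hex, hready, if_true]
    refine ⟨fun _ => ⟨?_, lastArm_spec hready, hk, hcs, hls, hp⟩, fun hf => ?_⟩
    · cases h2; constructor <;> assumption
    · have : σ.exploring = false := hf
      simp [hex] at this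
  · have h3 := R.exploreInv_closeBatch h2 ⟨σ.arm, hplay.1⟩ (not_exists.mp hready)
    simp only [Learner.step, Ledger.step, hex, hready, if_true, if_false]
    set σ' := (σ.record (fun j => M j σ.arm) σ.arm).closeBatch Ψ q with hσ'
    refine ⟨fun hT => ?_, fun hF => ?_⟩
    · have hT' : ∃ i, σ'.Playable q i := by simpa [Learner.choose] using hT
      refine ⟨?_, lastArm_spec hT', hk, hcs, hls, hp⟩
      cases h3; constructor <;> assumption
    · have hF' : ¬∃ i, σ'.Playable q i := by
        simpa [Learner.choose] using hF
      have hdrop : ∀ i, q.cutoff < σ'.score i := by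
        intro i
        by_contra! hle
        exact hF' ⟨i, hle, R.quota_pos⟩
      refine ⟨StageInv.fresh rfl rfl hcs hls ?_ ?_ hp.ge ?_ ?_, ?_⟩
      · intro i j
        exact (h2.part_mem i j).trans (h2.part_le i j)
      · have e : (σ'.choose q).stage = 0 := hk
        rw [e]
        simpa using R.norm_total_explore_le h3 ht
      · intro x hx
        exact R.norm_lt_of_dropped h3 ht hdrop hx
      · intro _ x _ k hk'
        have e : (σ'.choose q).stage = 0 := hk
        omega
      · exact R.potential_zero_le_bound _

theorem runInv_stage_step {σ : Learner n d} {g : Ledger n d} {t : ℕ}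
    (h : RunInv q N Ψ σ g t) (hex : σ.exploring = false) (ht : t + 1 ≤ q.T)
    {M : Matrix (Fin d) (Fin n) ℝ} (hM : ∀ i j, M i j ∈ Set.Icc (0 : ℝ) 1) (a : Fin n) :
    RunInv q N Ψ (σ.step Ψ q (fun j => M j a) a) (g.step Ψ q σ M a) (t + 1) := by
  obtain ⟨h1, hpot⟩ := h.stage hex
  have h2 := R.stageInv_observe h1 hM a
  by_cases hb : q.bound σ.stage < Ψ (q.eps σ.stage) (σ.load + fun j => M j a)
  · simp only [Learner.step, Ledger.step, hex, hb, if_true, Bool.false_eq_true, if_false]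
    set lossStage : Fin n → ℝ := fun i => g.lossStage i + σ.loss Ψ q fun j => M j i
    set D := Ledger.deviation q (σ.observe Ψ q (fun j => M j a) a).est lossStage with hD
    have hD0 : 0 ≤ D := Ledger.deviation_nonneg _ _ _
    have hpow : (0 : ℝ) < 2 ^ (σ.stage + 1) := by positivity
    refine ⟨fun hT => ?_, fun _ => ⟨StageInv.fresh rfl rfl rfl rfl ?_ ?_ ?_ h2.explored ?_,
      R.potential_zero_le_bound _⟩⟩
    · have : σ.exploring = true := hT
      simp [hex] at this
    · intro i j
      exact (h2.colStage_mem i j).trans (h2.colStage_le i j)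
    · have e0 := h2.norm_past_le
      have e1 : N (g.total + fun j => M j a) ≤
          N ((g.total + fun j => M j a) - (σ.load + fun j => M j a)) +
            N (σ.load + fun j => M j a) := by
        have := map_add_le_add N ((g.total + fun j => M j a) - (σ.load + fun j => M j a))
          (σ.load + fun j => M j a)
        rwa [sub_add_cancel] at this
      have e2 : N (σ.load + fun j => M j a) ≤ q.bound σ.stage + N 1 := by
        refine (map_add_le_add N _ _).trans (add_le_add ?_ ?_)
        · exact ((R.stableAt _).norm_le _ h1.load_mem).trans hpot
        · exact N_mono R.norm (fun j => (hM j a).1) fun j => (hM j a).2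
      have e3 : N 1 ≤ (q.α + q.γ) * q.guess * 2 ^ σ.stage := by
        have g1 := R.norm_le_guess
        have g2 := R.one_le_α
        have g3 := R.γ_nonneg
        have g4 := R.guess_pos
        have g5 : (1 : ℝ) ≤ 2 ^ σ.stage := one_le_pow₀ (by norm_num)
        have g6 : q.guess ≤ (q.α + q.γ) * q.guess := by nlinarith
        have g7 : (q.α + q.γ) * q.guess ≤ (q.α + q.γ) * q.guess * 2 ^ σ.stage :=
          le_mul_of_one_le_right (by positivity) g5
        linarith
      have e4 : q.bound σ.stage = 128 * ((q.α + q.γ) * q.guess * 2 ^ σ.stage) := by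
        rw [Params.bound]; ring
      show N (g.total + fun j => M j a) ≤ 16 * (q.unit * q.scale) +
        (2 ^ (σ.stage + 1) - 1) * (129 * ((q.α + q.γ) * q.guess))
      have e0' : N ((g.total + fun j => M j a) - (σ.load + fun j => M j a)) ≤
        16 * (q.unit * q.scale) + (2 ^ σ.stage - 1) * (129 * ((q.α + q.γ) * q.guess)) := e0
      rw [pow_succ]
      linarith
    · exact add_nonneg h1.past_nonneg (div_nonneg hD0 hpow.le)
    · intro hp x hx k hk
      have hk' : k = σ.stage := by
        have : k + 1 = σ.stage + 1 := hk
        omega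
      subst hk'
      have hp' : g.past + D / 2 ^ (σ.stage + 1) < 1 / q.p := hp
      have hdev : D < 2 ^ (σ.stage + 1) / q.p := by
        have e1 : D / 2 ^ (σ.stage + 1) < 1 / q.p := by linarith [h1.past_nonneg]
        rw [div_lt_iff₀ hpow] at e1
        rw [div_eq_mul_one_div, mul_comm]
        exact e1
      have := R.guess_lt_of_bound_lt h2 ht hdev hb hx
      exact this.trans_le (norm_combination_le R.norm hx h2.colStage_mem h2.colStage_le)
  · simp only [Learner.step, Ledger.step, hex, hb, Bool.false_eq_true, if_false]
    refine ⟨fun hT => ?_, fun _ => ⟨h2, not_lt.mp hb⟩⟩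
    have : σ.exploring = true := hT
    simp [hex] at this

/-- The invariant holds along every history of positive probability. -/
theorem runInv {C : Adversary d n} (hC : C.IsBounded) :
    ∀ h : List (Fin n), h.length ≤ q.T → historyWeight Ψ q C h ≠ 0 →
      RunInv q N Ψ (Learner.run Ψ q C h) (Ledger.run Ψ q C h) h.length := by
  intro h
  induction h with
  | nil =>
    intro _ _
    refine ⟨fun _ => ⟨R.exploreInv_start, ⟨R.cutoff_pos.le, R.quota_pos⟩, rfl, rfl, rfl, rfl⟩,
      fun hF => ?_⟩
    simp [Learner.run, Learner.start] at hF
  | cons a h ih =>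
    intro ht hw
    simp only [historyWeight, ne_eq, mul_eq_zero, not_or] at hw
    simp only [List.length_cons] at ht ⊢
    have h1 := ih (by omega) hw.1
    simp only [Learner.run, Ledger.run]
    by_cases hex : (Learner.run Ψ q C h).exploring = true
    · have ha : a = (Learner.run Ψ q C h).arm := by
        by_contra hne
        exact hw.2 (by simp [Learner.prob, hex, hne])
      rw [ha]
      exact R.runInv_explore_step h1 hex ht (hC h)
    · exact R.runInv_stage_step h1 (by simpa using hex) ht (hC h) a

/-- The deviation of the estimated losses is a supermartingale. -/
theorem sum_prob_mul_deviation_le {σ : Learner n d} (hσ : σ.load ∈ orthant d)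
    (lossStage : Fin n → ℝ) {M : Matrix (Fin d) (Fin n) ℝ}
    (hM : ∀ i j, M i j ∈ Set.Icc (0 : ℝ) 1) :
    ∑ a, σ.weight q a / (∑ i, σ.weight q i) *
      Ledger.deviation q (σ.observe Ψ q (fun j => M j a) a).est
        (fun i => lossStage i + σ.loss Ψ q fun j => M j i) ≤
      Ledger.deviation q σ.est lossStage := by
  set W := ∑ i, σ.weight q i with hW
  have hWpos : 0 < W := σ.sum_weight_pos q
  set P : Fin n → ℝ := fun a => σ.weight q a / W with hP
  have hPsum : ∑ a, P a = 1 := by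
    rw [hP, ← sum_div, ← hW, div_self hWpos.ne']
  have hn : (0 : ℝ) < n := by exact_mod_cast Nat.pos_of_ne_zero (NeZero.ne n)
  have key : ∀ i, ∑ a, P a * Real.exp (q.rate *
      ((σ.observe Ψ q (fun j => M j a) a).est i -
        (lossStage i + σ.loss Ψ q fun j => M j i))) ≤
      Real.exp (q.rate * (σ.est i - lossStage i)) := by
    intro i
    set ℓ := σ.loss Ψ q fun j => M j i with hℓ
    set e := ℓ / (P i + q.rate / 2) with he
    set B := Real.exp (q.rate * (σ.est i - (lossStage i + ℓ))) with hB
    have h1 : ∀ a, P a * Real.exp (q.rate * ((σ.observe Ψ q (fun j => M j a) a).est i -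
        (lossStage i + ℓ))) = P a * B + if a = i then P i * B * (Real.exp (q.rate * e) - 1)
          else 0 := by
      intro a
      by_cases ha : a = i
      · subst ha
        have e1 : (σ.observe Ψ q (fun j => M j a) a).est a = σ.est a + e := by
          simp [Learner.observe, he, hP, hW, hℓ]
        have e2 : Real.exp (q.rate * (σ.est a + e - (lossStage a + ℓ))) =
            B * Real.exp (q.rate * e) := by
          rw [hB, ← Real.exp_add]; congr 1; ring
        rw [e1, e2, if_pos rfl]
        ring
      · have e1 : (σ.observe Ψ q (fun j => M j a) a).est i = σ.est i := by
          simp [Learner.observe, Ne.symm ha]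
        rw [e1, if_neg ha, add_zero]
    rw [sum_congr rfl fun a _ => h1 a, sum_add_distrib, ← sum_mul, hPsum, sum_ite_eq' univ i,
      if_pos (mem_univ i)]
    have h2 := implicit_exploration_step (σ.weight_div_pos q i)
      (R.loss_nonneg hσ (c := fun j => M j i) fun j => hM j i)
      (R.loss_le_one hσ (c := fun j => M j i) fun j => hM j i) R.rate_pos
    have h3 : 1 - P i + P i * Real.exp (q.rate * e) ≤ Real.exp (q.rate * ℓ) := h2
    have h4 := mul_le_mul_of_nonneg_left h3 (Real.exp_pos (q.rate * (σ.est i -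
      (lossStage i + ℓ)))).le
    have h5 : Real.exp (q.rate * (σ.est i - (lossStage i + ℓ))) * Real.exp (q.rate * ℓ) =
        Real.exp (q.rate * (σ.est i - lossStage i)) := by
      rw [← Real.exp_add]; congr 1; ring
    rw [h5, ← hB] at h4
    linarith
  have e : ∑ a, P a * Ledger.deviation q (σ.observe Ψ q (fun j => M j a) a).est
      (fun i => lossStage i + σ.loss Ψ q fun j => M j i) =
      (∑ i, ∑ a, P a * Real.exp (q.rate * ((σ.observe Ψ q (fun j => M j a) a).est i -
        (lossStage i + σ.loss Ψ q fun j => M j i)))) / n := by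
    rw [sum_comm, sum_div]
    refine sum_congr rfl fun a _ => ?_
    rw [Ledger.deviation, ← mul_div_assoc, mul_sum]
  rw [e, Ledger.deviation]
  exact div_le_div_of_nonneg_right (sum_le_sum fun i _ => key i) hn.le

/-- At the end of a stage its deviation is frozen in `Ledger.past`, and the budget of the stages to
come is split evenly between the next stage and the ones after it. -/
theorem sum_prob_mul_value_le {σ : Learner n d} {g : Ledger n d} {t : ℕ}
    (h : RunInv q N Ψ σ g t) {M : Matrix (Fin d) (Fin n) ℝ}
    (hM : ∀ i j, M i j ∈ Set.Icc (0 : ℝ) 1) :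
    ∑ a, σ.prob q a * (g.step Ψ q σ M a).value q (σ.step Ψ q (fun j => M j a) a) ≤
      g.value q σ := by
  by_cases hex : σ.exploring = true
  · obtain ⟨h1, hplay, hk, hcs, hls, hp⟩ := h.explore hex
    have e1 : ∀ a, σ.prob q a * (g.step Ψ q σ M a).value q (σ.step Ψ q (fun j => M j a) a) =
        if a = σ.arm then
          (g.step Ψ q σ M σ.arm).value q (σ.step Ψ q (fun j => M j σ.arm) σ.arm) else 0 := by
      intro a
      by_cases ha : a = σ.arm
      · simp [Learner.prob, hex, ha]
      · simp [Learner.prob, hex, ha]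
    rw [sum_congr rfl fun a _ => e1 a, sum_ite_eq' univ σ.arm, if_pos (mem_univ _)]
    have e2 : g.value q σ = 1 := by simp [Ledger.value, hex]
    rw [e2]
    by_cases hready : ∃ i, (σ.record (fun j => M j σ.arm) σ.arm).Playable q i
    · have : (σ.step Ψ q (fun j => M j σ.arm) σ.arm).exploring = true := by
        simp only [Learner.step, hex, hready, if_true]
        exact hex
      simp [Ledger.value, this]
    · set σ' := ((σ.record (fun j => M j σ.arm) σ.arm).closeBatch Ψ q).choose q
      have e3 : σ.step Ψ q (fun j => M j σ.arm) σ.arm = σ' := by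
        simp only [Learner.step, hex, hready, if_true, if_false]
        rfl
      rw [e3, Ledger.value]
      split_ifs with hT
      · exact le_rfl
      · have e4 : (g.step Ψ q σ M σ.arm).past = 0 := by
          simp only [Ledger.step, hex, hready, if_true, if_false]
          exact hp
        have e5 : (g.step Ψ q σ M σ.arm).lossStage = 0 := by
          simp only [Ledger.step, hex, hready, if_true, if_false]
          exact hls
        have e6 : σ'.est = 0 := rfl
        have e7 : σ'.stage = 0 := hk
        rw [e4, e5, e6, e7, Ledger.deviation_zero]
        norm_num
  · have hex' : σ.exploring = false := by simpa using hex
    obtain ⟨h1, -⟩ := h.stage hex'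
    have e1 : ∀ a, (g.step Ψ q σ M a).value q (σ.step Ψ q (fun j => M j a) a) =
        g.past + (Ledger.deviation q (σ.observe Ψ q (fun j => M j a) a).est
          (fun i => g.lossStage i + σ.loss Ψ q fun j => M j i) + 1) / 2 ^ (σ.stage + 1) := by
      intro a
      by_cases hb : q.bound σ.stage < Ψ (q.eps σ.stage) (σ.load + fun j => M j a)
      · simp only [Learner.step, Ledger.step, hex', hb, if_true, Bool.false_eq_true, if_false,
          Ledger.value, Learner.restart, Learner.observe, Ledger.deviation_zero]
        rw [pow_succ (2 : ℝ) (σ.stage + 1)]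
        field_simp
        ring
      · simp [Learner.step, Ledger.step, hex', hb, Ledger.value, Learner.observe]
    have e2 : ∀ a, σ.prob q a = σ.weight q a / ∑ i, σ.weight q i := by
      intro a; simp [Learner.prob, hex']
    have e3 : ∑ a, σ.weight q a / (∑ i, σ.weight q i) = 1 := by
      rw [← sum_div, div_self (σ.sum_weight_pos q).ne']
    have e4 := R.sum_prob_mul_deviation_le h1.load_mem g.lossStage hM
    have hpow : (0 : ℝ) < 2 ^ (σ.stage + 1) := by positivity
    have e5 : g.value q σ =
        g.past + (Ledger.deviation q σ.est g.lossStage + 1) / 2 ^ (σ.stage + 1) := by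
      simp [Ledger.value, hex']
    rw [e5]
    simp only [e1, e2]
    have e6 : ∀ a, σ.weight q a / (∑ i, σ.weight q i) * (g.past +
        (Ledger.deviation q (σ.observe Ψ q (fun j => M j a) a).est
          (fun i => g.lossStage i + σ.loss Ψ q fun j => M j i) + 1) / 2 ^ (σ.stage + 1)) =
        σ.weight q a / (∑ i, σ.weight q i) * (g.past + 1 / 2 ^ (σ.stage + 1)) +
        (σ.weight q a / (∑ i, σ.weight q i) *
          Ledger.deviation q (σ.observe Ψ q (fun j => M j a) a).est
          (fun i => g.lossStage i + σ.loss Ψ q fun j => M j i)) / 2 ^ (σ.stage + 1) := by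
      intro a; ring
    rw [sum_congr rfl fun a _ => e6 a, sum_add_distrib, ← sum_mul, e3, ← sum_div, add_div]
    have := div_le_div_of_nonneg_right e4 hpow.le
    linarith

/-- The deterministic half of the theorem: on a history of positive probability on which the
supermartingale stays below `1 / p`, the load of the algorithm is bounded. -/
theorem norm_total_le {σ : Learner n d} {g : Ledger n d} {t : ℕ} (h : RunInv q N Ψ σ g t)
    (ht : t ≤ q.T) (hv : g.value q σ < 1 / q.p) {x : Fin n → ℝ}
    (hx : x ∈ stdSimplex ℝ (Fin n)) :
    N g.total ≤ 600 * ((q.α + q.γ) * N (∑ i, x i • g.colTotal i) + q.unit * q.scale) := by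
  have hG := R.αγ_pos
  have hU := mul_pos R.unit_pos q.scale_pos
  have hX : 0 ≤ (q.α + q.γ) * N (∑ i, x i • g.colTotal i) := mul_nonneg hG.le (apply_nonneg N _)
  by_cases hex : σ.exploring = true
  · have := R.norm_total_explore_le (h.explore hex).1 ht
    linarith
  · have hex' : σ.exploring = false := by simpa using hex
    obtain ⟨h1, hpot⟩ := h.stage hex'
    have hpast : g.past < 1 / q.p := by
      rw [Ledger.value, if_neg hex] at hv
      have : 0 ≤ (Ledger.deviation q σ.est g.lossStage + 1) / 2 ^ (σ.stage + 1) := by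
        have := Ledger.deviation_nonneg q σ.est g.lossStage
        positivity
      linarith
    have e1 : N g.total ≤ N (g.total - σ.load) + N σ.load := by
      have := map_add_le_add N (g.total - σ.load) σ.load
      rwa [sub_add_cancel] at this
    have e2 := (R.stableAt σ.stage).norm_le _ h1.load_mem
    have e3 := h1.norm_past_le
    have e4 : q.bound σ.stage = 128 * ((q.α + q.γ) * q.guess * 2 ^ σ.stage) := by
      rw [Params.bound]; ring
    set B := (q.α + q.γ) * q.guess * 2 ^ σ.stage with hB
    have hGg : 0 < (q.α + q.γ) * q.guess := mul_pos hG R.guess_pos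
    have e5 : N g.total ≤ 16 * (q.unit * q.scale) + 257 * B := by
      have : (2 ^ σ.stage - 1) * (129 * ((q.α + q.γ) * q.guess)) =
          129 * B - 129 * ((q.α + q.γ) * q.guess) := by rw [hB]; ring
      linarith
    rcases Nat.eq_zero_or_pos σ.stage with hk | hk
    · have e6 : B = (q.α + q.γ) * N 1 + q.unit * q.scale := by
        rw [hB, hk, pow_zero, mul_one, R.αγ_mul_guess]
      have e7 := mul_le_mul_of_nonneg_left (h1.explored x hx).le hG.le
      linarith
    · obtain ⟨k, hk'⟩ : ∃ k, k + 1 = σ.stage := ⟨σ.stage - 1, by omega⟩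
      have e6 := mul_le_mul_of_nonneg_left (h1.guess_lt hpast x hx k hk').le hG.le
      have e7 : B = 2 * ((q.α + q.γ) * (2 ^ k * q.guess)) := by
        rw [hB, ← hk', pow_succ]; ring
      linarith

end Regime

end VectorBandits

/-! ### The program -/

namespace VectorBandits

namespace Prog

/-- A real variable: entry `0` of array `a`, where register `4` holds the number zero. -/
def var (a : ℕ) : Loc := ⟨a, 4⟩

/-- Sequential composition of a list of programs. -/
def block : List Prog → Prog
  | [] => skip
  | [P] => P
  | P :: Q :: L => seq P (block (Q :: L))

/-- Clear the first `reg r` entries of array `a`. -/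
def clear (r i a : ℕ) : Prog := forLoop r i (cast ⟨a, i⟩ 4)

end Prog

open Prog

/-! The integer registers of the algorithm hold: `0` the action, `1`, `2`, `3` the sizes `n`, `d`,
`T`, `4`, `5`, `12`, `13` the numbers zero to three, `6` the mode (zero during the exploration), `7`
and `8` loop counters, `9` a position in array `11`, `10` the next arm of the exploration, `11`
whether there is one. The arrays `0`, `1`, `2` hold the input, the random number and the feedback,
the arrays `10` to `14` the fields `load`, `part` (row by row), `plays`, `score` and `est` of the
learner, array `15` the weights, array `16` a gradient. The variables `20` to `37` hold the
parameters, `36` and `37` the bound and the scale of the current stage, `38` the discount, `39` and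
`43` the numbers one and two, `40` the current value of the potential; the other variables are
auxiliary. -/

/-- The constants zero to three, and the parameters as variables. -/
def initInput : Prog := block
  [const 5 1, const 12 2, const 13 3, copy (var 20) ⟨0, 5⟩, copy (var 21) ⟨0, 12⟩,
    copy (var 22) ⟨0, 13⟩, cast (var 23) 1, cast (var 24) 3, cast (var 39) 5, cast (var 43) 12]

/-- `Params.logTerm`, `Params.scale`, `Params.rate` and `Params.quota`. -/
def initScale : Prog := block
  [bin .div (var 25) (var 23) (var 0), un .log (var 25) (var 25),
    bin .mul (var 26) (var 24) (var 23), bin .mul (var 26) (var 26) (var 25),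
    un .log (var 26) (var 26), bin .div (var 26) (var 26) (var 43), un .exp (var 26) (var 26),
    bin .div (var 27) (var 25) (var 26), bin .div (var 28) (var 27) (var 43),
    bin .div (var 29) (var 26) (var 23)]

/-- The parameters of the exploration. -/
def initExplore : Prog := block
  [bin .div (var 30) (var 29) (var 25), bin .mul (var 31) (var 20) (var 22),
    const 7 4, cast (var 42) 7, bin .mul (var 32) (var 25) (var 31),
    bin .mul (var 32) (var 42) (var 32), bin .add (var 33) (var 21) (var 39),
    bin .mul (var 33) (var 33) (var 30), bin .div (var 33) (var 33) (var 22),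
    copy (var 38) (var 30)]

/-- The parameters of the first stage. -/
def initStage : Prog := block
  [bin .add (var 35) (var 20) (var 21), bin .mul (var 34) (var 31) (var 26),
    bin .div (var 34) (var 34) (var 35), bin .add (var 34) (var 22) (var 34),
    const 7 128, cast (var 42) 7, bin .mul (var 36) (var 35) (var 34),
    bin .mul (var 36) (var 42) (var 36), const 7 16, cast (var 42) 7,
    bin .mul (var 37) (var 42) (var 34), bin .div (var 37) (var 39) (var 37)]

/-- The weights of the arms and their sum. -/
def weigh : Prog := seq (cast (var 44) 4)
  (forLoop 1 7 (block
    [bin .mul (var 42) (var 27) ⟨14, 7⟩, cast (var 41) 4, bin .sub (var 42) (var 41) (var 42),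
      un .exp ⟨15, 7⟩ (var 42), bin .add (var 44) (var 44) ⟨15, 7⟩]))

/-- Inversion sampling from the weights. -/
def sample : Prog := block
  [bin .mul (var 45) (var 1) (var 44), cast (var 46) 4,
    forLoop 1 7 (seq (ifReal (var 45) (var 46) skip (natAdd 0 7 4))
      (bin .add (var 46) (var 46) ⟨15, 7⟩))]

/-- Add the feedback to `load`. -/
def addLoad : Prog := forLoop 2 8 (bin .add ⟨10, 8⟩ ⟨10, 8⟩ ⟨2, 8⟩)

/-- Compute the position of the row of the current arm in `part`. -/
def findRow : Prog := seq (const 9 0) (forLoop 1 7 (ifNat 7 10 (natAdd 9 9 2) skip))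

/-- Add the feedback to the row of `part` at the position in register `9`. -/
def addRow : Prog :=
  forLoop 2 8 (seq (bin .add ⟨11, 9⟩ ⟨11, 9⟩ ⟨2, 8⟩) (natAdd 9 9 5))

/-- Find the last playable arm. -/
def scan : Prog := seq (const 11 0)
  (forLoop 1 7 (ifReal (var 32) ⟨13, 7⟩ skip
    (ifReal ⟨12, 7⟩ (var 29) (seq (natAdd 10 7 4) (natAdd 11 5 4)) skip)))

/-- The price of one row of `part`; the row is cleared. -/
def priceRow : Prog := seq (cast (var 41) 4)
  (forLoop 2 8 (block
    [bin .mul (var 42) ⟨16, 8⟩ ⟨11, 9⟩, bin .add (var 41) (var 41) (var 42), cast ⟨11, 9⟩ 4,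
      natAdd 9 9 5]))

/-- Update the scores from the gradient in array `16` and clear `part` and `plays`. -/
def scoreRows : Prog := seq (const 9 0)
  (forLoop 1 7 (block
    [priceRow, bin .div (var 41) (var 41) (var 38), bin .add ⟨13, 7⟩ ⟨13, 7⟩ (var 41),
      cast ⟨12, 7⟩ 4]))

/-- The end of a batch of the exploration. -/
def closeProg : Prog := block
  [gradient 16 (var 33) 10, bin .add (var 38) (var 38) (var 39), scoreRows, clear 2 8 10]

/-- The beginning of a stage. -/
def startStage : Prog := block [clear 1 7 14, clear 2 8 10, value (var 40) (var 37) 10]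

/-- The update of the exploration, apart from the end of batches. -/
def recordProg : Prog := block [findRow, addRow, bin .add ⟨12, 10⟩ ⟨12, 10⟩ (var 39)]

/-- The update during the exploration. -/
def exploreUpdate : Prog := block
  [recordProg, scan, ifNat 11 5 (block
    [closeProg, scan, ifNat 11 5 (seq startStage (const 6 1)) skip]) skip]

/-- The update of the estimated losses. -/
def observeProg : Prog := block
  [value (var 47) (var 37) 10, bin .sub (var 41) (var 47) (var 40),
    bin .div (var 41) (var 41) (var 31), bin .div (var 42) ⟨15, 0⟩ (var 44),
    bin .add (var 42) (var 42) (var 28), bin .div (var 41) (var 41) (var 42),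
    bin .add ⟨14, 0⟩ ⟨14, 0⟩ (var 41), copy (var 40) (var 47)]

/-- The update after the exploration. -/
def stageUpdate : Prog := seq observeProg
  (ifReal (var 36) (var 40) (block
    [bin .add (var 36) (var 36) (var 36), bin .div (var 37) (var 37) (var 43), startStage]) skip)

/-- The algorithm: exploration, followed by exponential weights in stages. -/
def algorithm : BanditAlgorithm where
  init := block [initInput, initScale, initExplore, initStage]
  select := ifNat 6 5 (natAdd 0 10 4) (seq weigh sample)
  update := seq addLoad (ifNat 6 5 exploreUpdate stageUpdate)

theorem algorithm_loops :
    ((∀ r ∈ algorithm.init.loopR, r ∈ [1, 2, 3]) ∧ ∀ r ∈ [1, 2, 3], r ∉ algorithm.init.regW) ∧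
    ((∀ r ∈ algorithm.select.loopR, r ∈ [1, 2, 3]) ∧
      ∀ r ∈ [1, 2, 3], r ∉ algorithm.select.regW) ∧
    ((∀ r ∈ algorithm.update.loopR, r ∈ [1, 2, 3]) ∧
      ∀ r ∈ [1, 2, 3], r ∉ algorithm.update.regW) := by
  decide

/-! ### What the loops compute -/

section Loops

variable {d : ℕ} {Ψ : ℝ → (Fin d → ℝ) → ℝ}

theorem exec_clear {r i a m : ℕ} {s : Store} (hm : s.reg r = m) (h4 : s.reg 4 = 0)
    (h5 : s.reg 5 = 1) (hi : i ∉ [4, 5, r]) :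
    ∀ k < m, ((clear r i a).exec Ψ s).arr a k = 0 := by
  simp only [List.mem_cons, List.not_mem_nil, or_false, not_or] at hi
  refine exec_for (fun k t => ∀ l < k, t.arr a l = 0) m hm h5 (by simp [regW, hi]) (by simp [regW])
    (fun t _ _ l hl => absurd hl (Nat.not_lt_zero l)) ?_
  intro k t t' hk hti hreg harr ha hr hInv l hl
  have e4 : t.reg 4 = 0 := by rw [hreg 4 (by simp [regW, Ne.symm hi.1]), h4]
  rw [ha]
  by_cases hlk : l = k
  · simp [exec, hti, e4, hlk]
  · simp [exec, hti, hlk]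
    exact hInv l (by omega)

theorem exec_addLoad {s : Store} (h2 : s.reg 2 = d) (h5 : s.reg 5 = 1) :
    ∀ j < d, (addLoad.exec Ψ s).arr 10 j = s.arr 10 j + s.arr 2 j := by
  have key := exec_for (Ψ := Ψ) (r := 2) (i := 8) (P := bin .add ⟨10, 8⟩ ⟨10, 8⟩ ⟨2, 8⟩) (s := s)
    (fun k t => ∀ m, t.arr 10 m = if m < k then s.arr 10 m + s.arr 2 m else s.arr 10 m)
    d h2 h5 (by decide) (by decide) (fun t ha _ m => by simp [ha]) ?_
  · intro j hj
    rw [addLoad, key j, if_pos hj]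
  · intro k t t' hk hti hreg harr ha hr hInv m
    have e2 : t.arr 2 = s.arr 2 := harr 2 (by decide)
    rw [ha]
    by_cases hm : m = k
    · simp [exec, Store.get, hti, BinOp.eval, hm, hInv k, e2]
    · have : m < k + 1 ↔ m < k := by omega
      simp [exec, hti, hm, hInv m, this]

theorem exec_findRow {n a : ℕ} {s : Store} (h1 : s.reg 1 = n) (h2 : s.reg 2 = d)
    (h5 : s.reg 5 = 1) (h10 : s.reg 10 = a) (ha : a < n) :
    (findRow.exec Ψ s).reg 9 = a * d := by
  have key := exec_for (Ψ := Ψ) (r := 1) (i := 7) (P := ifNat 7 10 (natAdd 9 9 2) skip)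
    (s := (const 9 0).exec Ψ s)
    (fun k t => t.reg 9 = min k a * d) n (by simpa [exec] using h1) (by simpa [exec] using h5)
    (by decide) (by decide) (fun t _ hr => by simp [hr 9 (by decide), exec]) ?_
  · rw [findRow, exec_seq, key, min_eq_right ha.le]
  · intro k t t' hk hti hreg harr hta hr hInv
    have e2 : t.reg 2 = d := by rw [hreg 2 (by decide)]; simpa [exec] using h2
    have e10 : t.reg 10 = a := by rw [hreg 10 (by decide)]; simpa [exec] using h10
    rw [hr 9 (by decide)]
    simp only [exec, hti, e10]
    split_ifs with hka
    · simp only [Store.tick_reg, Store.setReg_reg, Function.update_self, hInv, e2]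
      rw [min_eq_left hka.le, min_eq_left (by omega), add_mul, one_mul]
    · simp only [Store.tick_reg, hInv]
      rw [min_eq_right (by omega), min_eq_right (by omega)]

theorem exec_addRow {s : Store} (h2 : s.reg 2 = d) (h5 : s.reg 5 = 1) (m : ℕ) :
    (addRow.exec Ψ s).arr 11 m = if s.reg 9 ≤ m ∧ m < s.reg 9 + d then
      s.arr 11 m + s.arr 2 (m - s.reg 9) else s.arr 11 m := by
  have key := exec_for (Ψ := Ψ) (r := 2) (i := 8)
    (P := seq (bin .add ⟨11, 9⟩ ⟨11, 9⟩ ⟨2, 8⟩) (natAdd 9 9 5)) (s := s)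
    (fun k t => t.reg 9 = s.reg 9 + k ∧ ∀ m, t.arr 11 m = if s.reg 9 ≤ m ∧ m < s.reg 9 + k then
      s.arr 11 m + s.arr 2 (m - s.reg 9) else s.arr 11 m)
    d h2 h5 (by decide) (by decide)
    (fun t ha hr => ⟨hr 9 (by decide), fun m => by
      rw [if_neg (by omega), ha]⟩) ?_
  · exact key.2 m
  · rintro k t t' hk hti hreg harr hta hr ⟨hI1, hI2⟩
    have e5 : t.reg 5 = 1 := by rw [hreg 5 (by decide), h5]
    have e2 : t.arr 2 = s.arr 2 := harr 2 (by decide)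
    refine ⟨?_, fun m => ?_⟩
    · rw [hr 9 (by decide)]
      simp [exec, hI1, e5, add_assoc]
    · rw [hta]
      by_cases hm : m = s.reg 9 + k
      · simp [exec, Store.get, hti, hI1, BinOp.eval, hm, hI2, e2]
      · have : (s.reg 9 ≤ m ∧ m < s.reg 9 + (k + 1)) ↔ (s.reg 9 ≤ m ∧ m < s.reg 9 + k) := by omega
        simp [exec, hI1, hm, hI2, this]

/-- The search ends with the last arm that satisfies the test, if there is one. -/
theorem exec_scan {n : ℕ} {s : Store} (h1 : s.reg 1 = n) (h4 : s.reg 4 = 0) (h5 : s.reg 5 = 1) :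
    ((scan.exec Ψ s).reg 11 = 0 ∧
      ∀ i < n, ¬(s.arr 13 i ≤ s.arr 32 0 ∧ s.arr 12 i < s.arr 29 0)) ∨
    ((scan.exec Ψ s).reg 11 = 1 ∧ (scan.exec Ψ s).reg 10 < n ∧
      (s.arr 13 ((scan.exec Ψ s).reg 10) ≤ s.arr 32 0 ∧
        s.arr 12 ((scan.exec Ψ s).reg 10) < s.arr 29 0) ∧
      ∀ i < n, (scan.exec Ψ s).reg 10 < i →
        ¬(s.arr 13 i ≤ s.arr 32 0 ∧ s.arr 12 i < s.arr 29 0)) := by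
  set Q : ℕ → Prop := fun i => s.arr 13 i ≤ s.arr 32 0 ∧ s.arr 12 i < s.arr 29 0 with hQ
  have key := exec_for (Ψ := Ψ) (r := 1) (i := 7)
    (P := ifReal (var 32) ⟨13, 7⟩ skip
      (ifReal ⟨12, 7⟩ (var 29) (seq (natAdd 10 7 4) (natAdd 11 5 4)) skip))
    (s := (const 11 0).exec Ψ s)
    (fun k t => (t.reg 11 = 0 ∧ ∀ i < k, ¬Q i) ∨
      (t.reg 11 = 1 ∧ t.reg 10 < k ∧ Q (t.reg 10) ∧ ∀ i < k, t.reg 10 < i → ¬Q i))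
    n (by simpa [exec] using h1) (by simpa [exec] using h5) (by decide) (by decide)
    (fun t _ hr => .inl ⟨by simp [hr 11 (by decide), exec], by simp⟩) ?_
  · exact key
  · intro k t t' hk hti hreg harr hta hr hInv
    have e4 : t.reg 4 = 0 := by rw [hreg 4 (by decide)]; simpa [exec] using h4
    have e5 : t.reg 5 = 1 := by rw [hreg 5 (by decide)]; simpa [exec] using h5
    have a12 : t.arr 12 = s.arr 12 := harr 12 (by decide)
    have a13 : t.arr 13 = s.arr 13 := harr 13 (by decide)
    have a29 : t.arr 29 = s.arr 29 := harr 29 (by decide)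
    have a32 : t.arr 32 = s.arr 32 := harr 32 (by decide)
    rw [hr 11 (by decide), hr 10 (by decide)]
    by_cases hq : Q k
    · right
      have c1 : ¬s.arr 32 0 < s.arr 13 k := not_lt.mpr hq.1
      have c2 : s.arr 12 k < s.arr 29 0 := hq.2
      simp only [exec, Store.get, var, hti, e4, a12, a13, a29, a32, c1, c2, if_false, if_true,
        Store.tick_reg, Store.tick_arr, Store.setReg_reg]
      refine ⟨by simp [e5, e4], by simp [e4], by simpa [hti, e4] using hq, ?_⟩
      intro i hi hlt
      simp [e4] at hlt
      omega
    · have c : (exec Ψ (ifReal (var 32) ⟨13, 7⟩ skip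
          (ifReal ⟨12, 7⟩ (var 29) (seq (natAdd 10 7 4) (natAdd 11 5 4)) skip)) t).reg = t.reg := by
        simp only [exec, Store.get, var, hti, e4, a12, a13, a29, a32, Store.tick_reg,
          Store.tick_arr]
        split_ifs with c1 c2
        · rfl
        · exact absurd ⟨not_lt.mp c1, c2⟩ hq
        · rfl
      rw [c]
      rcases hInv with ⟨i1, i2⟩ | ⟨i1, i2, i3, i4⟩
      · refine .inl ⟨i1, fun i hi => ?_⟩
        rcases Nat.lt_succ_iff_lt_or_eq.mp hi with h | rfl
        · exact i2 i h
        · exact hq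
      · refine .inr ⟨i1, by omega, i3, fun i hi hlt => ?_⟩
        rcases Nat.lt_succ_iff_lt_or_eq.mp hi with h | rfl
        · exact i4 i h hlt
        · exact hq

theorem exec_priceRow {s : Store} (h2 : s.reg 2 = d) (h4 : s.reg 4 = 0) (h5 : s.reg 5 = 1) :
    (priceRow.exec Ψ s).reg 9 = s.reg 9 + d ∧
    (priceRow.exec Ψ s).arr 41 0 = ∑ j ∈ Finset.range d, s.arr 16 j * s.arr 11 (s.reg 9 + j) ∧
    ∀ m, (priceRow.exec Ψ s).arr 11 m =
      if s.reg 9 ≤ m ∧ m < s.reg 9 + d then 0 else s.arr 11 m := by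
  set s' := (cast (var 41) 4).exec Ψ s with hs'
  have r' : s'.reg = s.reg := rfl
  have a16' : s'.arr 16 = s.arr 16 := exec_arr _ _ (by decide)
  have a11' : s'.arr 11 = s.arr 11 := exec_arr _ _ (by decide)
  have key := exec_for (Ψ := Ψ) (r := 2) (i := 8)
    (P := block [bin .mul (var 42) ⟨16, 8⟩ ⟨11, 9⟩, bin .add (var 41) (var 41) (var 42),
      cast ⟨11, 9⟩ 4, natAdd 9 9 5]) (s := s')
    (fun k t => t.reg 9 = s.reg 9 + k ∧
      t.arr 41 0 = ∑ j ∈ Finset.range k, s.arr 16 j * s.arr 11 (s.reg 9 + j) ∧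
      ∀ m, t.arr 11 m = if s.reg 9 ≤ m ∧ m < s.reg 9 + k then 0 else s.arr 11 m)
    d (by rw [r', h2]) (by rw [r', h5]) (by decide) (by decide)
    (fun t ha hr => ⟨by rw [hr 9 (by decide), r']; rfl, by simp [ha, hs', exec, var, h4],
      fun m => by rw [if_neg (by omega), ha, a11']⟩) ?_
  · exact key
  · rintro k t t' hk hti hreg harr hta hr ⟨i1, i2, i3⟩
    have e4 : t.reg 4 = 0 := by rw [hreg 4 (by decide), r', h4]
    have e5 : t.reg 5 = 1 := by rw [hreg 5 (by decide), r', h5]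
    have a16 : t.arr 16 = s.arr 16 := by rw [harr 16 (by decide), a16']
    refine ⟨?_, ?_, fun m => ?_⟩
    · rw [hr 9 (by decide)]
      simp [block, exec, i1, e5, add_assoc]
    · rw [hta, Finset.sum_range_succ, ← i2]
      simp [block, exec, Store.get, var, BinOp.eval, hti, e4, i1, a16, i3]
    · rw [hta]
      by_cases hm : m = s.reg 9 + k
      · simp [block, exec, var, i1, hm, e4]
      · have : (s.reg 9 ≤ m ∧ m < s.reg 9 + (k + 1)) ↔ (s.reg 9 ≤ m ∧ m < s.reg 9 + k) := by omega
        simp [block, exec, var, i1, hm, e4, i3, this]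

theorem exec_scoreRows {n : ℕ} {s : Store} (h1 : s.reg 1 = n) (h2 : s.reg 2 = d)
    (h4 : s.reg 4 = 0) (h5 : s.reg 5 = 1) :
    (∀ i < n, (scoreRows.exec Ψ s).arr 13 i = s.arr 13 i +
      (∑ j ∈ Finset.range d, s.arr 16 j * s.arr 11 (i * d + j)) / s.arr 38 0) ∧
    (∀ i < n, (scoreRows.exec Ψ s).arr 12 i = 0) ∧
    ∀ m < n * d, (scoreRows.exec Ψ s).arr 11 m = 0 := by
  set s' := (const 9 0).exec Ψ s with hs'
  have r' : ∀ r, r ≠ 9 → s'.reg r = s.reg r := fun r hr => exec_reg _ _ (by simpa [regW] using hr)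
  have a' : s'.arr = s.arr := rfl
  have key := exec_for (Ψ := Ψ) (r := 1) (i := 7)
    (P := block [priceRow, bin .div (var 41) (var 41) (var 38),
      bin .add ⟨13, 7⟩ ⟨13, 7⟩ (var 41), cast ⟨12, 7⟩ 4]) (s := s')
    (fun k t => t.reg 9 = k * d ∧
      (∀ i, t.arr 13 i = if i < k then s.arr 13 i +
        (∑ j ∈ Finset.range d, s.arr 16 j * s.arr 11 (i * d + j)) / s.arr 38 0 else s.arr 13 i) ∧
      (∀ i < k, t.arr 12 i = 0) ∧ ∀ m, t.arr 11 m = if m < k * d then 0 else s.arr 11 m)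
    n (by rw [r' 1 (by decide), h1]) (by rw [r' 5 (by decide), h5]) (by decide) (by decide)
    (fun t ha hr => ⟨by rw [hr 9 (by decide)]; simp [hs', exec], fun i => by simp [ha, a'],
      by simp, fun m => by simp [ha, a']⟩) ?_
  · obtain ⟨-, k1, k2, k3⟩ := key
    refine ⟨fun i hi => ?_, k2, fun m hm => ?_⟩
    · have := k1 i
      rwa [if_pos hi] at this
    · have := k3 m
      rwa [if_pos hm] at this
  · rintro k t t' hk hti hreg harr hta hr ⟨i1, i2, i3, i4⟩
    have e2 : t.reg 2 = d := by rw [hreg 2 (by decide), r' 2 (by decide), h2]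
    have e4 : t.reg 4 = 0 := by rw [hreg 4 (by decide), r' 4 (by decide), h4]
    have e5 : t.reg 5 = 1 := by rw [hreg 5 (by decide), r' 5 (by decide), h5]
    have a16 : t.arr 16 = s.arr 16 := by rw [harr 16 (by decide), a']
    have a38 : t.arr 38 = s.arr 38 := by rw [harr 38 (by decide), a']
    obtain ⟨p1, p2, p3⟩ := exec_priceRow (Ψ := Ψ) (s := t) e2 e4 e5
    set u := priceRow.exec Ψ t with hu
    have u4 : u.reg 4 = 0 := by rw [hu, exec_reg _ _ (by decide), e4]
    have u7 : u.reg 7 = k := by rw [hu, exec_reg _ _ (by decide), hti]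
    have u12 : u.arr 12 = t.arr 12 := by rw [hu, exec_arr _ _ (by decide)]
    have u13 : u.arr 13 = t.arr 13 := by rw [hu, exec_arr _ _ (by decide)]
    have u38 : u.arr 38 = s.arr 38 := by rw [hu, exec_arr _ _ (by decide), a38]
    have hsum : u.arr 41 0 = ∑ j ∈ Finset.range d, s.arr 16 j * s.arr 11 (k * d + j) := by
      rw [p2, i1, a16]
      refine Finset.sum_congr rfl fun j hj => ?_
      rw [i4, if_neg (by omega)]
    have hseq : exec Ψ (block [priceRow, bin .div (var 41) (var 41) (var 38),
        bin .add ⟨13, 7⟩ ⟨13, 7⟩ (var 41), cast ⟨12, 7⟩ 4]) t =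
        exec Ψ (block [bin .div (var 41) (var 41) (var 38),
        bin .add ⟨13, 7⟩ ⟨13, 7⟩ (var 41), cast ⟨12, 7⟩ 4]) u := rfl
    rw [hseq] at hta hr
    refine ⟨?_, fun i => ?_, fun i hi => ?_, fun m => ?_⟩
    · rw [hr 9 (by decide)]
      simp [block, exec, p1, i1, add_mul]
    · rw [hta]
      by_cases hi : i = k
      · simp [block, exec, Store.get, var, BinOp.eval, u4, u7, u13, u38, hsum, hi, i2 k]
      · have : i < k + 1 ↔ i < k := by omega
        simp [block, exec, var, u7, u13, hi, i2 i, this]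
    · rw [hta]
      by_cases hik : i = k
      · simp [block, exec, Store.get, var, u4, u7, hik]
      · simp [block, exec, var, u7, u12, hik]
        exact i3 i (by omega)
    · rw [hta]
      simp only [block, exec, var, Store.tick_arr, Store.set_arr, ne_eq,
        Nat.reduceEqDiff, not_false_eq_true, Function.update_of_ne]
      rw [p3, i4, i1, add_mul, one_mul]
      split_ifs <;> first | rfl | omega

theorem exec_weigh {n : ℕ} {s : Store} (h1 : s.reg 1 = n) (h4 : s.reg 4 = 0)
    (h5 : s.reg 5 = 1) :
    (∀ i < n, (weigh.exec Ψ s).arr 15 i = Real.exp (-(s.arr 27 0 * s.arr 14 i))) ∧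
    (weigh.exec Ψ s).arr 44 0 =
      ∑ i ∈ Finset.range n, Real.exp (-(s.arr 27 0 * s.arr 14 i)) := by
  set s' := (cast (var 44) 4).exec Ψ s with hs'
  have r' : s'.reg = s.reg := rfl
  have a27' : s'.arr 27 = s.arr 27 := exec_arr _ _ (by decide)
  have a14' : s'.arr 14 = s.arr 14 := exec_arr _ _ (by decide)
  have key := exec_for (Ψ := Ψ) (r := 1) (i := 7)
    (P := block [bin .mul (var 42) (var 27) ⟨14, 7⟩, cast (var 41) 4,
      bin .sub (var 42) (var 41) (var 42), un .exp ⟨15, 7⟩ (var 42),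
      bin .add (var 44) (var 44) ⟨15, 7⟩]) (s := s')
    (fun k t => (∀ i < k, t.arr 15 i = Real.exp (-(s.arr 27 0 * s.arr 14 i))) ∧
      t.arr 44 0 = ∑ i ∈ Finset.range k, Real.exp (-(s.arr 27 0 * s.arr 14 i)))
    n (by rw [r', h1]) (by rw [r', h5]) (by decide) (by decide)
    (fun t ha hr => ⟨by simp, by simp [ha, hs', exec, var, h4]⟩) ?_
  · exact key
  · rintro k t t' hk hti hreg harr hta hr ⟨i1, i2⟩
    have e4 : t.reg 4 = 0 := by rw [hreg 4 (by decide), r', h4]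
    have a27 : t.arr 27 = s.arr 27 := by rw [harr 27 (by decide), a27']
    have a14 : t.arr 14 = s.arr 14 := by rw [harr 14 (by decide), a14']
    refine ⟨fun i hi => ?_, ?_⟩
    · rw [hta]
      by_cases hik : i = k
      · simp [block, exec, Store.get, var, BinOp.eval, UnOp.eval, hti, e4, a27, a14, hik]
      · simp [block, exec, var, hti, hik]
        exact i1 i (by omega)
    · rw [hta, Finset.sum_range_succ, ← i2]
      simp [block, exec, Store.get, var, BinOp.eval, UnOp.eval, hti, e4, a27, a14]

/-- Inversion sampling: the chosen arm is the one in whose interval the random number falls. -/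
theorem exec_sample {n : ℕ} (hn : 0 < n) {s : Store} (h1 : s.reg 1 = n) (h4 : s.reg 4 = 0)
    (h5 : s.reg 5 = 1) (hu : 0 ≤ s.arr 1 0 * s.arr 44 0) :
    (sample.exec Ψ s).reg 0 < n ∧
    ∑ i ∈ Finset.range ((sample.exec Ψ s).reg 0), s.arr 15 i ≤ s.arr 1 0 * s.arr 44 0 ∧
    ((sample.exec Ψ s).reg 0 + 1 < n → s.arr 1 0 * s.arr 44 0 ≤
      ∑ i ∈ Finset.range ((sample.exec Ψ s).reg 0 + 1), s.arr 15 i) := by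
  set x := s.arr 1 0 * s.arr 44 0 with hx
  set s' := (seq (bin .mul (var 45) (var 1) (var 44)) (cast (var 46) 4)).exec Ψ s with hs'
  have r' : s'.reg = s.reg := rfl
  have a15' : s'.arr 15 = s.arr 15 := exec_arr _ _ (by decide)
  have a45' : s'.arr 45 0 = x := by
    simp [hs', exec, Store.get, var, BinOp.eval, h4, hx]
  have a46' : s'.arr 46 0 = 0 := by
    simp [hs', exec, var, h4]
  have key := exec_for (Ψ := Ψ) (r := 1) (i := 7)
    (P := seq (ifReal (var 45) (var 46) skip (natAdd 0 7 4))
      (bin .add (var 46) (var 46) ⟨15, 7⟩)) (s := s')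
    (fun k t => t.arr 46 0 = ∑ i ∈ Finset.range k, s.arr 15 i ∧
      (0 < k → t.reg 0 < k ∧ ∑ i ∈ Finset.range (t.reg 0), s.arr 15 i ≤ x ∧
        (t.reg 0 + 1 < k → x ≤ ∑ i ∈ Finset.range (t.reg 0 + 1), s.arr 15 i)))
    n (by rw [r', h1]) (by rw [r', h5]) (by decide) (by decide)
    (fun t ha hr => ⟨by simp [ha, a46'], by simp⟩) ?_
  · exact key.2 hn
  · rintro k t t' hk hti hreg harr hta hr ⟨i1, i2⟩
    have e4 : t.reg 4 = 0 := by rw [hreg 4 (by decide), r', h4]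
    have a15 : t.arr 15 = s.arr 15 := by rw [harr 15 (by decide), a15']
    have a45 : t.arr 45 0 = x := by rw [harr 45 (by decide), a45']
    rw [hta, hr 0 (by decide)]
    by_cases hlt : x < ∑ i ∈ Finset.range k, s.arr 15 i
    · have e : exec Ψ (seq (ifReal (var 45) (var 46) skip (natAdd 0 7 4))
          (bin .add (var 46) (var 46) ⟨15, 7⟩)) t =
          exec Ψ (bin .add (var 46) (var 46) ⟨15, 7⟩) ((t.tick 1).tick 1) := by
        simp [exec, Store.get, var, e4, a45, i1, hlt]
      rw [e]
      have hk0 : 0 < k := by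
        rcases Nat.eq_zero_or_pos k with rfl | h
        · simp only [Finset.range_zero, Finset.sum_empty] at hlt
          linarith
        · exact h
      obtain ⟨j1, j2, j3⟩ := i2 hk0
      refine ⟨?_, fun _ => ?_⟩
      · rw [Finset.sum_range_succ, ← i1]
        simp [exec, Store.get, var, BinOp.eval, hti, e4, a15]
      · have er : (exec Ψ (bin .add (var 46) (var 46) ⟨15, 7⟩) ((t.tick 1).tick 1)).reg 0 =
          t.reg 0 := rfl
        rw [er]
        refine ⟨by omega, j2, fun _ => ?_⟩
        by_cases hlast : t.reg 0 + 1 < k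
        · exact j3 hlast
        · have : t.reg 0 + 1 = k := by omega
          rw [this]
          exact hlt.le
    · have e : exec Ψ (seq (ifReal (var 45) (var 46) skip (natAdd 0 7 4))
          (bin .add (var 46) (var 46) ⟨15, 7⟩)) t =
          exec Ψ (bin .add (var 46) (var 46) ⟨15, 7⟩) ((natAdd 0 7 4).exec Ψ (t.tick 1)) := by
        simp only [exec, Store.get, var, e4, a45, i1, hlt, if_false]
      rw [e]
      have er : (exec Ψ (bin .add (var 46) (var 46) ⟨15, 7⟩)
          ((natAdd 0 7 4).exec Ψ (t.tick 1))).reg 0 = k := by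
        simp [exec, hti, e4]
      rw [er]
      refine ⟨?_, fun _ => ⟨by omega, not_lt.mp hlt, fun h => absurd h (lt_irrefl _)⟩⟩
      rw [Finset.sum_range_succ, ← i1]
      simp [exec, Store.get, var, BinOp.eval, hti, e4, a15]

end Loops

end VectorBandits

/-! ### The program implements the learner -/

namespace VectorBandits

open Prog

variable {n d : ℕ} {Ψ : ℝ → (Fin d → ℝ) → ℝ} {q : Params}

/-- The part of the memory that is used both during the exploration and after it. -/
structure Store.Common (q : Params) (n : ℕ) (s : Store) (load : Fin d → ℝ) (k : ℕ) : Prop where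
  r1 : s.reg 1 = n
  r2 : s.reg 2 = d
  r4 : s.reg 4 = 0
  r5 : s.reg 5 = 1
  rate : s.arr 27 0 = q.rate
  halfRate : s.arr 28 0 = q.rate / 2
  quota : s.arr 29 0 = q.quota
  unit : s.arr 31 0 = q.unit
  cutoff : s.arr 32 0 = q.cutoff
  exploreEps : s.arr 33 0 = q.exploreEps
  one : s.arr 39 0 = 1
  two : s.arr 43 0 = 2
  bound : s.arr 36 0 = q.bound k
  eps : s.arr 37 0 = q.eps k
  load : ∀ j : Fin d, s.arr 10 j = load j

/-- The part of the memory that is used during the exploration, except for the next arm. -/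
structure Store.Explore (q : Params) (s : Store) (part : Fin n → Fin d → ℝ)
    (plays score : Fin n → ℝ) (batches : ℕ) : Prop where
  part : ∀ (i : Fin n) (j : Fin d), s.arr 11 (i * d + j) = part i j
  plays : ∀ i : Fin n, s.arr 12 i = plays i
  score : ∀ i : Fin n, s.arr 13 i = score i
  discount : s.arr 38 0 = batches + q.offset

/-- The part of the memory that is used after the exploration. -/
structure Store.Stage (Ψ : ℝ → (Fin d → ℝ) → ℝ) (q : Params) (s : Store) (est : Fin n → ℝ)
    (load : Fin d → ℝ) (k : ℕ) : Prop where
  est : ∀ i : Fin n, s.arr 14 i = est i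
  potential : s.arr 40 0 = Ψ (q.eps k) load

/-- The memory represents the state of the learner. -/
structure Store.Represents (Ψ : ℝ → (Fin d → ℝ) → ℝ) (q : Params) (s : Store)
    (σ : Learner n d) : Prop where
  common : s.Common q n σ.load σ.stage
  mode : s.reg 6 = if σ.exploring then 0 else 1
  explore : σ.exploring = true → s.Explore q σ.part σ.plays σ.score σ.batches ∧ s.reg 10 = σ.arm
  stage : σ.exploring = false → s.Stage Ψ q σ.est σ.load σ.stage

theorem Prog.exec_regs (P : Prog) (s : Store) {L : List ℕ} (h : ∀ r ∈ L, r ∉ P.regW) :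
    ∀ r ∈ L, (P.exec Ψ s).reg r = s.reg r := fun r m => exec_reg P s (h r m)

theorem Prog.exec_arrs (P : Prog) (s : Store) {L : List ℕ} (h : ∀ a ∈ L, a ∉ P.arrW) :
    ∀ a ∈ L, (P.exec Ψ s).arr a = s.arr a := fun a m => exec_arr P s (h a m)

namespace Store

theorem Common.of_frame {s s' : Store} {load load' : Fin d → ℝ} {k k' : ℕ}
    (h : s.Common q n load k) (hr : ∀ r ∈ [1, 2, 4, 5], s'.reg r = s.reg r)
    (ha : ∀ a ∈ [27, 28, 29, 31, 32, 33, 39, 43], s'.arr a = s.arr a)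
    (hb : s'.arr 36 0 = q.bound k') (he : s'.arr 37 0 = q.eps k')
    (hl : ∀ j : Fin d, s'.arr 10 j = load' j) : s'.Common q n load' k' := by
  simp only [List.forall_mem_cons, List.not_mem_nil, false_imp_iff, implies_true, and_true]
    at hr ha
  obtain ⟨r1, r2, r4, r5⟩ := hr
  obtain ⟨a1, a2, a3, a4, a5, a6, a7, a8⟩ := ha
  cases h
  constructor <;> first
    | assumption
    | (simp only [r1, r2, r4, r5, a1, a2, a3, a4, a5, a6, a7, a8]; assumption)

theorem Common.congr {s s' : Store} {load : Fin d → ℝ} {k : ℕ} (h : s.Common q n load k)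
    (hr : ∀ r ∈ [1, 2, 4, 5], s'.reg r = s.reg r)
    (ha : ∀ a ∈ [27, 28, 29, 31, 32, 33, 39, 43, 36, 37, 10], s'.arr a = s.arr a) :
    s'.Common q n load k :=
  h.of_frame hr (fun a m => ha a (List.mem_append_left (bs := [36, 37, 10]) m))
    (by rw [ha 36 (by decide)]; exact h.bound) (by rw [ha 37 (by decide)]; exact h.eps)
    fun j => by rw [ha 10 (by decide)]; exact h.load j

theorem Explore.congr {s s' : Store} {part : Fin n → Fin d → ℝ} {plays score : Fin n → ℝ}
    {b : ℕ} (h : s.Explore q part plays score b)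
    (ha : ∀ a ∈ [11, 12, 13, 38], s'.arr a = s.arr a) : s'.Explore q part plays score b := by
  simp only [List.forall_mem_cons, List.not_mem_nil, false_imp_iff, implies_true, and_true] at ha
  obtain ⟨a1, a2, a3, a4⟩ := ha
  cases h
  constructor <;> simp only [a1, a2, a3, a4] <;> assumption

theorem Stage.congr {s s' : Store} {est : Fin n → ℝ} {load : Fin d → ℝ} {k : ℕ}
    (h : s.Stage Ψ q est load k) (ha : ∀ a ∈ [14, 40], s'.arr a = s.arr a) :
    s'.Stage Ψ q est load k := by
  simp only [List.forall_mem_cons, List.not_mem_nil, false_imp_iff, implies_true, and_true] at ha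
  obtain ⟨a1, a2⟩ := ha
  cases h
  constructor <;> simp only [a1, a2] <;> assumption

theorem Represents.congr {s s' : Store} {σ : Learner n d} (h : s.Represents Ψ q σ)
    (hr : ∀ r ∈ [1, 2, 4, 5, 6, 10], s'.reg r = s.reg r)
    (ha : ∀ a ∈ [27, 28, 29, 31, 32, 33, 39, 43, 36, 37, 10, 11, 12, 13, 38, 14, 40],
      s'.arr a = s.arr a) : s'.Represents Ψ q σ where
  common := h.common.congr
    (fun r m => hr r (List.mem_append_left (bs := [6, 10]) m))
    (fun a m => ha a (List.mem_append_left (bs := [11, 12, 13, 38, 14, 40]) m))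
  mode := by rw [hr 6 (by decide)]; exact h.mode
  explore := fun he => ⟨(h.explore he).1.congr fun a m => ha a (by
      simp only [List.mem_cons, List.not_mem_nil, or_false] at m ⊢; omega),
    by rw [hr 10 (by decide)]; exact (h.explore he).2⟩
  stage := fun he => (h.stage he).congr fun a m => ha a (by
      simp only [List.mem_cons, List.not_mem_nil, or_false] at m ⊢; omega)

theorem Common.tick {s : Store} {load : Fin d → ℝ} {k : ℕ} (h : s.Common q n load k) (m : ℕ) :
    (s.tick m).Common q n load k := h.congr (fun _ _ => rfl) fun _ _ => rfl

theorem Explore.tick {s : Store} {part : Fin n → Fin d → ℝ} {plays score : Fin n → ℝ}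
    {b : ℕ} (h : s.Explore q part plays score b) (m : ℕ) :
    (s.tick m).Explore q part plays score b := h.congr fun _ _ => rfl

theorem Stage.tick {s : Store} {est : Fin n → ℝ} {load : Fin d → ℝ} {k : ℕ}
    (h : s.Stage Ψ q est load k) (m : ℕ) : (s.tick m).Stage Ψ q est load k :=
  h.congr fun _ _ => rfl

theorem Common.vec_eq {s : Store} {load : Fin d → ℝ} {k : ℕ} (h : s.Common q n load k) :
    s.vec d 10 = load := funext h.load

theorem Common.exec_addLoad {s : Store} {load c : Fin d → ℝ} {k : ℕ} (h : s.Common q n load k)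
    (hc : ∀ j : Fin d, s.arr 2 j = c j) : (addLoad.exec Ψ s).Common q n (load + c) k := by
  refine h.of_frame (exec_regs _ _ (by decide)) (exec_arrs _ _ (by decide))
    (by rw [exec_arr _ _ (by decide)]; exact h.bound)
    (by rw [exec_arr _ _ (by decide)]; exact h.eps) fun j => ?_
  rw [VectorBandits.exec_addLoad h.r2 h.r5 j j.2, h.load, hc]
  rfl

theorem Explore.exec_record {s : Store} {load c : Fin d → ℝ} {k b : ℕ}
    {part : Fin n → Fin d → ℝ} {plays score : Fin n → ℝ} {a : Fin n}
    (h : s.Common q n load k) (he : s.Explore q part plays score b)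
    (hc : ∀ j : Fin d, s.arr 2 j = c j) (ha : s.reg 10 = a) :
    (recordProg.exec Ψ s).Explore q (Function.update part a (part a + c))
      (Function.update plays a (plays a + 1)) score b := by
  set u := findRow.exec Ψ s with hu
  set v := addRow.exec Ψ u with hv
  have e : recordProg.exec Ψ s = (bin .add ⟨12, 10⟩ ⟨12, 10⟩ (var 39)).exec Ψ v := rfl
  have ur9 : u.reg 9 = a * d := exec_findRow h.r1 h.r2 h.r5 ha a.2
  have ua : ∀ b ∈ [2, 11, 12, 13, 38, 39], u.arr b = s.arr b := exec_arrs _ _ (by decide)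
  have ur : ∀ r ∈ [2, 4, 5, 10], u.reg r = s.reg r := exec_regs _ _ (by decide)
  have va : ∀ b ∈ [2, 12, 13, 38, 39], v.arr b = u.arr b := exec_arrs _ _ (by decide)
  have vr : ∀ r ∈ [2, 4, 5, 10], v.reg r = u.reg r := exec_regs _ _ (by decide)
  have v10 : v.reg 10 = a := by rw [vr 10 (by decide), ur 10 (by decide), ha]
  have v4 : v.reg 4 = 0 := by rw [vr 4 (by decide), ur 4 (by decide), h.r4]
  have v12 : v.arr 12 = s.arr 12 := by rw [va 12 (by decide), ua 12 (by decide)]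
  have v39 : v.arr 39 0 = 1 := by rw [va 39 (by decide), ua 39 (by decide), h.one]
  have v11 := exec_addRow (Ψ := Ψ) (s := u) (by rw [ur 2 (by decide), h.r2])
    (by rw [ur 5 (by decide), h.r5])
  rw [e]
  constructor
  · intro i j
    rw [exec_arr _ _ (by decide), v11, ur9, ua 11 (by decide), ua 2 (by decide)]
    by_cases hi : i = a
    · subst hi
      rw [if_pos ⟨by omega, by have := j.2; omega⟩, Nat.add_sub_cancel_left, he.part, hc]
      simp
    · rw [if_neg, he.part, Function.update_of_ne hi]
      rintro ⟨h1, h2⟩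
      have hj := j.2
      rcases lt_or_gt_of_ne (fun h => hi (Fin.ext h) : (i : ℕ) ≠ a) with hlt | hlt
      · have := Nat.mul_le_mul_right d (Nat.succ_le_of_lt hlt)
        rw [Nat.succ_eq_add_one, add_mul, one_mul] at this
        omega
      · have := Nat.mul_le_mul_right d (Nat.succ_le_of_lt hlt)
        rw [Nat.succ_eq_add_one, add_mul, one_mul] at this
        omega
  · intro i
    by_cases hi : i = a
    · simp [exec, Store.get, BinOp.eval, var, v4, v10, v12, v39, hi, he.plays]
    · have : (i : ℕ) ≠ a := fun h => hi (Fin.ext h)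
      simp [exec, var, v10, v12, hi, this, he.plays]
  · intro i
    rw [exec_arr _ _ (by decide), va 13 (by decide), ua 13 (by decide), he.score]
  · rw [exec_arr _ _ (by decide), va 38 (by decide), ua 38 (by decide), he.discount]

theorem Explore.exec_scan [NeZero n] {s : Store} {load : Fin d → ℝ} {k : ℕ} {σ : Learner n d}
    (h : s.Common q n load k) (he : s.Explore q σ.part σ.plays σ.score σ.batches) :
    ((scan.exec Ψ s).reg 11 = 0 ∧ ¬∃ i, σ.Playable q i) ∨
    ((scan.exec Ψ s).reg 11 = 1 ∧ (∃ i, σ.Playable q i) ∧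
      (scan.exec Ψ s).reg 10 = lastArm (σ.Playable q)) := by
  have iff : ∀ i : Fin n, (s.arr 13 i ≤ s.arr 32 0 ∧ s.arr 12 i < s.arr 29 0) ↔
      σ.Playable q i := fun i => by
    rw [he.score, he.plays, h.cutoff, h.quota, Learner.Playable]
  rcases VectorBandits.exec_scan (Ψ := Ψ) h.r1 h.r4 h.r5 with ⟨h1, h2⟩ | ⟨h1, h2, h3, h4⟩
  · exact .inl ⟨h1, fun ⟨i, hi⟩ => h2 i i.2 ((iff i).mpr hi)⟩
  · have hP : σ.Playable q ⟨_, h2⟩ := (iff ⟨_, h2⟩).mp h3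
    refine .inr ⟨h1, ⟨_, hP⟩, ?_⟩
    rw [lastArm_eq hP fun j hj hPj => h4 j j.2 hj ((iff j).mpr hPj)]

theorem Explore.exec_close {s : Store} {load : Fin d → ℝ} {k b : ℕ}
    {part : Fin n → Fin d → ℝ} {plays score : Fin n → ℝ}
    (h : s.Common q n load k) (he : s.Explore q part plays score b) :
    (closeProg.exec Ψ s).Common q n (0 : Fin d → ℝ) k ∧
    (closeProg.exec Ψ s).Explore q (0 : Fin n → Fin d → ℝ) 0 (fun i => score i +
      dirDeriv (Ψ q.exploreEps) load (part i) / (((b + 1 : ℕ) : ℝ) + q.offset)) (b + 1) := by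
  set u := (gradient 16 (var 33) 10).exec Ψ s with hu
  set v := (bin .add (var 38) (var 38) (var 39)).exec Ψ u with hv
  set w := scoreRows.exec Ψ v with hw
  have e : closeProg.exec Ψ s = (clear 2 8 10).exec Ψ w := rfl
  have u16 : ∀ j : Fin d, u.arr 16 j = grad (Ψ q.exploreEps) load j := fun j => by
    simp only [hu, exec, Store.tick_arr, Store.setVec_arr_self, h.vec_eq, Store.get, var, h.r4,
      h.exploreEps]
  have ua : ∀ a ∈ [11, 12, 13, 38, 39], u.arr a = s.arr a := exec_arrs _ _ (by decide)
  have ur : u.reg = s.reg := rfl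
  have va : ∀ a ∈ [11, 12, 13, 16, 39], v.arr a = u.arr a := exec_arrs _ _ (by decide)
  have vr : v.reg = u.reg := rfl
  have v38 : v.arr 38 0 = ((b + 1 : ℕ) : ℝ) + q.offset := by
    have : v.arr 38 0 = s.arr 38 0 + s.arr 39 0 := by
      simp [hv, exec, Store.get, BinOp.eval, var, ur, h.r4, ua]
    rw [this, he.discount, h.one]
    push_cast
    ring
  have v16 : ∀ j : Fin d, v.arr 16 j = grad (Ψ q.exploreEps) load j := fun j => by
    rw [va 16 (by decide), u16]
  have v11 : ∀ (i : Fin n) (j : Fin d), v.arr 11 (i * d + j) = part i j := fun i j => by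
    rw [va 11 (by decide), ua 11 (by decide), he.part]
  obtain ⟨w1, w2, w3⟩ := exec_scoreRows (d := d) (Ψ := Ψ) (n := n) (s := v) (by rw [vr, ur, h.r1])
    (by rw [vr, ur, h.r2]) (by rw [vr, ur, h.r4]) (by rw [vr, ur, h.r5])
  have wr : ∀ r ∈ [1, 2, 4, 5], w.reg r = s.reg r := exec_regs _ _ (by decide)
  rw [e]
  constructor
  · refine h.of_frame (s' := (clear 2 8 10).exec Ψ w) (k' := k) (load' := (0 : Fin d → ℝ))
      (fun r m => ?_) (fun a m => ?_) ?_ ?_ fun j => ?_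
    · rw [← wr r m]; exact exec_regs _ _ (by decide) r m
    · exact exec_arrs closeProg s (by decide) a m
    · rw [← e, exec_arr _ _ (by decide), h.bound]
    · rw [← e, exec_arr _ _ (by decide), h.eps]
    · exact exec_clear (by rw [wr 2 (by decide), h.r2]) (by rw [wr 4 (by decide), h.r4])
        (by rw [wr 5 (by decide), h.r5]) (by decide) j j.2
  · constructor
    · intro i j
      rw [exec_arr _ _ (by decide)]
      refine w3 _ ?_
      have := Nat.mul_le_mul_right d (Nat.succ_le_of_lt i.2)
      rw [Nat.succ_eq_add_one, add_mul, one_mul] at this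
      have := j.2
      omega
    · intro i
      rw [exec_arr _ _ (by decide)]
      exact w2 i i.2
    · intro i
      rw [exec_arr _ _ (by decide), w1 i i.2, v38, va 13 (by decide), ua 13 (by decide),
        he.score, Finset.sum_range, dirDeriv]
      simp only [v16, v11]
    · rw [exec_arr _ _ (by decide), exec_arr _ _ (by decide), v38]

theorem Stage.exec_start {s : Store} {load : Fin d → ℝ} {k : ℕ} (h : s.Common q n load k) :
    (startStage.exec Ψ s).Common q n (0 : Fin d → ℝ) k ∧
    (startStage.exec Ψ s).Stage Ψ q (0 : Fin n → ℝ) (0 : Fin d → ℝ) k := by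
  set u := (clear 1 7 14).exec Ψ s with hu
  set v := (clear 2 8 10).exec Ψ u with hv
  have e : startStage.exec Ψ s = (value (var 40) (var 37) 10).exec Ψ v := rfl
  have ur : ∀ r ∈ [1, 2, 4, 5], u.reg r = s.reg r := exec_regs _ _ (by decide)
  have hv0 : v.Common q n (0 : Fin d → ℝ) k := by
    refine h.of_frame (fun r m => ?_) (fun a m => ?_) ?_ ?_ fun j => ?_
    · rw [← ur r m]; exact exec_regs _ _ (by decide) r m
    · exact exec_arrs (seq (clear 1 7 14) (clear 2 8 10)) s (by decide) a m
    · rw [hv, exec_arr _ _ (by decide), hu, exec_arr _ _ (by decide), h.bound]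
    · rw [hv, exec_arr _ _ (by decide), hu, exec_arr _ _ (by decide), h.eps]
    · exact exec_clear (by rw [ur 2 (by decide), h.r2]) (by rw [ur 4 (by decide), h.r4])
        (by rw [ur 5 (by decide), h.r5]) (by decide) j j.2
  rw [e]
  refine ⟨hv0.congr (exec_regs _ _ (by decide)) (exec_arrs _ _ (by decide)), ?_, ?_⟩
  · intro i
    rw [exec_arr _ _ (by decide), exec_arr _ _ (by decide)]
    exact exec_clear h.r1 h.r4 h.r5 (by decide) i i.2
  · simp [exec, Store.get, var, hv0.r4, hv0.eps, hv0.vec_eq]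

theorem Stage.exec_observe {s : Store} {load load' : Fin d → ℝ} {k : ℕ} {est : Fin n → ℝ}
    {a : Fin n} {w W : ℝ} (h : s.Common q n load' k) (hs : s.Stage Ψ q est load k)
    (ha : s.reg 0 = a) (hw : s.arr 15 a = w) (hW : s.arr 44 0 = W) :
    (observeProg.exec Ψ s).Stage Ψ q (Function.update est a (est a +
      (Ψ (q.eps k) load' - Ψ (q.eps k) load) / q.unit / (w / W + q.rate / 2))) load' k := by
  have e1 := h.r4
  have e2 := h.eps
  have e3 := h.unit
  have e4 := h.halfRate
  have e5 := h.vec_eq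
  have e6 := hs.potential
  constructor
  · intro i
    by_cases hi : i = a
    · subst hi
      simp [observeProg, block, exec, Store.get, BinOp.eval, var, e1, e2, e3, e4, e5, e6,
        ha, hw, hW, hs.est]
    · have : (i : ℕ) ≠ a := fun h => hi (Fin.ext h)
      simp [observeProg, block, exec, var, ha, hi, this, hs.est]
  · simp [observeProg, block, exec, Store.get, var, e1, e2, e5]

theorem Represents.update_explore [NeZero n] {s : Store} {σ : Learner n d}
    (h : s.Represents Ψ q σ) {c : Fin d → ℝ} (hc : ∀ j : Fin d, s.arr 2 j = c j)
    (hmode : σ.exploring = true) :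
    (algorithm.update.exec Ψ s).Represents Ψ q (σ.step Ψ q c σ.arm) := by
  set u := (addLoad.exec Ψ s).tick 1 with hu
  have hu0 : u.Common q n (σ.load + c) σ.stage := (h.common.exec_addLoad hc).tick 1
  have ur : ∀ r ∈ [0, 5, 6, 10], u.reg r = s.reg r := exec_regs addLoad s (by decide)
  have ua : ∀ a ∈ [2, 11, 12, 13, 14, 15, 38, 40, 44], u.arr a = s.arr a :=
    exec_arrs addLoad s (by decide)
  have u6 : u.reg 6 = if σ.exploring then 0 else 1 := by rw [ur 6 (by decide), h.mode]
  have u5 : u.reg 5 = 1 := hu0.r5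
  have e : algorithm.update.exec Ψ s =
      if u.reg 6 < u.reg 5 then exploreUpdate.exec Ψ u else stageUpdate.exec Ψ u := rfl
  rw [e]
  obtain ⟨he, h10⟩ := h.explore hmode
  rw [if_pos (by rw [u6, u5, hmode]; decide)]
  set v := recordProg.exec Ψ u with hv
  have hve : v.Explore q (σ.record c σ.arm).part (σ.record c σ.arm).plays
      (σ.record c σ.arm).score (σ.record c σ.arm).batches :=
    Explore.exec_record hu0 (he.congr fun a m => ua a (by
      simp only [List.mem_cons, List.not_mem_nil, or_false] at m ⊢; omega))
      (fun j => by rw [ua 2 (by decide), hc]) (by rw [ur 10 (by decide), h10])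
  have hvc : v.Common q n (σ.record c σ.arm).load σ.stage :=
    hu0.congr (exec_regs _ _ (by decide)) (exec_arrs _ _ (by decide))
  have v6 : v.reg 6 = 0 := by
    rw [hv, exec_reg _ _ (by decide), u6, hmode]; rfl
  set w := scan.exec Ψ v with hw
  have hwc : w.Common q n (σ.record c σ.arm).load σ.stage :=
    hvc.congr (exec_regs _ _ (by decide)) (exec_arrs _ _ (by decide))
  have hwe := hve.congr (s' := w) (exec_arrs _ _ (by decide))
  have w6 : w.reg 6 = 0 := by rw [hw, exec_reg _ _ (by decide), v6]
  have e' : exploreUpdate.exec Ψ u = if w.reg 11 < w.reg 5 then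
      (ifNat 11 5 (seq startStage (const 6 1)) skip).exec Ψ
        (scan.exec Ψ (closeProg.exec Ψ (w.tick 1))) else (w.tick 1).tick 1 := rfl
  clear_value w
  rw [e', hwc.r5]
  rcases Explore.exec_scan (Ψ := Ψ) hvc hve with ⟨h11, hno⟩ | ⟨h11, hyes, harm⟩
  · have estep : σ.step Ψ q c σ.arm = ((σ.record c σ.arm).closeBatch Ψ q).choose q := by
      simp only [Learner.step, hmode, if_true, hno, if_false]
    rw [← hw] at h11
    rw [h11, if_pos one_pos, estep]
    obtain ⟨hxc, hxe⟩ := Explore.exec_close (Ψ := Ψ) (hwc.tick 1) (hwe.tick 1)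
    set σ' := (σ.record c σ.arm).closeBatch Ψ q with hσ'
    set x := closeProg.exec Ψ (w.tick 1) with hx
    have hxe' : x.Explore q σ'.part σ'.plays σ'.score σ'.batches := hxe
    have x6 : x.reg 6 = 0 := by rw [hx, exec_reg _ _ (by decide)]; exact w6
    set y := scan.exec Ψ x with hy
    have hyc : y.Common q n (0 : Fin d → ℝ) σ.stage :=
      hxc.congr (exec_regs _ _ (by decide)) (exec_arrs _ _ (by decide))
    have hye := hxe'.congr (s' := y) (exec_arrs _ _ (by decide))
    have y6 : y.reg 6 = 0 := by rw [hy, exec_reg _ _ (by decide), x6]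
    have e'' : (ifNat 11 5 (seq startStage (const 6 1)) skip).exec Ψ y =
        if y.reg 11 < y.reg 5 then (const 6 1).exec Ψ (startStage.exec Ψ (y.tick 1))
        else (y.tick 1).tick 1 := rfl
    clear_value y
    rw [e'', hyc.r5]
    rcases Explore.exec_scan (Ψ := Ψ) hxc hxe' with ⟨h11', hno'⟩ | ⟨h11', hyes', harm'⟩
    · rw [← hy] at h11'
      rw [h11', if_pos one_pos]
      have hmode' : (σ'.choose q).exploring = false := by
        simp [Learner.choose, hno']
      obtain ⟨hzc, hze⟩ := Stage.exec_start (n := n) (Ψ := Ψ) (hyc.tick 1)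
      generalize startStage.exec Ψ (y.tick 1) = z at hzc hze ⊢
      refine ⟨hzc.congr (exec_regs _ _ (by decide)) (exec_arrs _ _ (by decide)), ?_,
        fun ht => ?_, fun _ => hze.congr (exec_arrs _ _ (by decide))⟩
      · rw [hmode']; rfl
      · rw [hmode'] at ht; exact absurd ht (by decide)
    · rw [← hy] at h11' harm'
      rw [h11', if_neg (lt_irrefl _)]
      have hmode' : (σ'.choose q).exploring = true := by
        simp only [Learner.choose, hyes', decide_true]
      refine ⟨(hyc.tick 1).tick 1, ?_, fun _ => ⟨(hye.tick 1).tick 1, harm'⟩, fun hf => ?_⟩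
      · rw [hmode']; exact y6
      · rw [hmode'] at hf; exact absurd hf (by decide)
  · have estep : σ.step Ψ q c σ.arm =
        { σ.record c σ.arm with arm := lastArm ((σ.record c σ.arm).Playable q) } := by
      simp only [Learner.step, hmode, if_true, hyes]
    rw [← hw] at h11 harm
    rw [h11, if_neg (lt_irrefl _), estep]
    refine ⟨(hwc.tick 1).tick 1, ?_, fun _ => ⟨(hwe.tick 1).tick 1, harm⟩, fun hf => ?_⟩
    · have : (σ.record c σ.arm).exploring = true := hmode
      simp only [this, if_true]
      exact w6
    · exact absurd (hmode.symm.trans hf) (by decide)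

theorem Represents.update_stage [NeZero n] {s : Store} {σ : Learner n d}
    (h : s.Represents Ψ q σ) {c : Fin d → ℝ} {a : Fin n} (hc : ∀ j : Fin d, s.arr 2 j = c j)
    (hmode : σ.exploring = false) (h0 : s.reg 0 = a) (h15 : s.arr 15 a = σ.weight q a)
    (h44 : s.arr 44 0 = ∑ i, σ.weight q i) :
    (algorithm.update.exec Ψ s).Represents Ψ q (σ.step Ψ q c a) := by
  set u := (addLoad.exec Ψ s).tick 1 with hu
  have hu0 : u.Common q n (σ.load + c) σ.stage := (h.common.exec_addLoad hc).tick 1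
  have ur : ∀ r ∈ [0, 5, 6, 10], u.reg r = s.reg r := exec_regs addLoad s (by decide)
  have ua : ∀ a ∈ [2, 11, 12, 13, 14, 15, 38, 40, 44], u.arr a = s.arr a :=
    exec_arrs addLoad s (by decide)
  have u6 : u.reg 6 = if σ.exploring then 0 else 1 := by rw [ur 6 (by decide), h.mode]
  have u5 : u.reg 5 = 1 := hu0.r5
  have e : algorithm.update.exec Ψ s =
      if u.reg 6 < u.reg 5 then exploreUpdate.exec Ψ u else stageUpdate.exec Ψ u := rfl
  rw [e]
  have hs := h.stage hmode
  rw [if_neg (by rw [u6, u5, hmode]; decide)]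
  set v := observeProg.exec Ψ u with hv
  have hvc : v.Common q n (σ.load + c) σ.stage :=
    hu0.congr (exec_regs _ _ (by decide)) (exec_arrs _ _ (by decide))
  have hvs : v.Stage Ψ q (σ.observe Ψ q c a).est (σ.load + c) σ.stage :=
    Stage.exec_observe hu0 (hs.congr fun a m => ua a (by
      simp only [List.mem_cons, List.not_mem_nil, or_false] at m ⊢; omega))
      (by rw [ur 0 (by decide), h0]) (by rw [ua 15 (by decide), h15])
      (by rw [ua 44 (by decide), h44])
  have v6 : v.reg 6 = 1 := by
    rw [hv, exec_reg _ _ (by decide), u6, hmode]; rfl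
  have hmodeo : (σ.observe Ψ q c a).exploring = false := hmode
  have e' : stageUpdate.exec Ψ u = open Classical in
      if v.get (var 36) < v.get (var 40) then
      startStage.exec Ψ ((bin .div (var 37) (var 37) (var 43)).exec Ψ
        ((bin .add (var 36) (var 36) (var 36)).exec Ψ (v.tick 1)))
      else (v.tick 1).tick 1 := rfl
  clear_value v
  rw [e']
  have c36 : v.get (var 36) = q.bound σ.stage := by
    rw [Store.get, var, hvc.r4, hvc.bound]
  have c40 : v.get (var 40) = Ψ (q.eps σ.stage) (σ.load + c) := by
    rw [Store.get, var, hvc.r4, hvs.potential]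
  rw [c36, c40]
  by_cases hlt : q.bound σ.stage < Ψ (q.eps σ.stage) (σ.load + c)
  · have estep : σ.step Ψ q c a = (σ.observe Ψ q c a).restart := by
      simp only [Learner.step, hmode, hlt, if_true]
      rfl
    rw [if_pos hlt, estep]
    set w := (bin .div (var 37) (var 37) (var 43)).exec Ψ
        ((bin .add (var 36) (var 36) (var 36)).exec Ψ (v.tick 1)) with hw
    have hwc : w.Common q n (σ.load + c) (σ.stage + 1) := by
      refine hvc.of_frame (fun _ _ => rfl)
        (exec_arrs (seq (bin .add (var 36) (var 36) (var 36))
          (bin .div (var 37) (var 37) (var 43))) (v.tick 1) (by decide)) ?_ ?_ hvc.load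
      · have : w.arr 36 0 = v.arr 36 0 + v.arr 36 0 := by
          simp [hw, exec, Store.get, BinOp.eval, var, hvc.r4]
        rw [this, hvc.bound, Params.bound, Params.bound, pow_succ]
        ring
      · have : w.arr 37 0 = v.arr 37 0 / v.arr 43 0 := by
          simp [hw, exec, Store.get, BinOp.eval, var, hvc.r4]
        rw [this, hvc.eps, hvc.two, Params.eps, Params.eps, pow_succ, div_div _ _ (2 : ℝ)]
    have w6 : w.reg 6 = 1 := v6
    clear_value w
    obtain ⟨hzc, hze⟩ := Stage.exec_start (n := n) (Ψ := Ψ) hwc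
    have hmoder : (σ.observe Ψ q c a).restart.exploring = false := hmode
    refine ⟨hzc, ?_, fun ht => ?_, fun _ => hze⟩
    · rw [hmoder, exec_reg _ _ (by decide), w6]; rfl
    · exact absurd (hmoder.symm.trans ht) (by decide)
  · have estep : σ.step Ψ q c a = σ.observe Ψ q c a := by
      simp only [Learner.step, hmode, hlt, if_false]
      rfl
    rw [if_neg hlt, estep]
    refine ⟨(hvc.tick 1).tick 1, ?_, fun ht => ?_, fun _ => (hvs.tick 1).tick 1⟩
    · rw [hmodeo]; exact v6
    · exact absurd (hmodeo.symm.trans ht) (by decide)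

end Store

theorem sum_range_val {n : ℕ} {g : ℕ → ℝ} {f : Fin n → ℝ} (h : ∀ i : Fin n, g i = f i)
    (a : Fin n) : ∑ k ∈ Finset.range a, g k = ∑ i ∈ Finset.Iio a, f i := by
  rw [← Nat.Iio_eq_range, ← Fin.map_valEmbedding_Iio, Finset.sum_map]
  exact Finset.sum_congr rfl fun i _ => h i

theorem Store.action_val {n : ℕ} [NeZero n] {s : Store} (h : s.reg 0 < n) :
    (s.action n : ℕ) = s.reg 0 := Nat.mod_eq_of_lt h

/-- The random numbers on which an arm is played form an interval whose length is the probability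
of the arm. -/
theorem Store.Represents.select [NeZero n] {s : Store} {σ : Learner n d}
    (h : s.Represents Ψ q σ) (u : unitInterval) :
    let s' := algorithm.selected Ψ u s
    let a := s'.action n
    s'.Represents Ψ q σ ∧ (σ.exploring = true → a = σ.arm) ∧
    (σ.exploring = false → s'.reg 0 = a ∧ s'.arr 15 a = σ.weight q a ∧
      s'.arr 44 0 = ∑ i, σ.weight q i) ∧
    (u : ℝ) ∈ Set.Icc (∑ i ∈ Finset.Iio a, σ.prob q i)
      (∑ i ∈ Finset.Iio a, σ.prob q i + σ.prob q a) := by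
  intro s' a
  set v := s.setEntry 1 0 u with hv
  have hvR : v.Represents Ψ q σ := h.congr (fun _ _ => rfl) fun b m => by
    rw [hv, Store.setEntry_arr, Function.update_of_ne]
    revert b; decide
  have hR : s'.Represents Ψ q σ :=
    hvR.congr (exec_regs _ _ (by decide)) (exec_arrs _ _ (by decide))
  have e : s' = if v.reg 6 < v.reg 5 then (natAdd 0 10 4).exec Ψ (v.tick 1)
    else sample.exec Ψ (weigh.exec Ψ (v.tick 1)) := rfl
  have v6 := hvR.mode
  rw [v6, hvR.common.r5] at e
  cases hmode : σ.exploring with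
  | true =>
    rw [hmode, if_pos (by decide)] at e
    obtain ⟨-, h10⟩ := hvR.explore hmode
    have e0 : s'.reg 0 = σ.arm := by
      rw [e]
      simp [exec, h10, hvR.common.r4]
    have ha : a = σ.arm := Fin.ext (by
      rw [Store.action_val (by rw [e0]; exact σ.arm.2), e0])
    refine ⟨hR, fun _ => ha, fun hf => absurd hf (by decide), ?_⟩
    have h0 : ∑ i ∈ Finset.Iio a, σ.prob q i = 0 := Finset.sum_eq_zero fun i hi => by
      rw [Finset.mem_Iio, ha] at hi
      simp [Learner.prob, hmode, hi.ne]
    have h1 : σ.prob q a = 1 := by simp [Learner.prob, hmode, ha]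
    rw [h0, h1, zero_add]
    exact u.2
  | false =>
    rw [hmode, if_neg (by decide)] at e
    have hst := hvR.stage hmode
    obtain ⟨w1, w2⟩ := exec_weigh (Ψ := Ψ) (s := v.tick 1) hvR.common.r1 hvR.common.r4
      hvR.common.r5
    set w := weigh.exec Ψ (v.tick 1) with hw
    have e27 : (v.tick 1).arr 27 0 = q.rate := hvR.common.rate
    have e14 : ∀ i : Fin n, (v.tick 1).arr 14 i = σ.est i := hst.est
    have w15 : ∀ i : Fin n, w.arr 15 i = σ.weight q i := fun i => by
      rw [w1 i i.2, e27, e14, Learner.weight]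
    have w44 : w.arr 44 0 = ∑ i, σ.weight q i := by
      rw [w2, Finset.sum_range, e27]
      exact Finset.sum_congr rfl fun i _ => by rw [e14, Learner.weight]
    have wr : ∀ r ∈ [1, 4, 5], w.reg r = v.reg r := exec_regs weigh (v.tick 1) (by decide)
    have w10 : w.arr 1 0 = u := by
      rw [hw, exec_arr _ _ (by decide)]
      simp [hv]
    have hW : 0 < ∑ i, σ.weight q i :=
      Finset.sum_pos (fun i _ => Real.exp_pos _) Finset.univ_nonempty
    obtain ⟨k1, k2, k3⟩ := exec_sample (Ψ := Ψ) (NeZero.pos n) (s := w)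
      (by rw [wr 1 (by decide), hvR.common.r1]) (by rw [wr 4 (by decide), hvR.common.r4])
      (by rw [wr 5 (by decide), hvR.common.r5])
      (by rw [w10, w44]; exact mul_nonneg u.2.1 hW.le)
    rw [← e] at k1 k2 k3
    have ha : (a : ℕ) = s'.reg 0 := Store.action_val k1
    have s15 : s'.arr 15 = w.arr 15 := by rw [e, exec_arr _ _ (by decide)]
    have s44 : s'.arr 44 = w.arr 44 := by rw [e, exec_arr _ _ (by decide)]
    refine ⟨hR, fun hf => absurd hf (by decide), fun _ => ⟨ha.symm, by rw [s15, w15],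
      by rw [s44, w44]⟩, ?_⟩
    rw [← ha, sum_range_val w15, w10, w44] at k2
    have hp : ∀ i, σ.prob q i = σ.weight q i / ∑ i, σ.weight q i := fun i => by
      simp [Learner.prob, hmode]
    simp only [hp, ← Finset.sum_div, ← add_div]
    rw [Set.mem_Icc, div_le_iff₀ hW, le_div_iff₀ hW]
    refine ⟨k2, ?_⟩
    rw [← ha, Finset.sum_range_succ, sum_range_val w15, w15, w10, w44] at k3
    by_cases hlast : (a : ℕ) + 1 < n
    · exact k3 hlast
    -- The last arm takes the rest of the unit interval.
    · have : ∑ i ∈ Finset.Iio a, σ.weight q i + σ.weight q a = ∑ i, σ.weight q i := by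
        rw [add_comm, ← Finset.sum_insert (by simp)]
        refine Finset.sum_congr (Finset.eq_univ_of_forall fun i => ?_) fun _ _ => rfl
        have := i.2
        rw [Finset.mem_insert, Finset.mem_Iio, Fin.lt_def, Fin.ext_iff]
        omega
      rw [this]
      exact mul_le_of_le_one_left hW.le u.2.2

theorem represents_start [NeZero n] (hn : q.n = n) (hd : q.d = d) :
    (algorithm.init.exec Ψ q.store).Represents Ψ q (Learner.start : Learner n d) := by
  set s₁ := initInput.exec Ψ q.store with hs₁
  set s₂ := initScale.exec Ψ s₁ with hs₂
  set s₃ := initExplore.exec Ψ s₂ with hs₃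
  set s₄ := initStage.exec Ψ s₃ with hs₄
  have e : algorithm.init.exec Ψ q.store = s₄ := rfl
  have r4 : s₁.reg 4 = 0 := exec_reg _ _ (by decide)
  have r5 : s₁.reg 5 = 1 := by simp [hs₁, initInput, block, exec]
  have v0 : s₁.arr 0 0 = q.p := by
    rw [hs₁, exec_arr _ _ (by decide)]
    rfl
  have v20 : s₁.arr 20 0 = q.α := by
    simp [hs₁, initInput, block, exec, var, Store.get, Params.store]
  have v21 : s₁.arr 21 0 = q.γ := by
    simp [hs₁, initInput, block, exec, var, Store.get, Params.store]
  have v22 : s₁.arr 22 0 = q.normOne := by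
    simp [hs₁, initInput, block, exec, var, Store.get, Params.store]
  have v23 : s₁.arr 23 0 = q.n := by
    simp [hs₁, initInput, block, exec, var, Store.get, Params.store]
  have v24 : s₁.arr 24 0 = q.T := by
    simp [hs₁, initInput, block, exec, var, Store.get, Params.store]
  have v39 : s₁.arr 39 0 = 1 := by
    simp [hs₁, initInput, block, exec, var, Store.get, Params.store]
  have v43 : s₁.arr 43 0 = 2 := by
    simp [hs₁, initInput, block, exec, var, Store.get, Params.store]
  have k4 : s₂.reg 4 = 0 := r4
  have v25 : s₂.arr 25 0 = q.logTerm := by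
    simp [hs₂, initScale, block, exec, var, Store.get, UnOp.eval, BinOp.eval, r4, v0, v23,
      Params.logTerm]
  have v26 : s₂.arr 26 0 = q.scale := by
    simp [hs₂, initScale, block, exec, var, Store.get, UnOp.eval, BinOp.eval, r4, v0, v23, v24,
      v43, Params.logTerm, Params.scale]
  have v27 : s₂.arr 27 0 = q.rate := by
    simp [hs₂, initScale, block, exec, var, Store.get, UnOp.eval, BinOp.eval, r4, v0, v23, v24,
      v43, Params.logTerm, Params.scale, Params.rate]
  have v28 : s₂.arr 28 0 = q.rate / 2 := by
    simp [hs₂, initScale, block, exec, var, Store.get, UnOp.eval, BinOp.eval, r4, v0, v23, v24,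
      v43, Params.logTerm, Params.scale, Params.rate]
  have v29 : s₂.arr 29 0 = q.quota := by
    simp [hs₂, initScale, block, exec, var, Store.get, UnOp.eval, BinOp.eval, r4, v0, v23, v24,
      v43, Params.logTerm, Params.scale, Params.quota]
  have f₂ : ∀ a ∈ [20, 21, 22, 39], s₂.arr a = s₁.arr a := exec_arrs _ _ (by decide)
  have l4 : s₃.reg 4 = 0 := by rw [hs₃, exec_reg _ _ (by decide), k4]
  have v30 : s₃.arr 30 0 = q.offset := by
    simp [hs₃, initExplore, block, exec, var, Store.get, BinOp.eval, k4, v25, v29, Params.offset]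
  have v31 : s₃.arr 31 0 = q.unit := by
    simp [hs₃, initExplore, block, exec, var, Store.get, BinOp.eval, k4, f₂, v20, v22,
      Params.unit]
  have v32 : s₃.arr 32 0 = q.cutoff := by
    simp [hs₃, initExplore, block, exec, var, Store.get, BinOp.eval, k4, f₂, v20, v22, v25,
      Params.unit, Params.cutoff]
  have v33 : s₃.arr 33 0 = q.exploreEps := by
    simp [hs₃, initExplore, block, exec, var, Store.get, BinOp.eval, k4, f₂, v21, v22, v25, v29,
      v39, Params.offset, Params.exploreEps]
  have v38 : s₃.arr 38 0 = q.offset := by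
    simp [hs₃, initExplore, block, exec, var, Store.get, BinOp.eval, k4, v25, v29, Params.offset]
  have f₃ : ∀ a ∈ [20, 21, 22, 26, 39], s₃.arr a = s₂.arr a := exec_arrs _ _ (by decide)
  have v36 : s₄.arr 36 0 = q.bound 0 := by
    simp [hs₄, initStage, block, exec, var, Store.get, BinOp.eval, l4, f₃, f₂, v20, v21, v22, v26,
      v31, Params.bound, Params.guess]
  have v37 : s₄.arr 37 0 = q.eps 0 := by
    simp [hs₄, initStage, block, exec, var, Store.get, BinOp.eval, l4, f₃, f₂, v20, v21, v22, v26,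
      v31, v39, Params.eps, Params.guess]
  have fr : ∀ r ∈ [1, 2, 4, 6, 10], s₄.reg r = q.store.reg r :=
    exec_regs algorithm.init _ (by decide)
  have f₀ : ∀ a ∈ [10, 11, 12, 13], s₄.arr a = q.store.arr a :=
    exec_arrs algorithm.init _ (by decide)
  have zero : ∀ a ∈ [10, 11, 12, 13], ∀ k, s₄.arr a k = 0 := fun a m k => by
    rw [f₀ a m]
    exact if_neg (by rintro rfl; revert m; decide)
  have f₄₃ : ∀ a ∈ [31, 32, 33, 38], s₄.arr a = s₃.arr a := exec_arrs _ _ (by decide)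
  have f₄₂ : ∀ a ∈ [27, 28, 29], s₄.arr a = s₂.arr a :=
    exec_arrs (seq initExplore initStage) _ (by decide)
  have f₄₁ : ∀ a ∈ [39, 43], s₄.arr a = s₁.arr a :=
    exec_arrs (seq initScale (seq initExplore initStage)) _ (by decide)
  rw [e]
  refine ⟨⟨?_, ?_, ?_, ?_, ?_, ?_, ?_, ?_, ?_, ?_, ?_, ?_, v36, v37, ?_⟩, ?_, fun _ => ⟨⟨?_, ?_,
    ?_, ?_⟩, ?_⟩, fun hf => absurd hf (by simp [Learner.start])⟩
  · rw [fr 1 (by decide)]; exact hn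
  · rw [fr 2 (by decide)]; exact hd
  · rw [fr 4 (by decide)]; rfl
  · exact (exec_reg (seq initScale (seq initExplore initStage)) s₁ (by decide)).trans r5
  · rw [f₄₂ 27 (by decide), v27]
  · rw [f₄₂ 28 (by decide), v28]
  · rw [f₄₂ 29 (by decide), v29]
  · rw [f₄₃ 31 (by decide), v31]
  · rw [f₄₃ 32 (by decide), v32]
  · rw [f₄₃ 33 (by decide), v33]
  · rw [f₄₁ 39 (by decide), v39]
  · rw [f₄₁ 43 (by decide), v43]
  · exact fun j => zero 10 (by decide) j
  · rw [fr 6 (by decide)]; rfl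
  · exact fun i j => zero 11 (by decide) _
  · exact fun i => zero 12 (by decide) _
  · exact fun i => zero 13 (by decide) _
  · rw [f₄₃ 38 (by decide), v38]
    simp [Learner.start]
  · rw [fr 10 (by decide)]; rfl

end VectorBandits

/-! ### The law of the history -/

namespace VectorBandits

open MeasureTheory

section Cells

variable {n d : ℕ} {Ψ : ℝ → (Fin d → ℝ) → ℝ} {q : Params}

/-- The random numbers for which arm `a` is played in state `σ`. -/
noncomputable def Learner.cell (q : Params) (σ : Learner n d) (a : Fin n) : Set unitInterval :=
  {u | (u : ℝ) ∈ Set.Icc (∑ i ∈ Finset.Iio a, σ.prob q i)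
    (∑ i ∈ Finset.Iio a, σ.prob q i + σ.prob q a)}

theorem Learner.measurableSet_cell (q : Params) (σ : Learner n d) (a : Fin n) :
    MeasurableSet (σ.cell q a) := measurable_subtype_coe measurableSet_Icc

theorem Learner.volume_cell_le (q : Params) (σ : Learner n d) (a : Fin n) :
    volume (σ.cell q a) ≤ ENNReal.ofReal (σ.prob q a) := by
  rw [← volume_image_subtype_coe (s := unitInterval) measurableSet_Icc]
  refine (measure_mono (t := Set.Icc (∑ i ∈ Finset.Iio a, σ.prob q i)
    (∑ i ∈ Finset.Iio a, σ.prob q i + σ.prob q a)) ?_).trans ?_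
  · rintro _ ⟨u, hu, rfl⟩
    exact hu
  · rw [Real.volume_Icc, add_sub_cancel_left]

/-- The histories of a given length. -/
def histories (n : ℕ) : ℕ → Finset (List (Fin n))
  | 0 => {[]}
  | t + 1 => (histories n t ×ˢ Finset.univ).map
      ⟨fun x => x.2 :: x.1, fun x y h => by
        simp only [List.cons.injEq] at h
        exact Prod.ext h.2 h.1⟩

theorem mem_histories {t : ℕ} {h : List (Fin n)} : h ∈ histories n t ↔ h.length = t := by
  induction t generalizing h with
  | zero => simp [histories]
  | succ t ih =>
    cases h with
    | nil => simp [histories]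
    | cons a h =>
      simp only [histories, Finset.mem_map, Finset.mem_product, Finset.mem_univ, and_true, ih,
        List.length_cons, Nat.add_right_cancel_iff]
      constructor
      · rintro ⟨x, hx, he⟩
        obtain ⟨-, rfl⟩ := List.cons.inj he
        exact hx
      · exact fun hl => ⟨(h, a), hl, rfl⟩

theorem sum_histories_succ (f : List (Fin n) → ℝ) (t : ℕ) :
    ∑ h ∈ histories n (t + 1), f h = ∑ h ∈ histories n t, ∑ a, f (a :: h) := by
  rw [histories, Finset.sum_map, Finset.sum_product]
  rfl

end Cells

section Law

variable {n d : ℕ} [NeZero n] {Ψ : ℝ → (Fin d → ℝ) → ℝ} {q : Params}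

/-- The memory of the machine represents the state of the learner, throughout the interaction. -/
theorem play_represents (hn : q.n = n) (hd : q.d = d) (C : Adversary d n)
    (ω : ℕ → unitInterval) (t : ℕ) :
    (algorithm.play Ψ q C ω t).store.Represents Ψ q
      (Learner.run Ψ q C (algorithm.play Ψ q C ω t).history) := by
  induction t with
  | zero => exact represents_start hn hd
  | succ t ih =>
    set g := algorithm.play Ψ q C ω t with hg
    obtain ⟨h1, h2, h3, -⟩ := ih.select (ω t)
    set s := algorithm.selected Ψ (ω t) g.store with hs
    set a := s.action n with ha
    have e : algorithm.play Ψ q C ω (t + 1) =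
      { store := algorithm.update.exec Ψ (s.setVec 2 fun i => C g.history i a)
        history := a :: g.history } := rfl
    rw [e]
    set s' := s.setVec 2 fun i => C g.history i a with hs'
    have fa : ∀ b, b ≠ 2 → s'.arr b = s.arr b := fun b hb => Store.setVec_arr_of_ne _ _ hb
    have hR : s'.Represents Ψ q (Learner.run Ψ q C g.history) :=
      h1.congr (fun _ _ => rfl) fun b m => fa b (by rintro rfl; revert m; decide)
    have hc : ∀ j : Fin d, s'.arr 2 j = C g.history j a := fun j => Store.setVec_arr_self _ _ _ j
    cases hmode : (Learner.run Ψ q C g.history).exploring with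
    | true =>
      have := hR.update_explore hc hmode
      rwa [← h2 hmode] at this
    | false =>
      obtain ⟨k1, k2, k3⟩ := h3 hmode
      exact hR.update_stage hc hmode k1 (by rw [fa 15 (by decide), k2])
        (by rw [fa 44 (by decide), k3])

/-- The random numbers of the rounds that lead to a given history. -/
noncomputable def historyCells (Ψ : ℝ → (Fin d → ℝ) → ℝ) (q : Params) (C : Adversary d n) :
    List (Fin n) → ℕ → Set unitInterval
  | [], _ => Set.univ
  | a :: h, t => if t = h.length then (Learner.run Ψ q C h).cell q a else historyCells Ψ q C h t

theorem measurableSet_historyCells (C : Adversary d n) (h : List (Fin n)) (t : ℕ) :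
    MeasurableSet (historyCells Ψ q C h t) := by
  induction h with
  | nil => exact MeasurableSet.univ
  | cons a h ih =>
    unfold historyCells
    split_ifs
    · exact Learner.measurableSet_cell _ _ _
    · exact ih

theorem length_history (C : Adversary d n) (ω : ℕ → unitInterval) (t : ℕ) :
    (algorithm.play Ψ q C ω t).history.length = t := by
  induction t with
  | zero => rfl
  | succ t ih => exact congrArg (· + 1) ih

theorem mem_historyCells (hn : q.n = n) (hd : q.d = d) (C : Adversary d n)
    (ω : ℕ → unitInterval) (t : ℕ) :
    ∀ s < t, ω s ∈ historyCells Ψ q C (algorithm.play Ψ q C ω t).history s := by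
  induction t with
  | zero => exact fun s hs => absurd hs (Nat.not_lt_zero s)
  | succ t ih =>
    intro s hs
    have e : (algorithm.play Ψ q C ω (t + 1)).history =
      (algorithm.selected Ψ (ω t) (algorithm.play Ψ q C ω t).store).action n ::
        (algorithm.play Ψ q C ω t).history := rfl
    rw [e, historyCells, length_history]
    split_ifs with hst
    · rw [hst]
      exact ((play_represents hn hd C ω t).select (ω t)).2.2.2
    · exact ih s (by omega)

theorem prod_volume_historyCells_le (C : Adversary d n) (h : List (Fin n)) :
    ∏ t ∈ Finset.range h.length, volume (historyCells Ψ q C h t) ≤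
      ENNReal.ofReal (historyWeight Ψ q C h) := by
  induction h with
  | nil => simp [historyWeight]
  | cons a h ih =>
    rw [List.length_cons, Finset.prod_range_succ, historyWeight,
      ENNReal.ofReal_mul (historyWeight_nonneg Ψ q C h)]
    refine mul_le_mul' ((Finset.prod_congr rfl fun t ht => ?_).trans_le ih) ?_
    · rw [historyCells, if_neg (Finset.mem_range.mp ht).ne]
    · rw [historyCells, if_pos rfl]
      exact Learner.volume_cell_le _ _ _

theorem seedLaw_history_le (hn : q.n = n) (hd : q.d = d) (C : Adversary d n)
    (h : List (Fin n)) :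
    seedLaw {ω | (algorithm.play Ψ q C ω h.length).history = h} ≤
      ENNReal.ofReal (historyWeight Ψ q C h) := by
  refine le_trans ?_ (prod_volume_historyCells_le C h)
  rw [seedLaw, ← Measure.infinitePi_pi (μ := fun _ : ℕ => (volume : Measure unitInterval))
    fun t _ => measurableSet_historyCells C h t]
  refine measure_mono fun ω hω t ht => ?_
  have := mem_historyCells (Ψ := Ψ) hn hd C ω h.length t (by simpa using ht)
  rwa [Set.mem_ofPred_eq.mp hω] at this

end Law

/-! ### The loads of the algorithm and of the comparators -/

section Loads

variable {n d : ℕ} {Ψ : ℝ → (Fin d → ℝ) → ℝ} {q : Params}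

theorem Ledger.step_total (g : Ledger n d) (σ : Learner n d) (M : Matrix (Fin d) (Fin n) ℝ)
    (a : Fin n) : (g.step Ψ q σ M a).total = g.total + fun j => M j a := by
  unfold Ledger.step
  dsimp only
  split_ifs <;> rfl

theorem Ledger.step_colTotal (g : Ledger n d) (σ : Learner n d) (M : Matrix (Fin d) (Fin n) ℝ)
    (a : Fin n) : (g.step Ψ q σ M a).colTotal = fun i j => g.colTotal i j + M j i := by
  unfold Ledger.step
  dsimp only
  split_ifs <;> rfl

theorem run_total [NeZero n] (C : Adversary d n) (ω : ℕ → unitInterval) (t : ℕ) :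
    (Ledger.run Ψ q C (algorithm.play Ψ q C ω t).history).total =
      ∑ s ∈ Finset.range t, (algorithm.costMatrix Ψ q C ω s).mulVec
        (algorithm.actionVector Ψ q C ω s) := by
  induction t with
  | zero => rfl
  | succ t ih =>
    have e : (algorithm.play Ψ q C ω (t + 1)).history =
      (algorithm.selected Ψ (ω t) (algorithm.play Ψ q C ω t).store).action n ::
        (algorithm.play Ψ q C ω t).history := rfl
    rw [e, Ledger.run, Ledger.step_total, ih, Finset.sum_range_succ,
      BanditAlgorithm.actionVector, Matrix.mulVec_single_one]
    rfl

theorem run_colTotal [NeZero n] (C : Adversary d n) (ω : ℕ → unitInterval) (t : ℕ) (x : Fin n → ℝ) :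
    ∑ i, x i • (Ledger.run Ψ q C (algorithm.play Ψ q C ω t).history).colTotal i =
      ∑ s ∈ Finset.range t, (algorithm.costMatrix Ψ q C ω s).mulVec x := by
  induction t with
  | zero =>
    refine Finset.sum_eq_zero fun i _ => ?_
    exact smul_zero (x i)
  | succ t ih =>
    have e : (algorithm.play Ψ q C ω (t + 1)).history =
      (algorithm.selected Ψ (ω t) (algorithm.play Ψ q C ω t).store).action n ::
        (algorithm.play Ψ q C ω t).history := rfl
    rw [e, Ledger.run, Ledger.step_colTotal, Finset.sum_range_succ, ← ih]
    funext j
    simp only [Finset.sum_apply, Pi.smul_apply, Pi.add_apply, smul_eq_mul, mul_add,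
      Finset.sum_add_distrib, Matrix.mulVec, dotProduct, BanditAlgorithm.costMatrix]
    congr 1
    exact Finset.sum_congr rfl fun i _ => mul_comm _ _

end Loads

/-! ### The probability of failure -/

namespace Regime

variable {n d : ℕ} [NeZero n] {q : Params} {N : Seminorm ℝ (Fin d → ℝ)}
  {Ψ : ℝ → (Fin d → ℝ) → ℝ} (R : Regime n d q N Ψ)
include R

theorem weight_mul_value_nonneg {C : Adversary d n} (hC : C.IsBounded) (h : List (Fin n))
    (ht : h.length ≤ q.T) :
    0 ≤ historyWeight Ψ q C h * (Ledger.run Ψ q C h).value q (Learner.run Ψ q C h) := by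
  by_cases hw : historyWeight Ψ q C h = 0
  · rw [hw, zero_mul]
  · refine mul_nonneg (historyWeight_nonneg Ψ q C h) ?_
    unfold Ledger.value
    split_ifs with hex
    · exact zero_le_one
    · have h1 := ((R.runInv hC h ht hw).stage (by simpa using hex)).1.past_nonneg
      have h2 := Ledger.deviation_nonneg q (Learner.run Ψ q C h).est (Ledger.run Ψ q C h).lossStage
      positivity

/-- The expectation of the supermartingale is at most one. -/
theorem sum_weight_mul_value_le {C : Adversary d n} (hC : C.IsBounded) (t : ℕ) (ht : t ≤ q.T) :
    ∑ h ∈ histories n t,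
      historyWeight Ψ q C h * (Ledger.run Ψ q C h).value q (Learner.run Ψ q C h) ≤ 1 := by
  induction t with
  | zero => simp [histories, historyWeight, Learner.run, Learner.start, Ledger.value]
  | succ t ih =>
    rw [sum_histories_succ]
    refine (Finset.sum_le_sum fun h hh => ?_).trans (ih (by omega))
    rw [mem_histories] at hh
    by_cases hw : historyWeight Ψ q C h = 0
    · simp [historyWeight, hw]
    · have := mul_le_mul_of_nonneg_left
        (R.sum_prob_mul_value_le (R.runInv hC h (by omega) hw) (hC h))
        (historyWeight_nonneg Ψ q C h)
      refine le_trans (le_of_eq ?_) this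
      rw [Finset.mul_sum]
      exact Finset.sum_congr rfl fun a _ => by rw [historyWeight, mul_assoc]; rfl

/-- Markov's inequality for the supermartingale. -/
theorem seedLaw_le (hd : q.d = d) {C : Adversary d n} (hC : C.IsBounded) :
    seedLaw {ω | ¬ ∀ x ∈ stdSimplex ℝ (Fin n),
      N (∑ t ∈ Finset.range q.T, (algorithm.costMatrix Ψ q C ω t).mulVec
          (algorithm.actionVector Ψ q C ω t)) ≤
        600 * ((q.α + q.γ) * N (∑ t ∈ Finset.range q.T,
          (algorithm.costMatrix Ψ q C ω t).mulVec x) + q.unit * q.scale)} ≤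
      ENNReal.ofReal q.p := by
  classical
  set v : List (Fin n) → ℝ := fun h => (Ledger.run Ψ q C h).value q (Learner.run Ψ q C h) with hv
  -- Histories of weight zero need not satisfy the invariants; they contribute nothing.
  set F := (histories n q.T).filter fun h => historyWeight Ψ q C h = 0 ∨ 1 / q.p ≤ v h with hF
  have hsub : {ω | ¬ ∀ x ∈ stdSimplex ℝ (Fin n),
      N (∑ t ∈ Finset.range q.T, (algorithm.costMatrix Ψ q C ω t).mulVec
          (algorithm.actionVector Ψ q C ω t)) ≤
        600 * ((q.α + q.γ) * N (∑ t ∈ Finset.range q.T,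
          (algorithm.costMatrix Ψ q C ω t).mulVec x) + q.unit * q.scale)} ⊆
      ⋃ h ∈ F, {ω | (algorithm.play Ψ q C ω h.length).history = h} := by
    intro ω hω
    rw [Set.mem_iUnion₂]
    have hlen := length_history (Ψ := Ψ) (q := q) C ω q.T
    refine ⟨(algorithm.play Ψ q C ω q.T).history, ?_, by rw [Set.mem_ofPred_eq, hlen]⟩
    rw [hF, Finset.mem_filter, mem_histories]
    refine ⟨hlen, ?_⟩
    by_contra! hgood
    refine hω fun x hx => ?_
    have := R.norm_total_le (R.runInv hC _ hlen.le hgood.1) hlen.le hgood.2 hx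
    rwa [run_total, run_colTotal] at this
  calc _ ≤ seedLaw (⋃ h ∈ F, {ω | (algorithm.play Ψ q C ω h.length).history = h}) :=
        measure_mono hsub
    _ ≤ ∑ h ∈ F, seedLaw {ω | (algorithm.play Ψ q C ω h.length).history = h} :=
        measure_biUnion_finset_le _ _
    _ ≤ ∑ h ∈ F, ENNReal.ofReal (historyWeight Ψ q C h) :=
        Finset.sum_le_sum fun h _ => seedLaw_history_le R.n_eq hd C h
    _ = ENNReal.ofReal (∑ h ∈ F, historyWeight Ψ q C h) :=
        (ENNReal.ofReal_sum_of_nonneg fun h _ => historyWeight_nonneg Ψ q C h).symm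
    _ ≤ ENNReal.ofReal q.p := ENNReal.ofReal_le_ofReal ?_
  have hp := R.p_pos
  calc ∑ h ∈ F, historyWeight Ψ q C h ≤ ∑ h ∈ F, q.p * (historyWeight Ψ q C h * v h) := by
        refine Finset.sum_le_sum fun h hh => ?_
        rw [hF, Finset.mem_filter] at hh
        rcases hh.2 with h0 | h1
        · rw [h0, zero_mul, mul_zero]
        · rw [div_le_iff₀ hp] at h1
          nlinarith [historyWeight_nonneg Ψ q C h]
    _ = q.p * ∑ h ∈ F, historyWeight Ψ q C h * v h := (Finset.mul_sum _ _ _).symm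
    _ ≤ q.p * ∑ h ∈ histories n q.T, historyWeight Ψ q C h * v h := by
        refine mul_le_mul_of_nonneg_left (Finset.sum_le_sum_of_subset_of_nonneg
          (Finset.filter_subset _ _) fun h hh _ => ?_) hp.le
        exact R.weight_mul_value_nonneg hC h (mem_histories.mp hh).le
    _ ≤ q.p := mul_le_of_le_one_right hp.le (R.sum_weight_mul_value_le hC _ le_rfl)

end Regime

/-- If the horizon is short, then the load of any algorithm is small. -/
theorem norm_sum_le_of_short {n d : ℕ} {N : Seminorm ℝ (Fin d → ℝ)} (hN : IsMonotoneNorm N)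
    {T : ℕ} {v : ℕ → Fin d → ℝ} (hv : ∀ t j, v t j ∈ Set.Icc (0 : ℝ) 1) {L : ℝ}
    (hT : (T : ℝ) ≤ n * L) :
    N (∑ t ∈ Finset.range T, v t) ≤ N 1 * √(T * n * L) := by
  have h1 : N (∑ t ∈ Finset.range T, v t) ≤ N ((T : ℝ) • 1) := by
    refine hN.mono _ _ (fun j => ?_) fun j => ?_
    · rw [Finset.sum_apply]
      exact Finset.sum_nonneg fun t _ => (hv t j).1
    · rw [Finset.sum_apply]
      refine (Finset.sum_le_sum fun t _ => (hv t j).2).trans (le_of_eq ?_)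
      simp
  refine h1.trans ?_
  rw [map_smul_eq_mul, Real.norm_of_nonneg (Nat.cast_nonneg T), mul_comm]
  refine mul_le_mul_of_nonneg_left (Real.le_sqrt_of_sq_le ?_) (apply_nonneg N 1)
  rw [sq, mul_assoc]
  exact mul_le_mul_of_nonneg_left hT (Nat.cast_nonneg T)

/-- The regret bound outside the regime of the analysis, where it is trivial. -/
theorem norm_sum_le_of_trivial {n d T : ℕ} [NeZero n] {α γ L : ℝ} {N : Seminorm ℝ (Fin d → ℝ)}
    {Ψ : ℝ → (Fin d → ℝ) → ℝ} (hN : IsMonotoneNorm N)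
    (hΨ : IsGradStableApprox N (1 / 4) α γ Ψ) (h : d = 0 ∨ n = 1 ∨ (T : ℝ) ≤ n * L)
    {M : ℕ → Matrix (Fin d) (Fin n) ℝ} (hM : ∀ t i j, M t i j ∈ Set.Icc (0 : ℝ) 1)
    (a : ℕ → Fin n) {x : Fin n → ℝ} (hx : x ∈ stdSimplex ℝ (Fin n)) :
    N (∑ t ∈ Finset.range T, (M t).mulVec (Pi.single (a t) 1)) ≤
      600 * ((α + γ) * N (∑ t ∈ Finset.range T, (M t).mulVec x) +
        α * N 1 * √(T * n * L)) := by
  by_cases hd : d = 0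
  -- All norms vanish on `ℝ ^ 0`.
  · subst hd
    have h0 : ∀ y : Fin 0 → ℝ, N y = 0 := fun y => by rw [Subsingleton.elim y 0, map_zero]
    simp [h0]
  have : NeZero d := ⟨hd⟩
  have hα := one_le_of_isGradStableApprox hN hΨ
  have hγ := nonneg_of_le_nonneg_at_zero hΨ
  have h1 : 0 ≤ N 1 * √(T * n * L) := mul_nonneg (apply_nonneg N 1) (Real.sqrt_nonneg _)
  have h2 : 0 ≤ N (∑ t ∈ Finset.range T, (M t).mulVec x) := apply_nonneg N _
  have h3 : 0 ≤ (α + γ) * N (∑ t ∈ Finset.range T, (M t).mulVec x) :=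
    mul_nonneg (by linarith) h2
  rw [mul_assoc]
  rcases h with h | h | h
  · exact absurd h hd
  -- The only arm is the only comparator.
  · subst h
    have e : ∀ t, (Pi.single (a t) 1 : Fin 1 → ℝ) = x := fun t => by
      funext i
      have := hx.2
      rw [Fin.sum_univ_one] at this
      rw [Subsingleton.elim (a t) 0, Subsingleton.elim i 0, this]
      simp
    simp only [e]
    nlinarith
  · have := norm_sum_le_of_short hN (v := fun t => (M t).mulVec (Pi.single (a t) 1))
      (fun t j => by simpa [Matrix.mulVec_single_one] using hM t j (a t)) h
    nlinarith

end VectorBandits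

open VectorBandits in
theorem mainTheorem5 :
    ∃ (A : BanditAlgorithm) (K : ℝ) (k : ℕ),
      ∀ (n d T : ℕ) [NeZero n] (p α γ : ℝ) (N : Seminorm ℝ (Fin d → ℝ))
        (Ψ : ℝ → (Fin d → ℝ) → ℝ),
        0 < p → p ≤ 1 → IsMonotoneNorm N → IsGradStableApprox N (1 / 4) α γ Ψ →
        ∀ (C : Adversary d n), C.IsBounded →
          let q : Params := ⟨n, d, T, p, α, γ, N 1⟩
          (∀ ω : ℕ → unitInterval,
            (A.play Ψ q C ω T).store.steps ≤ k * (n + d + T + 1) ^ k) ∧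
          seedLaw {ω | ¬ ∀ x ∈ stdSimplex ℝ (Fin n),
            N (∑ t ∈ Finset.range T,
                (A.costMatrix Ψ q C ω t).mulVec (A.actionVector Ψ q C ω t)) ≤
              K * ((α + γ) * N (∑ t ∈ Finset.range T, (A.costMatrix Ψ q C ω t).mulVec x) +
                α * N 1 * √(T * n * Real.log (n / p)))} ≤ ENNReal.ofReal p := by
  obtain ⟨k, hk⟩ := algorithm.exists_steps_le algorithm_loops.1 algorithm_loops.2.1
    algorithm_loops.2.2
  refine ⟨algorithm, 600, k, fun n d T _ p α γ N Ψ hp hp1 hN hΨ C hC => ?_⟩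
  refine ⟨fun ω => hk n d T p α γ (N 1) Ψ C ω, ?_⟩
  by_cases htriv : d = 0 ∨ n = 1 ∨ (T : ℝ) ≤ n * Real.log (n / p)
  · have hempty : ∀ ω : ℕ → unitInterval, ∀ x ∈ stdSimplex ℝ (Fin n), _ := fun ω x hx =>
      norm_sum_le_of_trivial (T := T) hN hΨ htriv
        (M := algorithm.costMatrix Ψ ⟨n, d, T, p, α, γ, N 1⟩ C ω) (fun t => hC _)
        (fun t => (algorithm.selected Ψ (ω t)
          (algorithm.play Ψ ⟨n, d, T, p, α, γ, N 1⟩ C ω t).store).action n) hx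
    refine le_of_eq_of_le (b := 0) ?_ zero_le
    rw [← MeasureTheory.measure_empty (μ := seedLaw)]
    congr 1
    exact Set.eq_empty_of_forall_notMem fun ω hω => hω (hempty ω)
  · push Not at htriv
    have hn2 : 2 ≤ n := by
      have := NeZero.pos n
      omega
    have R : Regime n d ⟨n, d, T, p, α, γ, N 1⟩ N Ψ :=
      ⟨rfl, hn2, htriv.1, hp, hp1, rfl, htriv.2.2.le, hN, hΨ⟩
    have := R.seedLaw_le rfl hC
    rw [R.scale_eq_sqrt] at this
    exact this
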